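/- Let $M$ be a compact smooth Riemannian manifold without boundary, $m$ its normalized Riemannian volume, and $r=k+\gamma>1$ with $k\ge 1$ an integer and $0\le\gamma\le1$; $C^{r}$ means $C^k$ with $\gamma$-Hölder $k$-th derivative (for $\gamma=0$: just $C^k$), $C^{r-1}(M)$ is the space of complex functions of class $C^{r-1}=C^{(k-1)+\gamma}$ with a usual $C^{r-1}$ norm (computed in finitely many charts), and $C^r(M,M)$ carries a usual $C^r$ metric $d_{C^r}$. Let $\Omega$ be a separable metric space with a probability measure $P$ on a $\sigma$-algebra containing the Borel sets, and let $\theta:\Omega\to\Omega$ be measurable and $P$-preserving. For $u\in L^\infty_P(\Omega)$ let $\ell_\theta u\in L^\infty_P(\Omega)$ be defined by $\int \ell_\theta u\cdot\varphi\,dP=\int u\cdot\varphi\circ\theta\,dP$ for all $\varphi\in L^1_P(\Omega)$. Let $L^\infty_P(\Omega,C^{r-1}(M))$ be the Bochner space of (classes of) Bochner measurable, essentially bounded maps, and assume there is a bounded operator $\tilde\ell_\theta$ on it such that, for all $u$, all $x\in M$, all bounded linear functionals $A$ on $C^{r-1}(M)$ and all bounded operators $\mathcal A$ on $C^{r-1}(M)$,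 $P$-almost surely $\tilde\ell_\theta u(\cdot)(x)=\ell_\theta[u(\cdot)(x)]$, $A\,\tilde\ell_\theta u=\ell_\theta[Au]$, $\mathcal A\,\tilde\ell_\theta u=\tilde\ell_\theta[\mathcal Au]$, and moreover $\|\tilde\ell_\theta u\|_{L^\infty}\le\|u\|_{L^\infty}$. Call $f:M\to M$ expanding if $\|Df^n(x)v\|\ge C\lambda^n\|v\|$ for all $n\ge1$, $x$, $v$, with some $C>0$, $\lambda>1$. Let $f_0\in C^r(M,M)$ be expanding and let $f_\epsilon:\Omega\to C^r(M,M)$, $\epsilon>0$, be continuous with $\operatorname{ess\,sup}_\omega d_{C^r}(f_\epsilon(\omega),f_0)\to0$ as $\epsilon\to0$. Put $L(f)w(x)=\sum_{f(y)=x}w(y)/|\det Df(y)|$, $(\tilde{\mathcal L}_\epsilon u)(\omega)=L(f_\epsilon(\omega))u(\omega)$, $\mathcal L_\epsilon=\tilde\ell_\theta\tilde{\mathcal L}_\epsilon$, and $$K=K_P(\Omega,C^{r-1}(M))=\Big\{u\in L^\infty_P(\Omega,C^{r-1}(M)):\ \omega\mapsto\textstyle\int u(\omega)\,dm\ \text{is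 constant $P$-a.s.}\Big\}.$$ Then: (1) For every $u\in L^\infty_P(\Omega,C^{r-1}(M))$ the function $\omega\mapsto\int u(\omega)\,dm$ is $P$-measurable; $K$ is a closed subspace of $L^\infty_P(\Omega,C^{r-1}(M))$, and it is complete, i.e. a Banach space. (2) If $\int u(\omega)\,dm=c$ for $P$-a.e. $\omega$, then $\int \tilde\ell_\theta u(\omega)\,dm=c$ for $P$-a.e. $\omega$. (3) For every expanding $g\in C^r(M,M)$ the fibers $g^{-1}(x)$ are finite and $L(g)$ maps $C^{r-1}(M)$ into itself. (4) Let $\epsilon>0$ be such that $f_\epsilon(\omega)$ is expanding for $P$-a.e. $\omega$. Then $\int\tilde{\mathcal L}_\epsilon u(\omega)\,dm=\int u(\omega)\,dm$ for $P$-a.e. $\omega$, for all $u\in L^\infty_P(\Omega,C^{r-1}(M))$; and if $u\in K$ and $\tilde{\mathcal L}_\epsilon u\in L^\infty_P(\Omega,C^{r-1}(M))$, then $\tilde{\mathcal L}_\epsilon u\in K$ and $\mathcal L_\epsilon u\in K$. (5) For all sufficiently small $\epsilon>0$: $f_\epsilon(\omega)$ is expanding for $P$-a.e. $\omega$; there is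 a constant $C$ with $\|L(f_\epsilon(\omega))w\|_{C^{r-1}}\le C\|w\|_{C^{r-1}}$ for $P$-a.e. $\omega$ and all $w\in C^{r-1}(M)$; for each $u\in L^\infty_P(\Omega,C^{r-1}(M))$ such that $\tilde{\mathcal L}_\epsilon u$ is Bochner measurable one has $\tilde{\mathcal L}_\epsilon u\in L^\infty_P(\Omega,C^{r-1}(M))$, and $\mathcal L_\epsilon u\in K$ if $u\in K$; and if $\gamma=0$, then $\tilde{\mathcal L}_\epsilon u\in L^\infty_P(\Omega,C^{r-1}(M))$ for all $u$, so that $\mathcal L_\epsilon$ is a bounded operator on $L^\infty_P(\Omega,C^{r-1}(M))$, and $\mathcal L_\epsilon K\subset K$. -/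

import Mathlib

open MeasureTheory Filter Set
open scoped Manifold ContDiff Bundle ENNReal NNReal Topology

noncomputable section

namespace SkewTransfer

/-- The model space of a `d`-dimensional manifold. -/
abbrev Model (d : ℕ) : Type := EuclideanSpace ℝ (Fin d)

/-- A finite system of smooth charts of `M` together with compact subsets of the chart domains
whose interiors cover `M`. Norms of class `C^s` on a compact manifold are computed in such a
system, and different systems give equivalent norms. -/
structure CoordCover (d : ℕ) (M : Type*) [TopologicalSpace M] [ChartedSpace (Model d) M] where
  /-- the number of charts -/
  card : ℕ
  /-- the charts -/
  chart : Fin card → OpenPartialHomeomorph M (Model d)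
  chart_mem : ∀ i, chart i ∈ IsManifold.maximalAtlas (𝓡 d) ∞ M
  /-- the compact sets on which the charts are used -/
  core : Fin card → Set M
  isCompact_core : ∀ i, IsCompact (core i)
  core_subset : ∀ i, core i ⊆ (chart i).source
  iUnion_interior : ⋃ i, interior (core i) = univ

section FunctionSpaces

variable {d : ℕ} {M : Type*} [TopologicalSpace M] [ChartedSpace (Model d) M]
variable {F : Type*} [NormedAddCommGroup F] [NormedSpace ℝ F]

/-- The representation of `u : M → F` in the `i`-th chart. -/
def CoordCover.rep (𝒰 : CoordCover d M) (i : Fin 𝒰.card) (u : M → F) : Model d → F :=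
  u ∘ (𝒰.chart i).symm

/-- The image of the `i`-th compact set in the `i`-th chart. -/
def CoordCover.dom (𝒰 : CoordCover d M) (i : Fin 𝒰.card) : Set (Model d) :=
  𝒰.chart i '' 𝒰.core i

/-- The largest sup norm, over the charts, of a derivative of order at most `n`. -/
def supPart (𝒰 : CoordCover d M) (n : ℕ) (u : M → F) : ℝ≥0∞ :=
  ⨆ i : Fin 𝒰.card, ⨆ j : Fin (n + 1), ⨆ y : 𝒰.dom i,
    ‖iteratedFDeriv ℝ (j : ℕ) (𝒰.rep i u) (y : Model d)‖ₑ

/-- The largest `γ`-Hölder seminorm, over the charts, of the derivative of order `n`. -/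
def holderPart (𝒰 : CoordCover d M) (n : ℕ) (γ : ℝ≥0) (u : M → F) : ℝ≥0∞ :=
  ⨆ i : Fin 𝒰.card,
    eHolderNorm γ (fun y : 𝒰.dom i => iteratedFDeriv ℝ n (𝒰.rep i u) (y : Model d))

/-- The `C^{n+γ}` norm with values in `[0, ∞]`; for `γ = 0` it is the usual `C^n` norm. -/
def crENorm (𝒰 : CoordCover d M) (n : ℕ) (γ : ℝ≥0) (u : M → F) : ℝ≥0∞ :=
  supPart 𝒰 n u + if γ = 0 then 0 else holderPart 𝒰 n γ u

/-- `u : M → F` is of class `C^{n+γ}`: it is `C^n` and its `n`-th derivative is `γ`-Hölder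
(on a compact manifold the condition is void for `γ = 0`). -/
def IsCr (𝒰 : CoordCover d M) (n : ℕ) (γ : ℝ≥0) (u : M → F) : Prop :=
  ContMDiff (𝓡 d) 𝓘(ℝ, F) n u ∧ crENorm 𝒰 n γ u ≠ ⊤

lemma contDiffAt_rep (𝒰 : CoordCover d M) {n : ℕ} {u : M → F}
    (hu : ContMDiff (𝓡 d) 𝓘(ℝ, F) n u) (i : Fin 𝒰.card) {y : Model d} (hy : y ∈ 𝒰.dom i) :
    ContDiffAt ℝ n (𝒰.rep i u) y := by
  obtain ⟨x, hx, rfl⟩ := hy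
  have ht : 𝒰.chart i x ∈ (𝒰.chart i).target :=
    (𝒰.chart i).map_source (𝒰.core_subset i hx)
  have h1 : ContMDiffAt (𝓡 d) (𝓡 d) n (𝒰.chart i).symm (𝒰.chart i x) :=
    (contMDiffAt_symm_of_mem_maximalAtlas (𝒰.chart_mem i) ht).of_le
      (by exact_mod_cast le_top)
  exact (hu.contMDiffAt.comp _ h1).contDiffAt

lemma supPart_add_le (𝒰 : CoordCover d M) {n : ℕ} {u v : M → F}
    (hu : ContMDiff (𝓡 d) 𝓘(ℝ, F) n u) (hv : ContMDiff (𝓡 d) 𝓘(ℝ, F) n v) :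
    supPart 𝒰 n (u + v) ≤ supPart 𝒰 n u + supPart 𝒰 n v := by
  refine iSup_le fun i => iSup_le fun j => iSup_le fun y => ?_
  have hj : ((j : ℕ) : ℕ∞ω) ≤ n := by exact_mod_cast Nat.lt_succ_iff.1 j.2
  have : iteratedFDeriv ℝ (j : ℕ) (𝒰.rep i (u + v)) (y : Model d) =
      iteratedFDeriv ℝ (j : ℕ) (𝒰.rep i u) (y : Model d)
        + iteratedFDeriv ℝ (j : ℕ) (𝒰.rep i v) (y : Model d) :=
    iteratedFDeriv_add_apply ((contDiffAt_rep 𝒰 hu i y.2).of_le hj)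
      ((contDiffAt_rep 𝒰 hv i y.2).of_le hj)
  rw [this]
  refine (enorm_add_le _ _).trans (add_le_add ?_ ?_)
  · exact le_iSup_of_le i (le_iSup_of_le j (le_iSup_of_le y le_rfl))
  · exact le_iSup_of_le i (le_iSup_of_le j (le_iSup_of_le y le_rfl))

lemma holderPart_add_le (𝒰 : CoordCover d M) {n : ℕ} (γ : ℝ≥0) {u v : M → F}
    (hu : ContMDiff (𝓡 d) 𝓘(ℝ, F) n u) (hv : ContMDiff (𝓡 d) 𝓘(ℝ, F) n v) :
    holderPart 𝒰 n γ (u + v) ≤ holderPart 𝒰 n γ u + holderPart 𝒰 n γ v := by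
  refine iSup_le fun i => ?_
  have : (fun y : 𝒰.dom i => iteratedFDeriv ℝ n (𝒰.rep i (u + v)) (y : Model d)) =
      (fun y : 𝒰.dom i => iteratedFDeriv ℝ n (𝒰.rep i u) (y : Model d))
        + fun y : 𝒰.dom i => iteratedFDeriv ℝ n (𝒰.rep i v) (y : Model d) := by
    funext y
    exact iteratedFDeriv_add_apply (contDiffAt_rep 𝒰 hu i y.2) (contDiffAt_rep 𝒰 hv i y.2)
  rw [this]
  refine eHolderNorm_add_le.trans (add_le_add ?_ ?_)
  · exact le_iSup_of_le i le_rfl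
  · exact le_iSup_of_le i le_rfl

lemma crENorm_add_le (𝒰 : CoordCover d M) {n : ℕ} (γ : ℝ≥0) {u v : M → F}
    (hu : ContMDiff (𝓡 d) 𝓘(ℝ, F) n u) (hv : ContMDiff (𝓡 d) 𝓘(ℝ, F) n v) :
    crENorm 𝒰 n γ (u + v) ≤ crENorm 𝒰 n γ u + crENorm 𝒰 n γ v := by
  have h1 := supPart_add_le 𝒰 hu hv
  have h2 := holderPart_add_le 𝒰 γ hu hv
  unfold crENorm
  split_ifs
  · simpa using h1
  · exact (add_le_add h1 h2).trans (le_of_eq (by ring))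

lemma crENorm_zero (𝒰 : CoordCover d M) (n : ℕ) (γ : ℝ≥0) :
    crENorm 𝒰 n γ (0 : M → F) = 0 := by
  have hrep : ∀ i, 𝒰.rep i (0 : M → F) = fun _ => 0 := fun i => rfl
  have h2 : ∀ i, (fun y : 𝒰.dom i =>
      iteratedFDeriv ℝ n (𝒰.rep i (0 : M → F)) (y : Model d)) = 0 := by
    intro i; funext y; rw [hrep, iteratedFDeriv_fun_zero]; rfl
  have h1 : supPart 𝒰 n (0 : M → F) = 0 := by
    simp only [supPart, ENNReal.iSup_eq_zero]
    intro i j y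
    rw [hrep, iteratedFDeriv_fun_zero]; simp
  have h3 : holderPart 𝒰 n γ (0 : M → F) = 0 := by
    simp only [holderPart, ENNReal.iSup_eq_zero]
    intro i
    rw [h2]; exact eHolderNorm_zero _ _
  simp [crENorm, h1, h3]

variable {𝕜 : Type*} [NormedField 𝕜] [NormedSpace 𝕜 F] [SMulCommClass ℝ 𝕜 F]

lemma contMDiff_smul {n : ℕ} {u : M → F} (c : 𝕜) (hu : ContMDiff (𝓡 d) 𝓘(ℝ, F) n u) :
    ContMDiff (𝓡 d) 𝓘(ℝ, F) n (c • u) :=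
  (c • ContinuousLinearMap.id ℝ F).contMDiff.comp hu

lemma crENorm_smul_le (𝒰 : CoordCover d M) {n : ℕ} (γ : ℝ≥0) {u : M → F} (c : 𝕜)
    (hu : ContMDiff (𝓡 d) 𝓘(ℝ, F) n u) :
    crENorm 𝒰 n γ (c • u) ≤ ‖c‖ₑ * crENorm 𝒰 n γ u := by
  have key : ∀ (i : Fin 𝒰.card) (j : ℕ), j ≤ n → ∀ y ∈ 𝒰.dom i,
      iteratedFDeriv ℝ j (𝒰.rep i (c • u)) y = c • iteratedFDeriv ℝ j (𝒰.rep i u) y := by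
    intro i j hj y hy
    exact iteratedFDeriv_const_smul_apply
      ((contDiffAt_rep 𝒰 hu i hy).of_le (by exact_mod_cast hj))
  have h1 : supPart 𝒰 n (c • u) ≤ ‖c‖ₑ * supPart 𝒰 n u := by
    refine iSup_le fun i => iSup_le fun j => iSup_le fun y => ?_
    rw [key i j (Nat.lt_succ_iff.1 j.2) y y.2, enorm_smul]
    gcongr
    exact le_iSup_of_le i (le_iSup_of_le j (le_iSup_of_le y le_rfl))
  have h2 : holderPart 𝒰 n γ (c • u) ≤ ‖c‖ₑ * holderPart 𝒰 n γ u := by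
    refine iSup_le fun i => ?_
    have : (fun y : 𝒰.dom i => iteratedFDeriv ℝ n (𝒰.rep i (c • u)) (y : Model d)) =
        c • fun y : 𝒰.dom i => iteratedFDeriv ℝ n (𝒰.rep i u) (y : Model d) := by
      funext y
      exact key i n le_rfl y y.2
    rw [this, eHolderNorm_smul]
    change ‖c‖ₑ * _ ≤ _
    gcongr
    exact le_iSup_of_le i le_rfl
  unfold crENorm
  split_ifs
  · simpa using h1
  · rw [mul_add]; exact add_le_add h1 h2

variable (𝕜 F) in
/-- The functions of class `C^{n+γ}` as a vector space over `𝕜`. -/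
def crSubmodule (𝒰 : CoordCover d M) (n : ℕ) (γ : ℝ≥0) : Submodule 𝕜 (M → F) where
  carrier := {u | IsCr 𝒰 n γ u}
  zero_mem' := ⟨contMDiff_const, by rw [crENorm_zero]; exact ENNReal.zero_ne_top⟩
  add_mem' := fun {u v} hu hv => ⟨hu.1.add hv.1,
    ne_top_of_le_ne_top (ENNReal.add_ne_top.2 ⟨hu.2, hv.2⟩) (crENorm_add_le 𝒰 γ hu.1 hv.1)⟩
  smul_mem' := fun c u hu => ⟨contMDiff_smul c hu.1,
    ne_top_of_le_ne_top (ENNReal.mul_ne_top enorm_ne_top hu.2) (crENorm_smul_le 𝒰 γ c hu.1)⟩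

variable (F) in
/-- The space `C^{n+γ}(M, F)`. -/
def CrFun (𝒰 : CoordCover d M) (n : ℕ) (γ : ℝ≥0) : Type _ := {u : M → F // IsCr 𝒰 n γ u}

variable {𝒰 : CoordCover d M} {n : ℕ} {γ : ℝ≥0}

instance : FunLike (CrFun F 𝒰 n γ) M F where
  coe u := u.1
  coe_injective := Subtype.val_injective

instance : AddCommGroup (CrFun F 𝒰 n γ) :=
  inferInstanceAs (AddCommGroup (crSubmodule F ℝ 𝒰 n γ))

instance : Module 𝕜 (CrFun F 𝒰 n γ) :=
  inferInstanceAs (Module 𝕜 (crSubmodule F 𝕜 𝒰 n γ))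

@[simp] lemma CrFun.coe_zero : ((0 : CrFun F 𝒰 n γ) : M → F) = 0 := rfl

@[simp] lemma CrFun.coe_add (u v : CrFun F 𝒰 n γ) : ((u + v : CrFun F 𝒰 n γ) : M → F) = u + v :=
  rfl

@[simp] lemma CrFun.coe_neg (u : CrFun F 𝒰 n γ) : ((-u : CrFun F 𝒰 n γ) : M → F) = -u := rfl

@[simp] lemma CrFun.coe_smul (c : 𝕜) (u : CrFun F 𝒰 n γ) :
    ((c • u : CrFun F 𝒰 n γ) : M → F) = c • (u : M → F) := rfl

/-- The `C^{n+γ}` norm. -/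
instance : Norm (CrFun F 𝒰 n γ) := ⟨fun u => (crENorm 𝒰 n γ (u : M → F)).toReal⟩

lemma CrFun.norm_def (u : CrFun F 𝒰 n γ) : ‖u‖ = (crENorm 𝒰 n γ (u : M → F)).toReal := rfl

lemma CrFun.eq_zero_of_norm (u : CrFun F 𝒰 n γ) (h : ‖u‖ = 0) : u = 0 := by
  have h0 : crENorm 𝒰 n γ (u : M → F) = 0 :=
    ((ENNReal.toReal_eq_zero_iff _).1 h).resolve_right u.2.2
  have h1 : supPart 𝒰 n (u : M → F) = 0 := (add_eq_zero.1 h0).1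
  refine DFunLike.ext _ _ fun x => ?_
  obtain ⟨i, hi⟩ := mem_iUnion.1 (𝒰.iUnion_interior.symm ▸ mem_univ x)
  have hx := interior_subset hi
  simp only [supPart, ENNReal.iSup_eq_zero] at h1
  have h2 := h1 i 0 ⟨𝒰.chart i x, mem_image_of_mem _ hx⟩
  rw [enorm_eq_zero, ← norm_eq_zero] at h2
  have h3 : ‖𝒰.rep i (u : M → F) (𝒰.chart i x)‖ = 0 := by
    rw [← norm_iteratedFDeriv_zero (𝕜 := ℝ)]; exact h2
  rw [norm_eq_zero] at h3
  have h4 : (𝒰.chart i).symm (𝒰.chart i x) = x :=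
    (𝒰.chart i).left_inv (𝒰.core_subset i hx)
  simpa [CoordCover.rep, h4] using h3

lemma CrFun.norm_smul_le (c : 𝕜) (u : CrFun F 𝒰 n γ) : ‖c • u‖ ≤ ‖c‖ * ‖u‖ := by
  have h := crENorm_smul_le 𝒰 γ c u.2.1
  have h' := ENNReal.toReal_mono (ENNReal.mul_ne_top enorm_ne_top u.2.2) h
  rwa [ENNReal.toReal_mul, toReal_enorm] at h'

instance : NormedAddCommGroup (CrFun F 𝒰 n γ) :=
  AddGroupNorm.toNormedAddCommGroup
    { toFun := fun u => ‖u‖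
      map_zero' := by simp [CrFun.norm_def, crENorm_zero]
      add_le' := fun u v => by
        have h := crENorm_add_le 𝒰 γ u.2.1 v.2.1
        have h' := ENNReal.toReal_mono (ENNReal.add_ne_top.2 ⟨u.2.2, v.2.2⟩) h
        rwa [ENNReal.toReal_add u.2.2 v.2.2] at h'
      neg' := fun u => by
        have h : ∀ v : CrFun F 𝒰 n γ, ‖-v‖ ≤ ‖v‖ := fun v => by
          have := CrFun.norm_smul_le (-1 : ℝ) v
          simpa using this
        exact le_antisymm (h u) (by simpa using h (-u))
      eq_zero_of_map_eq_zero' := CrFun.eq_zero_of_norm }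

instance : NormedSpace 𝕜 (CrFun F 𝒰 n γ) where
  norm_smul_le := CrFun.norm_smul_le

lemma CrFun.continuous (u : CrFun F 𝒰 n γ) : Continuous (u : M → F) := u.2.1.continuous

/-- A smooth embedding of the compact manifold `M` into a Euclidean space. -/
structure EuclideanEmbedding (d : ℕ) (M : Type*) [TopologicalSpace M] [ChartedSpace (Model d) M]
    (N : ℕ) where
  /-- the underlying map -/
  toFun : M → EuclideanSpace ℝ (Fin N)
  contMDiff : ContMDiff (𝓡 d) (𝓡 N) ∞ toFun
  injective : Function.Injective toFun
  injective_mfderiv : ∀ x, Function.Injective (mfderiv (𝓡 d) (𝓡 N) toFun x)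

/-- The space `C^{n+γ}(M, M)`: maps `f : M → M` of class `C^{n+γ}`, that is, `f` is `C^n` and
`e ∘ f` is `C^{n+γ}` for a smooth embedding `e` of `M` into a Euclidean space. -/
def CrSelf (𝒰 : CoordCover d M) {N : ℕ} (e : EuclideanEmbedding d M N) (n : ℕ) (γ : ℝ≥0) :
    Type _ :=
  {f : M → M // ContMDiff (𝓡 d) (𝓡 d) n f ∧ IsCr 𝒰 n γ (e.toFun ∘ f)}

variable {N : ℕ} {e : EuclideanEmbedding d M N}

instance : FunLike (CrSelf 𝒰 e n γ) M M where
  coe f := f.1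
  coe_injective := Subtype.val_injective

/-- The composition of a self-map with the embedding. -/
def CrSelf.emb (f : CrSelf 𝒰 e n γ) : CrFun (EuclideanSpace ℝ (Fin N)) 𝒰 n γ :=
  ⟨e.toFun ∘ f, f.2.2⟩

lemma CrSelf.emb_injective : Function.Injective (CrSelf.emb (𝒰 := 𝒰) (e := e) (n := n) (γ := γ)) :=
  fun _ _ h => DFunLike.ext _ _ fun x => e.injective (congrFun (congrArg Subtype.val h) x)

/-- The `C^{n+γ}` metric on self-maps, `d(f, g) = ‖e ∘ f - e ∘ g‖`. -/
instance : MetricSpace (CrSelf 𝒰 e n γ) :=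
  MetricSpace.induced CrSelf.emb CrSelf.emb_injective inferInstance

end FunctionSpaces

section Riemannian

variable {d : ℕ} {M : Type*} [TopologicalSpace M] [ChartedSpace (Model d) M]
  [IsManifold (𝓡 d) ∞ M] [Bundle.RiemannianBundle (fun x : M => TangentSpace (𝓡 d) x)]

/-- The `d`-dimensional volume of the parallelepiped spanned by `d` tangent vectors at `x`. -/
def paraVol (x : M) (v : Fin d → TangentSpace (𝓡 d) x) : ℝ :=
  √(Matrix.gram ℝ v).det

/-- The density `√(det g_{ab})` of the Riemannian volume in the coordinates given by `φ`. -/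
def volDensity (φ : OpenPartialHomeomorph M (Model d)) (y : Model d) : ℝ :=
  paraVol (φ.symm y) fun a =>
    mfderiv (𝓡 d) (𝓡 d) φ.symm y (EuclideanSpace.single a (1 : ℝ) : Model d)

variable (d) in
/-- `|det Df(y)|`, computed with respect to the Riemannian metric: the factor by which
`Df(y) : T_y M → T_{f(y)} M` multiplies the volume of a parallelepiped spanned by a basis. -/
def absDet (f : M → M) (y : M) : ℝ :=
  paraVol (f y) (fun a => mfderiv (𝓡 d) (𝓡 d) f y (EuclideanSpace.single a (1 : ℝ) : Model d)) /
    paraVol y (fun a => (EuclideanSpace.single a (1 : ℝ) : Model d))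

variable (d) in
/-- `f` is an expanding map: `‖Df^n(x) v‖ ≥ C λ^n ‖v‖` with `C > 0`, `λ > 1`. -/
def IsExpanding (f : M → M) : Prop :=
  ∃ C > (0 : ℝ), ∃ l > (1 : ℝ), ∀ n : ℕ, 1 ≤ n → ∀ (x : M) (v : TangentSpace (𝓡 d) x),
    C * l ^ n * ‖v‖ ≤ ‖mfderiv (𝓡 d) (𝓡 d) f^[n] x v‖

variable [MeasurableSpace M] [BorelSpace M]

/-- The Riemannian volume measure. The manifold is cut into disjoint Borel pieces, each of them
inside one of the charts, where the measure has density `√(det g_{ab})`; by the change of variables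
formula the result does not depend on the charts or on the pieces. -/
def riemannianVolume (𝒰 : CoordCover d M) : Measure M :=
  ∑ i : Fin 𝒰.card,
    (Measure.map (𝒰.chart i).symm
      ((volume.restrict (𝒰.chart i).target).withDensity
        fun y => ENNReal.ofReal (volDensity (𝒰.chart i) y))).restrict
      (𝒰.core i \ ⋃ j : Fin 𝒰.card, ⋃ _ : j < i, 𝒰.core j)

/-- The normalized Lebesgue (Riemannian volume) measure on `M`. -/
def leb (𝒰 : CoordCover d M) : Measure M :=
  (riemannianVolume 𝒰 univ)⁻¹ • riemannianVolume 𝒰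

instance (𝒰 : CoordCover d M) : IsFiniteMeasure (leb 𝒰) :=
  ⟨by
    rw [leb, Measure.smul_apply, smul_eq_mul]
    exact (ENNReal.inv_mul_le_one _).trans_lt ENNReal.one_lt_top⟩

lemma CrFun.integrable [CompactSpace M] {𝒰 : CoordCover d M} {n : ℕ} {γ : ℝ≥0}
    (u : CrFun ℂ 𝒰 n γ) : Integrable (u : M → ℂ) (leb 𝒰) := by
  obtain ⟨C, hC⟩ := (isCompact_range u.continuous).isBounded.exists_norm_le
  exact Integrable.of_bound u.continuous.aestronglyMeasurable C
    (Eventually.of_forall fun x => hC _ (mem_range_self x))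

variable {𝒰 : CoordCover d M} {N : ℕ} {e : EuclideanEmbedding d M N} {p : ℕ} {γ : ℝ≥0}

variable (d) in
/-- The function `L(f)w(x) = ∑_{f(y) = x} w(y) / |det Df(y)|`. -/
def transferFun (f : M → M) (w : M → ℂ) (x : M) : ℂ :=
  ∑ᶠ (y : M) (_ : f y = x), w y / (absDet d f y : ℂ)

open Classical in
/-- The transfer operator `L(f)` on the space of functions of class `C^{r-1}`, `r = p + 1 + γ`,
of a map `f` of class `C^r` (with the value `0` where `L(f)w` is not of class `C^{r-1}`, which
does not happen for expanding maps). -/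
def transferOp (f : CrSelf 𝒰 e (p + 1) γ) (w : CrFun ℂ 𝒰 p γ) : CrFun ℂ 𝒰 p γ :=
  if h : IsCr 𝒰 p γ (transferFun d f w) then ⟨transferFun d f w, h⟩ else 0

end Riemannian

section Random

variable {Ω : Type*} [MeasurableSpace Ω]

/-- `v = ℓ_θ u`, where `ℓ_θ` is the transfer operator of `θ` on `L^∞_P(Ω)`: `v` is the essentially
bounded function representing the functional `φ ↦ ∫ u · φ ∘ θ dP` on `L^1_P(Ω)`. -/
def IsBaseTransfer (θ : Ω → Ω) (P : Measure Ω) (u v : Ω → ℂ) : Prop :=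
  MemLp v ⊤ P ∧ ∀ φ : Ω → ℂ, Integrable φ P →
    ∫ s, v s * φ s ∂P = ∫ s, u s * φ (θ s) ∂P

variable {d : ℕ} {M : Type*} [TopologicalSpace M] [ChartedSpace (Model d) M]

/-- `ℓ̃` is a contraction of `L^∞_P(Ω, C^{n+γ}(M))` that lifts `ℓ_θ`: it acts as `ℓ_θ` at each point
of `M`, and it commutes with bounded functionals and bounded operators. -/
structure IsTransferLift (θ : Ω → Ω) (P : Measure Ω) {𝒰 : CoordCover d M} {n : ℕ} {γ : ℝ≥0}
    (ell : Lp (CrFun ℂ 𝒰 n γ) ⊤ P →L[ℂ] Lp (CrFun ℂ 𝒰 n γ) ⊤ P) : Prop where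
  apply_point : ∀ (u : Lp (CrFun ℂ 𝒰 n γ) ⊤ P) (x : M),
    IsBaseTransfer θ P (fun s => u s x) (fun s => ell u s x)
  apply_functional : ∀ (u : Lp (CrFun ℂ 𝒰 n γ) ⊤ P) (A : CrFun ℂ 𝒰 n γ →L[ℂ] ℂ),
    IsBaseTransfer θ P (fun s => A (u s)) (fun s => A (ell u s))
  apply_operator : ∀ (u : Lp (CrFun ℂ 𝒰 n γ) ⊤ P)
    (A : CrFun ℂ 𝒰 n γ →L[ℂ] CrFun ℂ 𝒰 n γ), ell (A.compLp u) = A.compLp (ell u)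
  contraction : ∀ u : Lp (CrFun ℂ 𝒰 n γ) ⊤ P, ‖ell u‖ ≤ ‖u‖

variable [IsManifold (𝓡 d) ∞ M] [Bundle.RiemannianBundle (fun x : M => TangentSpace (𝓡 d) x)]
  [MeasurableSpace M] [BorelSpace M]

/-- The fiber integral `I(u; s) = ∫ u(s) dm`. -/
def fiberIntegral {𝒰 : CoordCover d M} {n : ℕ} {γ : ℝ≥0} (u : Ω → CrFun ℂ 𝒰 n γ) (s : Ω) : ℂ :=
  ∫ x, u s x ∂(leb 𝒰)

/-- The space `K_P(Ω, C^{n+γ}(M))` of all classes in `L^∞_P(Ω, C^{n+γ}(M))` whose fiber integral is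
`P`-almost surely constant. -/
def constFiberIntegral [CompactSpace M] (P : Measure Ω) (𝒰 : CoordCover d M) (n : ℕ) (γ : ℝ≥0) :
    Submodule ℂ (Lp (CrFun ℂ 𝒰 n γ) ⊤ P) where
  carrier := {u | ∃ c : ℂ, ∀ᵐ s ∂P, fiberIntegral u s = c}
  zero_mem' := ⟨0, by
    filter_upwards [Lp.coeFn_zero (CrFun ℂ 𝒰 n γ) ⊤ P] with s h
    rw [fiberIntegral, h]
    exact integral_zero M ℂ⟩
  add_mem' := by
    rintro u v ⟨a, ha⟩ ⟨b, hb⟩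
    refine ⟨a + b, ?_⟩
    filter_upwards [ha, hb, Lp.coeFn_add u v] with s h1 h2 h3
    rw [← h1, ← h2, fiberIntegral, h3]
    exact integral_add (u s).integrable (v s).integrable
  smul_mem' := by
    rintro c u ⟨a, ha⟩
    refine ⟨c * a, ?_⟩
    filter_upwards [ha, Lp.coeFn_smul c u] with s h1 h2
    rw [← h1, fiberIntegral, h2]
    exact integral_const_mul c _

/-- The map `s ↦ L(f(s)) u(s)`. -/
def fiberTransfer {𝒰 : CoordCover d M} {N : ℕ} {e : EuclideanEmbedding d M N} {p : ℕ} {γ : ℝ≥0}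
    (f : Ω → CrSelf 𝒰 e (p + 1) γ) (u : Ω → CrFun ℂ 𝒰 p γ) (s : Ω) : CrFun ℂ 𝒰 p γ :=
  transferOp (f s) (u s)

end Random

end SkewTransfer

end

/-! The integral over `M` is a bounded functional I on C^{r-1}(M), so K is the preimage of the
constants under the operator that I induces into L^∞(Ω). The constants form a finite-dimensional,
hence closed, subspace (`isClosed_constFiberIntegral`), and K is complete because C^{r-1}(M) is
(`CrFun.completeSpace`). The lift commutes with I, so the fiber integral of its value at u is ℓ_θ
applied to the fiber integral of u, and ℓ_θ fixes constants because θ preserves P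
(`IsBaseTransfer.ae_eq_const`). Each L(g) preserves I: on a small set where g is injective this is
the change of variables formula in charts (`integral_transferFun_indicator`), and finitely many such
sets cover M (`integral_transferFun`). Hence K is invariant.

The analytic core is that L(g) acts on C^{r-1}(M), with bounds uniform for g near f₀. The pair (g,
w) is treated as a parameter, and (g, w, x) ↦ L(g)w(x) is shown to be a family of class C^{p+γ} in
x, with p = k - 1: its x-derivatives up to order p are jointly continuous and the Hölder constants
are locally bounded (`FamCr`, `MFam`). The evaluations (g, x) ↦ g(x) and (w, x) ↦ w(x) are such
families, of orders p + 1 and p, by the very form of the norms. The class is stable under products,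
smooth functions, composition with Lipschitz families and local inversion (`FamCr.exists_inverse`).
An expanding map is immersive, so over a neighbourhood of (g, x) the fiber consists of finitely many
regular branches, and the sum over them is in the class (`MFam.finsum_fiber`, `mfam_transferFun`).

Compactness of M turns local statements into norms. A family of class C^{p+γ} is locally bounded in
the C^{p+γ} norm (`MFam.eventually_crENorm_le`); at the parameter (f₀, 0) this and linearity give
the uniform operator bound (`eventually_norm_transferOp_le`). For γ = 0 the family is even
continuous in norm (`MFam.eventually_crENorm_sub_le`), so (g, w) ↦ L(g)w is continuous for g near
f₀, which makes ω ↦ L(f_ε(ω))u(ω) Bochner measurable. For γ > 0 the Hölder constants are only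
bounded, and measurability stays a hypothesis.

Expanding maps form an open set because expansion follows from two estimates, one for Df and one for
the derivative of a single iterate, which hold strictly for f₀ and survive small C^1 perturbations
(`isExpanding_of_iterate`, `IsExpanding.eventually`). -/

open MeasureTheory Filter Set
open scoped Manifold ContDiff Bundle ENNReal NNReal Topology

noncomputable section

set_option linter.unusedSectionVars false

namespace SkewTransfer

/-! ### Calculus of parametrized families of class C^{n+γ} on a normed space. -/

section Families

variable {S : Type*} [TopologicalSpace S] {S' : Type*} [TopologicalSpace S']
variable {E F G H : Type} [NormedAddCommGroup E] [NormedSpace ℝ E]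
  [NormedAddCommGroup F] [NormedSpace ℝ F] [NormedAddCommGroup G] [NormedSpace ℝ G]
  [NormedAddCommGroup H] [NormedSpace ℝ H]

/-- The family of functions `x ↦ u (s, x)` is `γ`-Hölder, locally uniformly in `(s, x) ∈ W`. -/
def LocHolder (γ : ℝ≥0) (u : S × E → F) (W : Set (S × E)) : Prop :=
  ∀ q ∈ W, ∃ C : ℝ, 0 ≤ C ∧ ∀ᶠ z : S × E × E in 𝓝 (q.1, q.2, q.2),
    ‖u (z.1, z.2.1) - u (z.1, z.2.2)‖ ≤ C * ‖z.2.1 - z.2.2‖ ^ (γ : ℝ)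

/-- The family of functions `x ↦ u (s, x)` is of class `C^{n+γ}` on the open set `W`, the
derivatives being jointly continuous and the Hölder constants being locally bounded. -/
def FamCr (γ : ℝ≥0) : ℕ → ∀ {F : Type} [NormedAddCommGroup F] [NormedSpace ℝ F],
    (S × E → F) → Set (S × E) → Prop
  | 0, _, _, _, u, W => ContinuousOn u W ∧ (γ ≠ 0 → LocHolder γ u W)
  | n + 1, F, _, _, u, W => ContinuousOn u W ∧ ∃ u' : S × E → E →L[ℝ] F,
      (∀ q ∈ W, HasFDerivAt (fun x => u (q.1, x)) (u' q) q.2) ∧ FamCr γ n u' W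

lemma FamCr.continuousOn {γ : ℝ≥0} {n : ℕ} {u : S × E → F} {W : Set (S × E)}
    (h : FamCr γ n u W) : ContinuousOn u W := by
  cases n <;> exact h.1

lemma tendsto_fst_triple (q : S × E) :
    Tendsto (fun z : S × E × E => (z.1, z.2.1)) (𝓝 (q.1, q.2, q.2)) (𝓝 q) := by
  have : Continuous (fun z : S × E × E => (z.1, z.2.1)) := by fun_prop
  exact this.tendsto' _ _ rfl

lemma tendsto_snd_triple (q : S × E) :
    Tendsto (fun z : S × E × E => (z.1, z.2.2)) (𝓝 (q.1, q.2, q.2)) (𝓝 q) := by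
  have : Continuous (fun z : S × E × E => (z.1, z.2.2)) := by fun_prop
  exact this.tendsto' _ _ rfl

lemma eventually_norm_le {X : Type*} [TopologicalSpace X] {u : X → F} {q : X}
    (h : ContinuousAt u q) : ∀ᶠ z in 𝓝 q, ‖u z‖ ≤ ‖u q‖ + 1 :=
  (h.norm.eventually (gt_mem_nhds (lt_add_one _))).mono fun _ h => le_of_lt h

lemma exists_ball_of_eventually {P : S × E → Prop} {q : S × E} (h : ∀ᶠ z in 𝓝 q, P z) :
    ∃ A ∈ 𝓝 q.1, ∃ r : ℝ, 0 < r ∧ ∀ s ∈ A, ∀ x ∈ Metric.ball q.2 r, P (s, x) := by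
  rw [← Prod.mk.eta (p := q), nhds_prod_eq, Filter.eventually_prod_iff] at h
  obtain ⟨pa, ha, pb, hb, h⟩ := h
  obtain ⟨r, hr, hb⟩ := Metric.eventually_nhds_iff_ball.1 hb
  exact ⟨_, ha, r, hr, fun s hs x hx => h hs (hb x hx)⟩

lemma LocHolder.of_hasFDerivAt {γ : ℝ≥0} (hγ : γ ≤ 1) {u : S × E → F} {u' : S × E → E →L[ℝ] F}
    {W : Set (S × E)} (hW : IsOpen W)
    (hd : ∀ q ∈ W, HasFDerivAt (fun x => u (q.1, x)) (u' q) q.2) (hc : ContinuousOn u' W) :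
    LocHolder γ u W := by
  intro q hq
  have h1 := (eventually_norm_le (hc.continuousAt (hW.mem_nhds hq))).and (hW.mem_nhds hq)
  obtain ⟨A, hA, r, hr, h⟩ := exists_ball_of_eventually h1
  refine ⟨‖u' q‖ + 1, by positivity, ?_⟩
  -- The radius 1/2 keeps ‖x - y‖ ≤ 1, and there a Lipschitz bound implies a γ-Hölder bound since γ
  -- ≤ 1.
  have hB : Metric.ball q.2 (min r (1 / 2)) ∈ 𝓝 q.2 := Metric.ball_mem_nhds _ (by positivity)
  filter_upwards [prod_mem_nhds hA (prod_mem_nhds hB hB)] with ⟨s, x, y⟩ ⟨hs, hx, hy⟩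
  simp only [] at hs hx hy ⊢
  have hx' := Metric.ball_subset_ball (min_le_left _ _) hx
  have hy' := Metric.ball_subset_ball (min_le_left _ _) hy
  have h2 := (convex_ball q.2 r).norm_image_sub_le_of_norm_hasFDerivWithin_le
    (f := fun x => u (s, x)) (fun z hz => (hd (s, z) (h s hs z hz).2).hasFDerivWithinAt)
    (fun z hz => (h s hs z hz).1) hy' hx'
  refine h2.trans ?_
  gcongr
  have h3 : ‖x - y‖ ≤ 1 := by
    rw [← dist_eq_norm]
    have := Metric.ball_subset_ball (min_le_right r (1 / 2)) hx
    have h' := Metric.ball_subset_ball (min_le_right r (1 / 2)) hy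
    rw [Metric.mem_ball] at this h'
    linarith [dist_triangle_right x y q.2]
  calc ‖x - y‖ = ‖x - y‖ ^ (1 : ℝ) := (Real.rpow_one _).symm
    _ ≤ ‖x - y‖ ^ (γ : ℝ) :=
      Real.rpow_le_rpow_of_exponent_ge' (norm_nonneg _) h3 γ.2 (by exact_mod_cast hγ)

variable {γ : ℝ≥0} {n : ℕ} {W : Set (S × E)}

lemma LocHolder.mono {u : S × E → F} {W' : Set (S × E)} (h : LocHolder γ u W) (hs : W' ⊆ W) :
    LocHolder γ u W' := fun q hq => h q (hs hq)

lemma FamCr.mono {u : S × E → F} {W' : Set (S × E)} (h : FamCr γ n u W) (hs : W' ⊆ W) :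
    FamCr γ n u W' := by
  induction n generalizing F with
  | zero => exact ⟨h.1.mono hs, fun h0 => (h.2 h0).mono hs⟩
  | succ n ih =>
    obtain ⟨hc, u', hd, h'⟩ := h
    exact ⟨hc.mono hs, u', fun q hq => hd q (hs hq), ih h'⟩

lemma FamCr.congr (hW : IsOpen W) {u v : S × E → F} (h : FamCr γ n u W) (huv : EqOn u v W) :
    FamCr γ n v W := by
  cases n with
  | zero =>
    refine ⟨h.1.congr huv.symm, fun h0 q hq => ?_⟩
    obtain ⟨C, hC, h'⟩ := h.2 h0 q hq
    refine ⟨C, hC, ?_⟩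
    filter_upwards [h', (tendsto_fst_triple q).eventually (hW.mem_nhds hq),
      (tendsto_snd_triple q).eventually (hW.mem_nhds hq)] with z h1 h2 h3
    rwa [← huv h2, ← huv h3]
  | succ n =>
    obtain ⟨hc, u', hd, h'⟩ := h
    refine ⟨hc.congr huv.symm, u', fun q hq => (hd q hq).congr_of_eventuallyEq ?_, h'⟩
    have : ∀ᶠ x in 𝓝 q.2, (q.1, x) ∈ W :=
      (Continuous.prodMk_right q.1).continuousAt.eventually (hW.mem_nhds hq)
    exact this.mono fun x hx => (huv hx).symm

lemma FamCr.locHolder_of_succ {γ' : ℝ≥0} (hγ' : γ' ≤ 1) (hW : IsOpen W) {u : S × E → F}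
    (h : FamCr γ (n + 1) u W) : LocHolder γ' u W := by
  obtain ⟨-, u', hd, h'⟩ := h
  exact LocHolder.of_hasFDerivAt hγ' hW hd h'.continuousOn

/-- Only the bottom order has content: the Hölder bound for the function itself comes from the mean
value inequality. -/
lemma FamCr.of_succ (hγ : γ ≤ 1) (hW : IsOpen W) {u : S × E → F}
    (h : FamCr γ (n + 1) u W) : FamCr γ n u W := by
  induction n generalizing F with
  | zero => exact ⟨h.1, fun _ => h.locHolder_of_succ hγ hW⟩
  | succ n ih =>
    obtain ⟨hc, u', hd, h'⟩ := h
    exact ⟨hc, u', hd, ih h'⟩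

lemma FamCr.of_le (hγ : γ ≤ 1) (hW : IsOpen W) {u : S × E → F} {m : ℕ} (hm : m ≤ n)
    (h : FamCr γ n u W) : FamCr γ m u W := by
  induction n, hm using Nat.le_induction with
  | base => exact h
  | succ n _ ih => exact ih (h.of_succ hγ hW)

/-- Reparametrization of a family. -/
lemma FamCr.reparam {σ : S' → S} (hσ : Continuous σ) {u : S × E → F} {W' : Set (S' × E)}
    (h : FamCr γ n u W) (hW' : ∀ q ∈ W', (σ q.1, q.2) ∈ W) :
    FamCr γ n (fun q : S' × E => u (σ q.1, q.2)) W' := by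
  have hc : Continuous fun q : S' × E => (σ q.1, q.2) := by fun_prop
  induction n generalizing F with
  | zero =>
    refine ⟨h.1.comp hc.continuousOn hW', fun h0 q hq => ?_⟩
    obtain ⟨C, hC, h'⟩ := h.2 h0 _ (hW' q hq)
    refine ⟨C, hC, ?_⟩
    have : Continuous fun z : S' × E × E => (σ z.1, z.2.1, z.2.2) := by fun_prop
    exact (this.tendsto (q.1, q.2, q.2)).eventually h'
  | succ n ih =>
    obtain ⟨hc', u', hd, h'⟩ := h
    exact ⟨hc'.comp hc.continuousOn hW', _, fun q hq => hd _ (hW' q hq), ih h'⟩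

lemma FamCr.const (c : F) : FamCr γ n (fun _ : S × E => c) W := by
  induction n generalizing F with
  | zero =>
    refine ⟨continuousOn_const, fun _ q _ => ⟨0, le_rfl, ?_⟩⟩
    simp
  | succ n ih => exact ⟨continuousOn_const, fun _ => 0, fun q _ => hasFDerivAt_const _ _, ih 0⟩

lemma FamCr.snd (hγ : γ ≤ 1) : FamCr γ n (fun q : S × E => q.2) W := by
  -- `W` need not be open here, but lowering the order needs an open set; hence the claim is proved
  -- on `univ` and then restricted.
  have key : ∀ n, FamCr γ (n + 1) (fun q : S × E => q.2) (univ : Set (S × E)) := fun n =>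
    ⟨continuous_snd.continuousOn, fun _ => ContinuousLinearMap.id ℝ E,
      fun q _ => hasFDerivAt_id _, FamCr.const _⟩
  cases n with
  | zero => exact ((key 0).of_succ hγ isOpen_univ).mono (subset_univ _)
  | succ n => exact (key n).mono (subset_univ _)

lemma FamCr.clm_apply (L : F →L[ℝ] G) {u : S × E → F} (h : FamCr γ n u W) :
    FamCr γ n (fun q => L (u q)) W := by
  induction n generalizing F G with
  | zero =>
    refine ⟨L.continuous.comp_continuousOn h.1, fun h0 q hq => ?_⟩
    obtain ⟨C, hC, h'⟩ := h.2 h0 q hq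
    refine ⟨‖L‖ * C, by positivity, h'.mono fun z hz => ?_⟩
    rw [← map_sub, mul_assoc]
    exact (L.le_opNorm _).trans (by gcongr)
  | succ n ih =>
    obtain ⟨hc, u', hd, h'⟩ := h
    refine ⟨L.continuous.comp_continuousOn hc, fun q => L.comp (u' q),
      fun q hq => L.hasFDerivAt.comp q.2 (hd q hq), ?_⟩
    exact ih (ContinuousLinearMap.compL ℝ E F G L) h'

lemma FamCr.add {u v : S × E → F} (hu : FamCr γ n u W) (hv : FamCr γ n v W) :
    FamCr γ n (fun q => u q + v q) W := by
  induction n generalizing F with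
  | zero =>
    refine ⟨hu.1.add hv.1, fun h0 q hq => ?_⟩
    obtain ⟨C, hC, h'⟩ := hu.2 h0 q hq
    obtain ⟨D, hD, h''⟩ := hv.2 h0 q hq
    refine ⟨C + D, by positivity, ?_⟩
    filter_upwards [h', h''] with z h1 h2
    rw [add_sub_add_comm, add_mul]
    exact (norm_add_le _ _).trans (add_le_add h1 h2)
  | succ n ih =>
    obtain ⟨hc, u', hd, h'⟩ := hu
    obtain ⟨hc₂, v', hd₂, h₂⟩ := hv
    exact ⟨hc.add hc₂, _, fun q hq => (hd q hq).add (hd₂ q hq), ih h' h₂⟩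

lemma FamCr.sum {ι : Type*} (s : Finset ι) {u : ι → S × E → F} (hu : ∀ i ∈ s, FamCr γ n (u i) W) :
    FamCr γ n (fun q => ∑ i ∈ s, u i q) W := by
  classical
  induction s using Finset.induction_on with
  | empty => simpa using FamCr.const 0
  | insert a s ha ih =>
    simp only [Finset.sum_insert ha]
    exact (hu a (by simp)).add (ih fun i hi => hu i (by simp [hi]))

lemma FamCr.prodMk {u : S × E → F} {v : S × E → G} (hu : FamCr γ n u W) (hv : FamCr γ n v W) :
    FamCr γ n (fun q => (u q, v q)) W := by
  have := (hu.clm_apply (ContinuousLinearMap.inl ℝ F G)).add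
    (hv.clm_apply (ContinuousLinearMap.inr ℝ F G))
  simpa using this

/-- Leibniz rule, by induction over all bilinear maps at once: the derivative is a sum of two
bilinear expressions, in (u, v') and in (u', v), given by `precompR` and `precompL`. -/
lemma FamCr.bilin (hγ : γ ≤ 1) (hW : IsOpen W) (B : F →L[ℝ] G →L[ℝ] H) {u : S × E → F}
    {v : S × E → G} (hu : FamCr γ n u W) (hv : FamCr γ n v W) :
    FamCr γ n (fun q => B (u q) (v q)) W := by
  induction n generalizing F G H with
  | zero =>
    refine ⟨(B.continuous.comp_continuousOn hu.1).clm_apply hv.1, fun h0 q hq => ?_⟩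
    obtain ⟨C, hC, h'⟩ := hu.2 h0 q hq
    obtain ⟨D, hD, h''⟩ := hv.2 h0 q hq
    have h3 := eventually_norm_le (hu.1.continuousAt (hW.mem_nhds hq))
    have h4 := eventually_norm_le (hv.1.continuousAt (hW.mem_nhds hq))
    refine ⟨‖B‖ * C * (‖v q‖ + 1) + ‖B‖ * (‖u q‖ + 1) * D, by positivity, ?_⟩
    filter_upwards [h', h'', (tendsto_fst_triple q).eventually h4,
      (tendsto_snd_triple q).eventually h3] with z h1 h2 h3 h4
    have e : B (u (z.1, z.2.1)) (v (z.1, z.2.1)) - B (u (z.1, z.2.2)) (v (z.1, z.2.2))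
        = B (u (z.1, z.2.1) - u (z.1, z.2.2)) (v (z.1, z.2.1))
          + B (u (z.1, z.2.2)) (v (z.1, z.2.1) - v (z.1, z.2.2)) := by
      simp only [map_sub, sub_apply]; abel
    rw [e, add_mul]
    refine (norm_add_le _ _).trans (add_le_add ?_ ?_)
    · calc _ ≤ ‖B‖ * ‖u (z.1, z.2.1) - u (z.1, z.2.2)‖ * ‖v (z.1, z.2.1)‖ := B.le_opNorm₂ _ _
        _ ≤ ‖B‖ * (C * ‖z.2.1 - z.2.2‖ ^ (γ : ℝ)) * (‖v q‖ + 1) := by gcongr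
        _ = _ := by ring
    · calc _ ≤ ‖B‖ * ‖u (z.1, z.2.2)‖ * ‖v (z.1, z.2.1) - v (z.1, z.2.2)‖ := B.le_opNorm₂ _ _
        _ ≤ ‖B‖ * (‖u q‖ + 1) * (D * ‖z.2.1 - z.2.2‖ ^ (γ : ℝ)) := by gcongr
        _ = _ := by ring
  | succ n ih =>
    have hu0 := hu.of_succ hγ hW
    have hv0 := hv.of_succ hγ hW
    obtain ⟨hc, u', hd, h'⟩ := hu
    obtain ⟨hc₂, v', hd₂, h₂⟩ := hv
    refine ⟨(B.continuous.comp_continuousOn hc).clm_apply hc₂, fun q => B.precompR E (u q) (v' q) + B.precompL E (u' q) (v q),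
      fun q hq => B.hasFDerivAt_of_bilinear (hd q hq) (hd₂ q hq), ?_⟩
    exact (ih (B.precompR E) hu0 h₂).add (ih (B.precompL E) h' hv0)

/-- A sufficiently smooth function of a family. -/
lemma FamCr.contDiffOn_comp (hγ : γ ≤ 1) (hW : IsOpen W) {V : Set F} (hV : IsOpen V) {φ : F → G}
    (hφ : ContDiffOn ℝ (n + 1 : ℕ) φ V) {u : S × E → F} (hu : FamCr γ n u W)
    (hm : MapsTo u W V) : FamCr γ n (fun q => φ (u q)) W := by
  induction n generalizing G with
  | zero =>
    refine ⟨hφ.continuousOn.comp hu.1 hm, fun h0 q hq => ?_⟩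
    obtain ⟨C, hC, h'⟩ := hu.2 h0 q hq
    have h1 : ContDiffAt ℝ 1 φ (u q) := by
      simpa using hφ.contDiffAt (hV.mem_nhds (hm hq))
    -- The one spare derivative of φ makes it locally Lipschitz at order zero, which preserves
    -- Hölder bounds.
    obtain ⟨K, t, ht, hK⟩ := h1.exists_lipschitzOnWith
    have h2 := (hu.1.continuousAt (hW.mem_nhds hq)).eventually ht
    refine ⟨K * C, by positivity, ?_⟩
    filter_upwards [h', (tendsto_fst_triple q).eventually h2,
      (tendsto_snd_triple q).eventually h2] with z h1 h2 h3
    rw [← dist_eq_norm, mul_assoc]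
    refine (hK.dist_le_mul _ h2 _ h3).trans ?_
    rw [dist_eq_norm]
    gcongr
  | succ n ih =>
    have hu0 := hu.of_succ hγ hW
    obtain ⟨hc, u', hd, h'⟩ := hu
    refine ⟨hφ.continuousOn.comp hc hm, fun q => (fderiv ℝ φ (u q)).comp (u' q),
      fun q hq => ?_, ?_⟩
    · have : DifferentiableAt ℝ φ (u q) :=
        (hφ.contDiffAt (hV.mem_nhds (hm hq))).differentiableAt (by simp)
      exact HasFDerivAt.comp q.2 (g := φ) (f := fun x => u (q.1, x)) this.hasFDerivAt (hd q hq)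
    · have h1 : ContDiffOn ℝ (n + 1 : ℕ) (fderiv ℝ φ) V := hφ.fderiv_of_isOpen hV (by simp)
      exact (ih h1 hu0).bilin hγ hW (ContinuousLinearMap.compL ℝ E F G) h'

/-- A smooth function of a family. -/
lemma FamCr.smooth_comp (hγ : γ ≤ 1) (hW : IsOpen W) {V : Set F} (hV : IsOpen V) {φ : F → G}
    (hφ : ContDiffOn ℝ ∞ φ V) {u : S × E → F} (hu : FamCr γ n u W) (hm : MapsTo u W V) :
    FamCr γ n (fun q => φ (u q)) W :=
  hu.contDiffOn_comp hγ hW hV (hφ.of_le (by exact_mod_cast le_top)) hm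

/-- Composition of families. -/
lemma FamCr.comp (hγ : γ ≤ 1) (hW : IsOpen W) {V : Set (S × F)} {f : S × F → G}
    {h : S × E → F} (hf : FamCr γ n f V) (hh : FamCr γ n h W) (hL : LocHolder 1 h W)
    (hm : ∀ q ∈ W, (q.1, h q) ∈ V) : FamCr γ n (fun q => f (q.1, h q)) W := by
  have hc : ∀ q ∈ W, ContinuousAt (fun q => (q.1, h q)) q := fun q hq =>
    continuousAt_fst.prodMk (hh.continuousOn.continuousAt (hW.mem_nhds hq))
  have hc' : ContinuousOn (fun q => f (q.1, h q)) W :=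
    hf.continuousOn.comp (fun q hq => (hc q hq).continuousWithinAt) hm
  induction n generalizing G with
  | zero =>
    refine ⟨hc', fun h0 q hq => ?_⟩
    obtain ⟨C, hC, h1⟩ := hf.2 h0 _ (hm q hq)
    obtain ⟨K, hK, h2⟩ := hL q hq
    have hcq := hh.1.continuousAt (hW.mem_nhds hq)
    have h3 : Tendsto (fun z : S × E × E => (z.1, h (z.1, z.2.1), h (z.1, z.2.2)))
        (𝓝 (q.1, q.2, q.2)) (𝓝 (q.1, h q, h q)) :=
      Tendsto.prodMk_nhds continuousAt_fst
        ((hcq.tendsto.comp (tendsto_fst_triple q)).prodMk_nhds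
          (hcq.tendsto.comp (tendsto_snd_triple q)))
    -- A Lipschitz inner map keeps the exponent γ, as (K‖x - y‖)^γ = K^γ ‖x - y‖^γ; a γ-Hölder one
    -- would only give γ². This is the purpose of `hL`.
    refine ⟨C * K ^ (γ : ℝ), by positivity, ?_⟩
    filter_upwards [h2, h3.eventually h1] with z h4 h5
    refine h5.trans ?_
    rw [mul_assoc, ← Real.mul_rpow hK (norm_nonneg _)]
    gcongr
    simpa using h4
  | succ n ih =>
    have hh0 := hh.of_succ hγ hW
    obtain ⟨-, f', hd, h'⟩ := hf
    obtain ⟨-, h₁, hd₁, h1⟩ := hh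
    refine ⟨hc', fun q => (f' (q.1, h q)).comp (h₁ q),
      fun q hq => ?_, ?_⟩
    · exact HasFDerivAt.comp q.2 (g := fun y => f (q.1, y)) (f := fun x => h (q.1, x))
        (hd _ (hm q hq)) (hd₁ q hq)
    · have h2 := ih h' hh0
        (h'.continuousOn.comp (fun q hq => (hc q hq).continuousWithinAt) hm)
      exact h2.bilin hγ hW (ContinuousLinearMap.compL ℝ E F G) h1

/-- A jointly continuous family of local inverses of a family is as regular as the family. -/
lemma FamCr.of_inverse [CompleteSpace E] (hγ : γ ≤ 1) (hW : IsOpen W) {V : Set (S × E)}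
    (hV : IsOpen V) {g : S × E → E} {g' : S × E → E →L[ℝ] E} {h : S × E → E}
    (hd : ∀ q ∈ V, HasFDerivAt (fun x => g (q.1, x)) (g' q) q.2) (hg : FamCr γ n g' V)
    (hinv : ∀ q ∈ V, (g' q).IsInvertible) (hh : ContinuousOn h W)
    (hm : ∀ q ∈ W, (q.1, h q) ∈ V) (hr : ∀ q ∈ W, g (q.1, h q) = q.2) :
    FamCr γ (n + 1) h W := by
  have hc : ContinuousOn (fun q => (q.1, h q)) W := continuousOn_fst.prodMk hh
  have hO : IsOpen (ContinuousLinearMap.IsInvertible : Set (E →L[ℝ] E)) := by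
    have : (ContinuousLinearMap.IsInvertible : Set (E →L[ℝ] E)) =
      range ((↑) : (E ≃L[ℝ] E) → E →L[ℝ] E) := rfl
    rw [this]; exact ContinuousLinearEquiv.isOpen
  have hsm : ContDiffOn ℝ ∞ (ContinuousLinearMap.inverse : (E →L[ℝ] E) → E →L[ℝ] E)
      (ContinuousLinearMap.IsInvertible : Set (E →L[ℝ] E)) := by
    rintro _ ⟨A, rfl⟩
    exact (contDiffAt_map_inverse A).contDiffWithinAt
  have hD : ∀ q ∈ W, HasFDerivAt (fun x => h (q.1, x)) (g' (q.1, h q)).inverse q.2 := by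
    intro q hq
    obtain ⟨A, hA⟩ := hinv _ (hm q hq)
    have h1 := hd _ (hm q hq)
    rw [← hA] at h1 ⊢
    rw [ContinuousLinearMap.inverse_equiv]
    have hcq : ContinuousAt (fun x => h (q.1, x)) q.2 :=
      ContinuousAt.comp (f := fun x => (q.1, x)) (g := h) (x := q.2)
        (hh.continuousAt (hW.mem_nhds hq)) (Continuous.prodMk_right q.1).continuousAt
    refine HasFDerivAt.of_local_left_inverse hcq h1 ?_
    have : ∀ᶠ x in 𝓝 q.2, (q.1, x) ∈ W :=
      (Continuous.prodMk_right q.1).continuousAt.eventually (hW.mem_nhds hq)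
    exact this.mono fun x hx => hr _ hx
  have hgc : ContinuousOn (fun q => (g' (q.1, h q)).inverse) W :=
    hsm.continuousOn.comp (hg.continuousOn.comp hc hm) fun q hq => hinv _ (hm q hq)
  have hLip : ∀ δ : ℝ≥0, δ ≤ 1 → LocHolder δ h W := fun δ hδ =>
    LocHolder.of_hasFDerivAt hδ hW hD hgc
  -- Bootstrap: the derivative of `h` is the inverse of `g'` along `h`, hence as regular as `g'` and
  -- `h` are, and `h` gains one order. The start is the continuity of `h`, which already makes it
  -- differentiable and Lipschitz.
  have step : ∀ m, FamCr γ m g' V → FamCr γ m h W → FamCr γ (m + 1) h W := by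
    intro m h1 h2
    refine ⟨hh, _, hD, ?_⟩
    exact (h1.comp hγ hW h2 (hLip 1 le_rfl) hm).smooth_comp hγ hW hO hsm
      fun q hq => hinv _ (hm q hq)
  have all : ∀ m ≤ n, FamCr γ (m + 1) h W := by
    intro m
    induction m with
    | zero => exact fun _ => step 0 (hg.of_le hγ hV (Nat.zero_le n)) ⟨hh, fun _ => hLip γ hγ⟩
    | succ m ih => exact fun hm' => step (m + 1) (hg.of_le hγ hV hm') (ih (by omega))
  exact all n le_rfl

end Families

/-! ### Families described by iterated derivatives, the form in which the norms are given. -/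

section IteratedDerivatives

variable {S : Type*} [TopologicalSpace S]
variable {E F : Type} [NormedAddCommGroup E] [NormedSpace ℝ E]
  [NormedAddCommGroup F] [NormedSpace ℝ F]

variable {γ : ℝ≥0} {n : ℕ} {W : Set (S × E)}

/-- A family is of class `C^{n+γ}` if and only if its iterated derivatives are jointly continuous
and the last one is locally uniformly Hölder. -/
lemma famCr_iff_iteratedFDeriv (hW : IsOpen W) {u : S × E → F} :
    FamCr γ n u W ↔ (∀ q ∈ W, ContDiffAt ℝ n (fun x => u (q.1, x)) q.2) ∧
      (∀ j ≤ n, ContinuousOn (fun q : S × E => iteratedFDeriv ℝ j (fun x => u (q.1, x)) q.2) W) ∧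
      FamCr γ 0 (fun q : S × E => iteratedFDeriv ℝ n (fun x => u (q.1, x)) q.2) W := by
  induction n generalizing F with
  | zero =>
    have e : (fun q : S × E => iteratedFDeriv ℝ 0 (fun x => u (q.1, x)) q.2) =
        fun q => ((continuousMultilinearCurryFin0 ℝ E F).symm : F →L[ℝ] _) (u q) := rfl
    constructor
    · intro h
      have h2 : FamCr γ 0 (fun q : S × E => iteratedFDeriv ℝ 0 (fun x => u (q.1, x)) q.2) W := by
        rw [e]; exact h.clm_apply _
      refine ⟨fun q hq => ?_, fun j hj => ?_, h2⟩
      · rw [Nat.cast_zero, contDiffAt_zero]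
        refine ⟨{x | (q.1, x) ∈ W},
          (Continuous.prodMk_right q.1).continuousAt.eventually (hW.mem_nhds hq), ?_⟩
        exact h.continuousOn.comp (Continuous.prodMk_right q.1).continuousOn fun x hx => hx
      · obtain rfl : j = 0 := by omega
        exact h2.continuousOn
    · rintro ⟨-, -, h⟩
      exact h.clm_apply (continuousMultilinearCurryFin0 ℝ E F : _ →L[ℝ] F)
  | succ n ih =>
    -- The recursion in `FamCr` takes the first derivative off u, so D^{j+1}u is written as D^j(Du).
    -- Currying is a linear isometry, and linear maps preserve families.
    have e : ∀ j, (fun q : S × E => iteratedFDeriv ℝ (j + 1) (fun x => u (q.1, x)) q.2) =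
        fun q => ((continuousMultilinearCurryRightEquiv' ℝ j E F).symm : _ →L[ℝ] _)
          (iteratedFDeriv ℝ j (fderiv ℝ fun x => u (q.1, x)) q.2) := by
      intro j; funext q; rw [iteratedFDeriv_succ_eq_comp_right]; rfl
    have e' : ∀ j, (fun q : S × E => iteratedFDeriv ℝ j (fderiv ℝ fun x => u (q.1, x)) q.2) =
        fun q => (continuousMultilinearCurryRightEquiv' ℝ j E F : _ →L[ℝ] _)
          (iteratedFDeriv ℝ (j + 1) (fun x => u (q.1, x)) q.2) := by
      intro j; funext q; rw [iteratedFDeriv_succ_eq_comp_right]; simp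
    constructor
    · rintro ⟨hc, u', hd, h⟩
      have h := (ih (u := fun q => fderiv ℝ (fun x => u (q.1, x)) q.2)).1
        (h.congr hW fun q hq => (hd q hq).fderiv.symm)
      have h2 : FamCr γ 0
          (fun q : S × E => iteratedFDeriv ℝ (n + 1) (fun x => u (q.1, x)) q.2) W := by
        rw [e]; exact h.2.2.clm_apply _
      refine ⟨fun q hq => ?_, fun j hj => ?_, h2⟩
      · rw [Nat.cast_succ]
        refine contDiffAt_succ_iff_hasFDerivAt.2 ⟨_, ⟨{x | (q.1, x) ∈ W},
          (Continuous.prodMk_right q.1).continuousAt.eventually (hW.mem_nhds hq),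
          fun x hx => (hd (q.1, x) hx).differentiableAt.hasFDerivAt⟩, h.1 q hq⟩
      · cases j with
        | zero =>
          exact (LinearIsometryEquiv.continuous _).comp_continuousOn
            (g := (continuousMultilinearCurryFin0 ℝ E F).symm) hc
        | succ j =>
          rw [e]
          exact (ContinuousLinearMap.continuous _).comp_continuousOn (h.2.1 j (by omega))
    · rintro ⟨h1, h2, h3⟩
      have hc : ContinuousOn u W :=
        (LinearIsometryEquiv.continuous (continuousMultilinearCurryFin0 ℝ E F)).comp_continuousOn
          (h2 0 (by omega))
      refine ⟨hc, fun q => fderiv ℝ (fun x => u (q.1, x)) q.2, fun q hq =>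
        ((h1 q hq).differentiableAt (by simp)).hasFDerivAt, ?_⟩
      refine ih.2 ⟨fun q hq => (h1 q hq).fderiv_right (by simp), fun j hj => ?_, ?_⟩
      · change ContinuousOn
          (fun q : S × E => iteratedFDeriv ℝ j (fderiv ℝ fun x => u (q.1, x)) q.2) W
        rw [e']
        exact (ContinuousLinearMap.continuous _).comp_continuousOn (h2 (j + 1) (by omega))
      · change FamCr γ 0
          (fun q : S × E => iteratedFDeriv ℝ n (fderiv ℝ fun x => u (q.1, x)) q.2) W
        rw [e']
        exact h3.clm_apply _

end IteratedDerivatives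

/-! ### Evaluation of C^{n+γ} functions as a family parametrized by the function. -/

section Evaluation

variable {d : ℕ} {M : Type*} [TopologicalSpace M] [ChartedSpace (Model d) M]
variable {F : Type} [NormedAddCommGroup F] [NormedSpace ℝ F]
variable {𝒰 : CoordCover d M} {n : ℕ} {γ : ℝ≥0}

lemma supPart_le_crENorm (u : M → F) : supPart 𝒰 n u ≤ crENorm 𝒰 n γ u := le_self_add

lemma holderPart_le_crENorm (hγ : γ ≠ 0) (u : M → F) :
    holderPart 𝒰 n γ u ≤ crENorm 𝒰 n γ u := by
  rw [crENorm, if_neg hγ]; exact le_add_self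

lemma CrFun.norm_iteratedFDeriv_le (w : CrFun F 𝒰 n γ) (i : Fin 𝒰.card) {j : ℕ} (hj : j ≤ n)
    {y : Model d} (hy : y ∈ 𝒰.dom i) : ‖iteratedFDeriv ℝ j (𝒰.rep i w) y‖ ≤ ‖w‖ := by
  have h : ‖iteratedFDeriv ℝ j (𝒰.rep i w) y‖ₑ ≤ crENorm 𝒰 n γ (w : M → F) :=
    le_trans (le_iSup_of_le i (le_iSup_of_le (⟨j, Nat.lt_succ_iff.2 hj⟩ : Fin (n + 1))
      (le_iSup (fun y : 𝒰.dom i => ‖iteratedFDeriv ℝ j (𝒰.rep i (w : M → F)) (y : Model d)‖ₑ)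
        ⟨y, hy⟩))) (supPart_le_crENorm _)
  have := ENNReal.toReal_mono w.2.2 h
  rwa [toReal_enorm] at this

lemma CrFun.norm_iteratedFDeriv_sub_le (hγ : γ ≠ 0) (w : CrFun F 𝒰 n γ) (i : Fin 𝒰.card)
    {y z : Model d} (hy : y ∈ 𝒰.dom i) (hz : z ∈ 𝒰.dom i) :
    ‖iteratedFDeriv ℝ n (𝒰.rep i w) y - iteratedFDeriv ℝ n (𝒰.rep i w) z‖ ≤
      ‖w‖ * ‖y - z‖ ^ (γ : ℝ) := by
  set D := fun y : 𝒰.dom i => iteratedFDeriv ℝ n (𝒰.rep i (w : M → F)) (y : Model d) with hD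
  have h : eHolderNorm γ D ≤ crENorm 𝒰 n γ (w : M → F) :=
    le_trans (le_iSup_of_le i le_rfl) (holderPart_le_crENorm hγ _)
  have hm : MemHolder γ D :=
    eHolderNorm_ne_top.1 (ne_top_of_le_ne_top w.2.2 h)
  have h1 := hm.holderWith.dist_le ⟨y, hy⟩ ⟨z, hz⟩
  have h2 : ((nnHolderNorm γ D : ℝ≥0) : ℝ) ≤ ‖w‖ := ENNReal.toReal_mono w.2.2 h
  rw [dist_eq_norm, Subtype.dist_eq, dist_eq_norm] at h1
  exact h1.trans (by gcongr)

lemma CoordCover.isOpen_image (𝒰 : CoordCover d M) (i : Fin 𝒰.card) :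
    IsOpen (𝒰.chart i '' interior (𝒰.core i)) :=
  (𝒰.chart i).isOpen_image_of_subset_source isOpen_interior
    (interior_subset.trans (𝒰.core_subset i))

lemma CoordCover.image_subset (𝒰 : CoordCover d M) (i : Fin 𝒰.card) :
    𝒰.chart i '' interior (𝒰.core i) ⊆ 𝒰.dom i := image_mono interior_subset

lemma CoordCover.exists_mem_interior (𝒰 : CoordCover d M) (x : M) :
    ∃ i, x ∈ interior (𝒰.core i) :=
  mem_iUnion.1 (𝒰.iUnion_interior.symm ▸ mem_univ x)

/-- The evaluation of functions of class `C^{n+γ}` is a family of class `C^{n+γ}`. -/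
lemma famCr_eval (𝒰 : CoordCover d M) (i : Fin 𝒰.card) :
    FamCr γ n (fun q : CrFun F 𝒰 n γ × Model d => 𝒰.rep i q.1 q.2)
      (univ ×ˢ (𝒰.chart i '' interior (𝒰.core i))) := by
  have hO := 𝒰.isOpen_image i
  have hcd : ∀ w : CrFun F 𝒰 n γ, ∀ y ∈ 𝒰.chart i '' interior (𝒰.core i),
      ContDiffAt ℝ n (𝒰.rep i w) y :=
    fun w y hy => contDiffAt_rep 𝒰 w.2.1 i (𝒰.image_subset i hy)
  have hc : ∀ j ≤ n, ContinuousOn (fun q : CrFun F 𝒰 n γ × Model d =>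
      iteratedFDeriv ℝ j (𝒰.rep i q.1) q.2) (univ ×ˢ (𝒰.chart i '' interior (𝒰.core i))) := by
    rintro j hj ⟨w₀, y₀⟩ ⟨-, hy₀⟩
    refine ContinuousAt.continuousWithinAt ?_
    have h1 : ContinuousAt (fun y => iteratedFDeriv ℝ j (𝒰.rep i w₀) y) y₀ :=
      (hcd w₀ y₀ hy₀).continuousAt_iteratedFDeriv (by exact_mod_cast hj)
    -- Joint continuity splits: changing the function costs at most the norm of the difference,
    -- uniformly in the point, and for the fixed function the derivative is continuous.
    have h2 : Tendsto (fun q : CrFun F 𝒰 n γ × Model d =>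
        ‖q.1 - w₀‖ + ‖iteratedFDeriv ℝ j (𝒰.rep i w₀) q.2 -
          iteratedFDeriv ℝ j (𝒰.rep i w₀) y₀‖) (𝓝 (w₀, y₀)) (𝓝 0) := by
      have a : Tendsto (fun q : CrFun F 𝒰 n γ × Model d => ‖q.1 - w₀‖) (𝓝 (w₀, y₀)) (𝓝 0) := by
        have : Continuous fun q : CrFun F 𝒰 n γ × Model d => ‖q.1 - w₀‖ := by fun_prop
        exact this.tendsto' _ _ (by simp)
      have b := (tendsto_iff_norm_sub_tendsto_zero.1 h1.tendsto).comp
        (continuous_snd.tendsto (w₀, y₀))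
      simpa using a.add b
    refine tendsto_iff_norm_sub_tendsto_zero.2 (squeeze_zero' ?_ ?_ h2)
    · exact Eventually.of_forall fun _ => norm_nonneg _
    · filter_upwards [continuous_snd.continuousAt.eventually (hO.mem_nhds hy₀)] with q hq
      refine (norm_sub_le_norm_sub_add_norm_sub _ (iteratedFDeriv ℝ j (𝒰.rep i w₀) q.2) _).trans ?_
      gcongr
      have : iteratedFDeriv ℝ j (𝒰.rep i q.1) q.2 - iteratedFDeriv ℝ j (𝒰.rep i w₀) q.2 =
          iteratedFDeriv ℝ j (𝒰.rep i (q.1 - w₀ : CrFun F 𝒰 n γ)) q.2 := by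
        exact (iteratedFDeriv_sub_apply ((hcd q.1 _ hq).of_le (by exact_mod_cast hj))
          ((hcd w₀ _ hq).of_le (by exact_mod_cast hj))).symm
      rw [this]
      exact CrFun.norm_iteratedFDeriv_le _ i hj (𝒰.image_subset i hq)
  refine (famCr_iff_iteratedFDeriv (isOpen_univ.prod hO)).2
    ⟨fun q hq => hcd q.1 q.2 hq.2, hc, hc n le_rfl, fun h0 q hq => ⟨‖q.1‖ + 1, by positivity, ?_⟩⟩
  -- The Hölder constant of a function is at most its norm, which stays below ‖q.1‖ + 1 nearby.
  have h1 : ∀ᶠ z : CrFun F 𝒰 n γ × Model d × Model d in 𝓝 (q.1, q.2, q.2), ‖z.1‖ ≤ ‖q.1‖ + 1 :=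
    eventually_norm_le (F := ℝ) (u := fun z : CrFun F 𝒰 n γ × Model d × Model d => ‖z.1‖)
      (by fun_prop) |>.mono fun z hz => by simpa using hz
  filter_upwards [h1, (tendsto_fst_triple q).eventually ((isOpen_univ.prod hO).mem_nhds hq),
    (tendsto_snd_triple q).eventually ((isOpen_univ.prod hO).mem_nhds hq)] with z h2 h3 h4
  refine (CrFun.norm_iteratedFDeriv_sub_le h0 z.1 i (𝒰.image_subset i h3.2)
    (𝒰.image_subset i h4.2)).trans ?_
  gcongr

end Evaluation

/-! ### Families of functions on a manifold and independence of the chart. -/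

section ManifoldFamilies

variable {S : Type*} [TopologicalSpace S] {S' : Type*} [TopologicalSpace S']
variable {d : ℕ} {M : Type*} [TopologicalSpace M] [ChartedSpace (Model d) M]
variable {F : Type} [NormedAddCommGroup F] [NormedSpace ℝ F]
variable {n : ℕ} {γ : ℝ≥0}

variable (d) in
/-- The family of functions `u s : M → F` is of class `C^{n+γ}` near `(s₀, x₀)`. -/
def MFam (γ : ℝ≥0) (n : ℕ) (u : S → M → F) (s₀ : S) (x₀ : M) : Prop :=
  ∃ φ ∈ IsManifold.maximalAtlas (𝓡 d) ∞ M, x₀ ∈ φ.source ∧ ∃ W : Set (S × Model d), IsOpen W ∧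
    (s₀, φ x₀) ∈ W ∧ FamCr γ n (fun q : S × Model d => u q.1 (φ.symm q.2)) W

lemma contDiffOn_transition {φ ψ : OpenPartialHomeomorph M (Model d)}
    (hφ : φ ∈ IsManifold.maximalAtlas (𝓡 d) ∞ M) (hψ : ψ ∈ IsManifold.maximalAtlas (𝓡 d) ∞ M) :
    ContDiffOn ℝ ∞ (φ ∘ ψ.symm) (ψ.target ∩ ψ.symm ⁻¹' φ.source) := by
  rintro z ⟨hz, hz'⟩
  exact ((contMDiffAt_of_mem_maximalAtlas hφ hz').comp z
    (contMDiffAt_symm_of_mem_maximalAtlas hψ hz)).contDiffAt.contDiffWithinAt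

lemma famCr_of_contDiffOn (hγ : γ ≤ 1) {E G : Type} [NormedAddCommGroup E] [NormedSpace ℝ E]
    [NormedAddCommGroup G] [NormedSpace ℝ G] {V : Set E} (hV : IsOpen V) {φ : E → G}
    (hφ : ContDiffOn ℝ ∞ φ V) : FamCr γ n (fun q : S × E => φ q.2) (univ ×ˢ V) :=
  (FamCr.snd hγ).smooth_comp hγ (isOpen_univ.prod hV) hV hφ fun _ h => h.2

/-- The regularity of a family does not depend on the chart. -/
lemma MFam.famCr (hγ : γ ≤ 1) {u : S → M → F} {s₀ : S} {x₀ : M} (h : MFam d γ n u s₀ x₀)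
    {ψ : OpenPartialHomeomorph M (Model d)} (hψ : ψ ∈ IsManifold.maximalAtlas (𝓡 d) ∞ M)
    (hx : x₀ ∈ ψ.source) : ∃ W : Set (S × Model d), IsOpen W ∧ (s₀, ψ x₀) ∈ W ∧
      (∀ q ∈ W, q.2 ∈ ψ.target) ∧ FamCr γ n (fun q : S × Model d => u q.1 (ψ.symm q.2)) W := by
  obtain ⟨φ, hφ, hxφ, W, hW, hmem, hf⟩ := h
  set V := ψ.target ∩ ψ.symm ⁻¹' φ.source with hVdef
  have hV : IsOpen V := ψ.symm.isOpen_inter_preimage φ.open_source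
  have hτ := contDiffOn_transition hφ hψ
  have hcont : ContinuousOn (fun q : S × Model d => (q.1, (φ ∘ ψ.symm) q.2)) (univ ×ˢ V) :=
    continuousOn_fst.prodMk (hτ.continuousOn.comp continuousOn_snd fun q hq => hq.2)
  set W' := (univ ×ˢ V) ∩ (fun q : S × Model d => (q.1, (φ ∘ ψ.symm) q.2)) ⁻¹' W
  have hW' : IsOpen W' := hcont.isOpen_inter_preimage (isOpen_univ.prod hV) hW
  -- The transition map is smooth, hence Lipschitz as composition of families requires.
  have hL : LocHolder 1 (fun q : S × Model d => (φ ∘ ψ.symm) q.2) W' :=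
    ((famCr_of_contDiffOn (n := 1) hγ hV hτ).mono inter_subset_left).locHolder_of_succ le_rfl hW'
  refine ⟨W', hW', ⟨⟨trivial, ψ.map_source hx, ?_⟩, ?_⟩, fun q hq => hq.1.2.1, ?_⟩
  · simpa [hx] using hxφ
  · simpa [hx] using hmem
  · refine (hf.comp hγ hW' ((famCr_of_contDiffOn hγ hV hτ).mono inter_subset_left) hL
      fun q hq => hq.2).congr hW' fun q hq => ?_
    simp only [Function.comp]
    rw [φ.left_inv hq.1.2.2]

lemma MFam.reparam {σ : S' → S} (hσ : Continuous σ) {u : S → M → F} {s₀ : S'} {x₀ : M}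
    (h : MFam d γ n u (σ s₀) x₀) : MFam d γ n (fun s => u (σ s)) s₀ x₀ := by
  obtain ⟨φ, hφ, hxφ, W, hW, hmem, hf⟩ := h
  have hc : Continuous fun q : S' × Model d => (σ q.1, q.2) := by fun_prop
  exact ⟨φ, hφ, hxφ, _, hW.preimage hc, hmem, hf.reparam hσ fun q hq => hq⟩

lemma MFam.eventually {u : S → M → F} {s₀ : S} {x₀ : M} (h : MFam d γ n u s₀ x₀) :
    ∀ᶠ z in 𝓝 (s₀, x₀), MFam d γ n u z.1 z.2 := by
  obtain ⟨φ, hφ, hxφ, W, hW, hmem, hf⟩ := h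
  have hc : ContinuousAt (fun z : S × M => (z.1, φ z.2)) (s₀, x₀) :=
    continuousAt_fst.prodMk (ContinuousAt.comp (f := Prod.snd) (x := (s₀, x₀))
      (φ.continuousAt hxφ) continuousAt_snd)
  filter_upwards [hc.eventually (hW.mem_nhds hmem),
    continuousAt_snd.eventually (φ.open_source.mem_nhds hxφ)] with z h1 h2
  exact ⟨φ, hφ, h2, W, hW, h1, hf⟩

lemma MFam.continuousAt {u : S → M → F} {s₀ : S} {x₀ : M} (h : MFam d γ n u s₀ x₀) :
    ContinuousAt (fun z : S × M => u z.1 z.2) (s₀, x₀) := by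
  obtain ⟨φ, hφ, hxφ, W, hW, hmem, hf⟩ := h
  have hc : ContinuousAt (fun z : S × M => (z.1, φ z.2)) (s₀, x₀) :=
    continuousAt_fst.prodMk (ContinuousAt.comp (f := Prod.snd) (x := (s₀, x₀))
      (φ.continuousAt hxφ) continuousAt_snd)
  have h1 := ContinuousAt.comp (f := fun z : S × M => (z.1, φ z.2)) (x := (s₀, x₀))
    (hf.continuousOn.continuousAt (hW.mem_nhds hmem)) hc
  refine h1.congr ?_
  filter_upwards [continuousAt_snd.eventually (φ.open_source.mem_nhds hxφ)] with z hz
  simp [φ.left_inv hz]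

lemma mfam_eval (𝒰 : CoordCover d M) (w : CrFun F 𝒰 n γ) (x : M) :
    MFam d γ n (fun (w : CrFun F 𝒰 n γ) x => w x) w x := by
  obtain ⟨i, hi⟩ := 𝒰.exists_mem_interior x
  exact ⟨𝒰.chart i, 𝒰.chart_mem i, 𝒰.core_subset i (interior_subset hi), _,
    isOpen_univ.prod (𝒰.isOpen_image i), ⟨trivial, mem_image_of_mem _ hi⟩, famCr_eval 𝒰 i⟩

end ManifoldFamilies

/-! ### From local regularity of a family to bounds and continuity in norm. -/

section UniformBounds

/-- A tube lemma with constants: near each point a constant and a product neighbourhood work, and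
monotonicity in the constant allows the maximum over a finite cover. -/
lemma exists_eventually_forall_of_isCompact {S X : Type*} [TopologicalSpace S] [TopologicalSpace X]
    {K : Set X} (hK : IsCompact K) {s₀ : S} {Q : ℝ → S → X → Prop}
    (hmono : ∀ C C' s x, C ≤ C' → Q C s x → Q C' s x)
    (h : ∀ x ∈ K, ∃ C, ∀ᶠ z in 𝓝 (s₀, x), Q C z.1 z.2) :
    ∃ C, ∀ᶠ s in 𝓝 s₀, ∀ x ∈ K, Q C s x := by
  refine hK.induction_on (p := fun K => ∃ C, ∀ᶠ s in 𝓝 s₀, ∀ x ∈ K, Q C s x) ⟨0, by simp⟩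
    (fun s t hst ⟨C, hC⟩ => ⟨C, hC.mono fun s h x hx => h x (hst hx)⟩) ?_ fun x hx => ?_
  · rintro s t ⟨C, hC⟩ ⟨D, hD⟩
    refine ⟨max C D, ?_⟩
    filter_upwards [hC, hD] with s h1 h2 x hx
    rcases hx with hx | hx
    · exact hmono _ _ _ _ (le_max_left _ _) (h1 x hx)
    · exact hmono _ _ _ _ (le_max_right _ _) (h2 x hx)
  · obtain ⟨C, hC⟩ := h x hx
    rw [nhds_prod_eq, Filter.eventually_prod_iff] at hC
    obtain ⟨pa, ha, pb, hb, h⟩ := hC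
    exact ⟨_, mem_nhdsWithin_of_mem_nhds hb, C, ha.mono fun s hs x hx => h hs hx⟩

lemma exists_eventually_forall_of_finite {S ι : Type*} [TopologicalSpace S] [Finite ι] {s₀ : S}
    {Q : ℝ → S → ι → Prop} (hmono : ∀ C C' s i, C ≤ C' → Q C s i → Q C' s i)
    (h : ∀ i, ∃ C, ∀ᶠ s in 𝓝 s₀, Q C s i) : ∃ C, ∀ᶠ s in 𝓝 s₀, ∀ i, Q C s i := by
  choose C hC using h
  obtain ⟨D, hD⟩ := (finite_range C).bddAbove
  exact ⟨D, eventually_all.2 fun i =>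
    (hC i).mono fun s hs => hmono _ _ _ _ (hD (mem_range_self i)) hs⟩

variable {S : Type*} [TopologicalSpace S]
variable {d : ℕ} {M : Type*} [TopologicalSpace M] [ChartedSpace (Model d) M]
variable {F : Type} [NormedAddCommGroup F] [NormedSpace ℝ F]
variable {n : ℕ} {γ : ℝ≥0} {𝒰 : CoordCover d M}

lemma crENorm_le_of_forall {u : M → F} {C : ℝ} (hC : 0 ≤ C)
    (h1 : ∀ i, ∀ j ≤ n, ∀ y ∈ 𝒰.dom i, ‖iteratedFDeriv ℝ j (𝒰.rep i u) y‖ ≤ C)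
    (h2 : γ ≠ 0 → ∀ i, ∀ y ∈ 𝒰.dom i, ∀ z ∈ 𝒰.dom i,
      ‖iteratedFDeriv ℝ n (𝒰.rep i u) y - iteratedFDeriv ℝ n (𝒰.rep i u) z‖ ≤
        C * ‖y - z‖ ^ (γ : ℝ)) :
    crENorm 𝒰 n γ u ≤ ENNReal.ofReal (2 * C) := by
  have a : supPart 𝒰 n u ≤ ENNReal.ofReal C := by
    refine iSup_le fun i => iSup_le fun j => iSup_le fun y => ?_
    rw [← ofReal_norm]
    exact ENNReal.ofReal_le_ofReal (h1 i j (Nat.lt_succ_iff.1 j.2) y y.2)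
  -- One `C` pays for the sup part, the other for the Hölder part.
  rw [two_mul, ENNReal.ofReal_add hC hC, crENorm]
  refine add_le_add a ?_
  split_ifs with h0
  · exact zero_le
  · refine iSup_le fun i => ?_
    refine HolderWith.eHolderNorm_le (C := C.toNNReal) fun y z => ?_
    rw [edist_dist, edist_dist, dist_eq_norm, Subtype.dist_eq, dist_eq_norm,
      ENNReal.ofReal_rpow_of_nonneg (norm_nonneg _) γ.coe_nonneg]
    change _ ≤ ENNReal.ofReal C * _
    rw [← ENNReal.ofReal_mul hC]
    exact ENNReal.ofReal_le_ofReal (h2 h0 i y y.2 z z.2)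

lemma contMDiffAt_of_contDiffAt_symm {φ : OpenPartialHomeomorph M (Model d)}
    (hφ : φ ∈ IsManifold.maximalAtlas (𝓡 d) ∞ M) {x : M} (hx : x ∈ φ.source) {u : M → F}
    (hu : ContDiffAt ℝ n (fun y => u (φ.symm y)) (φ x)) : ContMDiffAt (𝓡 d) 𝓘(ℝ, F) n u x := by
  have h1 : ContMDiffAt (𝓡 d) (𝓡 d) n φ x :=
    (contMDiffAt_of_mem_maximalAtlas hφ hx).of_le (by exact_mod_cast le_top)
  refine (ContMDiffAt.comp x (g := fun y => u (φ.symm y)) hu.contMDiffAt h1).congr_of_eventuallyEq ?_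
  filter_upwards [φ.open_source.mem_nhds hx] with y hy
  simp [φ.left_inv hy]

lemma CoordCover.isCompact_dom (𝒰 : CoordCover d M) (i : Fin 𝒰.card) : IsCompact (𝒰.dom i) :=
  (𝒰.isCompact_core i).image_of_continuousOn
    ((𝒰.chart i).continuousOn.mono (𝒰.core_subset i))

lemma MFam.famCr_rep (hγ : γ ≤ 1) {u : S → M → F} {s₀ : S} {i : Fin 𝒰.card} {y : Model d}
    (hy : y ∈ 𝒰.dom i) (h : ∀ x, MFam d γ n u s₀ x) :
    ∃ W : Set (S × Model d), IsOpen W ∧ (s₀, y) ∈ W ∧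
      FamCr γ n (fun q : S × Model d => 𝒰.rep i (u q.1) q.2) W := by
  obtain ⟨x, hx, rfl⟩ := hy
  obtain ⟨W, hW, hm, -, hf⟩ := (h x).famCr hγ (𝒰.chart_mem i) (𝒰.core_subset i hx)
  exact ⟨W, hW, hm, hf⟩

lemma MFam.continuousAt_iteratedFDeriv (hγ : γ ≤ 1) {u : S → M → F} {s₀ : S} {i : Fin 𝒰.card}
    {y : Model d} (hy : y ∈ 𝒰.dom i) (h : ∀ x, MFam d γ n u s₀ x) {j : ℕ} (hj : j ≤ n) :
    ContinuousAt (fun q : S × Model d => iteratedFDeriv ℝ j (𝒰.rep i (u q.1)) q.2) (s₀, y) := by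
  obtain ⟨W, hW, hm, hf⟩ := MFam.famCr_rep hγ hy h
  exact (((famCr_iff_iteratedFDeriv hW).1 hf).2.1 j hj).continuousAt (hW.mem_nhds hm)

lemma MFam.eventually_contMDiff [CompactSpace M] {u : S → M → F} {s₀ : S}
    (h : ∀ x, MFam d γ n u s₀ x) :
    ∀ᶠ s in 𝓝 s₀, ContMDiff (𝓡 d) 𝓘(ℝ, F) n (u s) := by
  have := isCompact_univ.eventually_forall_of_forall_eventually (x₀ := s₀)
    (P := fun (s : S) (x : M) => ContMDiffAt (𝓡 d) 𝓘(ℝ, F) n (u s) x) fun x _ => by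
      filter_upwards [(h x).eventually] with z hz
      obtain ⟨φ, hφ, hx, W, hW, hm, hf⟩ := hz
      exact contMDiffAt_of_contDiffAt_symm hφ hx (((famCr_iff_iteratedFDeriv hW).1 hf).1 _ hm)
  exact this.mono fun s hs x => hs x (mem_univ x)

/-- A family of class `C^{n+γ}` on a compact manifold is locally bounded in the `C^{n+γ}` norm. -/
lemma MFam.eventually_crENorm_le [CompactSpace M] (hγ : γ ≤ 1) {u : S → M → F} {s₀ : S}
    (h : ∀ x, MFam d γ n u s₀ x) (𝒰 : CoordCover d M) :
    ∃ C : ℝ, 0 ≤ C ∧ ∀ᶠ s in 𝓝 s₀, crENorm 𝒰 n γ (u s) ≤ ENNReal.ofReal C := by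
  have h1 : ∃ C, ∀ᶠ s in 𝓝 s₀, ∀ i, ∀ j : Fin (n + 1), ∀ y ∈ 𝒰.dom i,
      ‖iteratedFDeriv ℝ (j : ℕ) (𝒰.rep i (u s)) y‖ ≤ C := by
    refine exists_eventually_forall_of_finite
      (Q := fun C s i => ∀ j : Fin (n + 1), ∀ y ∈ 𝒰.dom i,
        ‖iteratedFDeriv ℝ (j : ℕ) (𝒰.rep i (u s)) y‖ ≤ C)
      (fun C C' s i hC h j y hy => (h j y hy).trans hC) fun i => ?_
    refine exists_eventually_forall_of_finite
      (Q := fun C s (j : Fin (n + 1)) => ∀ y ∈ 𝒰.dom i,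
        ‖iteratedFDeriv ℝ (j : ℕ) (𝒰.rep i (u s)) y‖ ≤ C)
      (fun C C' s i hC h y hy => (h y hy).trans hC) fun j => ?_
    refine exists_eventually_forall_of_isCompact (𝒰.isCompact_dom i)
      (Q := fun C s y => ‖iteratedFDeriv ℝ (j : ℕ) (𝒰.rep i (u s)) y‖ ≤ C)
      (fun C C' s x hC h => h.trans hC) fun y hy => ?_
    exact ⟨_, eventually_norm_le
      (MFam.continuousAt_iteratedFDeriv hγ hy h (Nat.lt_succ_iff.1 j.2))⟩
  have h2 : γ ≠ 0 → ∃ C, ∀ᶠ s in 𝓝 s₀, ∀ i, ∀ p ∈ 𝒰.dom i ×ˢ 𝒰.dom i,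
      ‖iteratedFDeriv ℝ n (𝒰.rep i (u s)) p.1 - iteratedFDeriv ℝ n (𝒰.rep i (u s)) p.2‖ ≤
        C * ‖p.1 - p.2‖ ^ (γ : ℝ) := by
    intro h0
    have hm : ∀ (C C' : ℝ) (s : S) (i : Fin 𝒰.card) (p : Model d × Model d), C ≤ C' →
      ‖iteratedFDeriv ℝ n (𝒰.rep i (u s)) p.1 - iteratedFDeriv ℝ n (𝒰.rep i (u s)) p.2‖ ≤
        C * ‖p.1 - p.2‖ ^ (γ : ℝ) →
      ‖iteratedFDeriv ℝ n (𝒰.rep i (u s)) p.1 - iteratedFDeriv ℝ n (𝒰.rep i (u s)) p.2‖ ≤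
        C' * ‖p.1 - p.2‖ ^ (γ : ℝ) := fun C C' s i p hC h => h.trans (by gcongr)
    refine exists_eventually_forall_of_finite
      (Q := fun C s i => ∀ p ∈ 𝒰.dom i ×ˢ 𝒰.dom i,
        ‖iteratedFDeriv ℝ n (𝒰.rep i (u s)) p.1 - iteratedFDeriv ℝ n (𝒰.rep i (u s)) p.2‖ ≤
          C * ‖p.1 - p.2‖ ^ (γ : ℝ))
      (fun C C' s i hC h p hp => hm C C' s i p hC (h p hp)) fun i => ?_
    refine exists_eventually_forall_of_isCompact ((𝒰.isCompact_dom i).prod (𝒰.isCompact_dom i))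
      (Q := fun C s p =>
        ‖iteratedFDeriv ℝ n (𝒰.rep i (u s)) p.1 - iteratedFDeriv ℝ n (𝒰.rep i (u s)) p.2‖ ≤
          C * ‖p.1 - p.2‖ ^ (γ : ℝ)) (fun C C' s p hC h => hm C C' s i p hC h) ?_
    rintro ⟨y, z⟩ ⟨hy, hz⟩
    -- The seminorm compares all pairs, not only close ones. Near a diagonal point the local Hölder
    -- bound applies; at a point off the diagonal the difference quotient is jointly continuous and
    -- so locally bounded.
    rcases eq_or_ne y z with rfl | hyz
    · obtain ⟨W, hW, hmem, hf⟩ := MFam.famCr_rep hγ hy h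
      obtain ⟨C, -, hC⟩ := (((famCr_iff_iteratedFDeriv hW).1 hf).2.2).2 h0 _ hmem
      exact ⟨C, hC⟩
    · have hyz' : 0 < ‖y - z‖ := norm_pos_iff.2 (sub_ne_zero.2 hyz)
      have c1 : ContinuousAt (fun q : S × Model d × Model d =>
          iteratedFDeriv ℝ n (𝒰.rep i (u q.1)) q.2.1) (s₀, y, z) :=
        ContinuousAt.comp (f := fun q : S × Model d × Model d => (q.1, q.2.1)) (x := (s₀, y, z))
          (MFam.continuousAt_iteratedFDeriv hγ hy h le_rfl) (by fun_prop)
      have c2 : ContinuousAt (fun q : S × Model d × Model d =>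
          iteratedFDeriv ℝ n (𝒰.rep i (u q.1)) q.2.2) (s₀, y, z) :=
        ContinuousAt.comp (f := fun q : S × Model d × Model d => (q.1, q.2.2)) (x := (s₀, y, z))
          (MFam.continuousAt_iteratedFDeriv hγ hz h le_rfl) (by fun_prop)
      have c3 : ContinuousAt (fun q : S × Model d × Model d => ‖q.2.1 - q.2.2‖ ^ (γ : ℝ))
          (s₀, y, z) :=
        ContinuousAt.rpow_const (by fun_prop) (Or.inl hyz'.ne')
      have c4 : ContinuousAt (fun q : S × Model d × Model d =>
          ‖iteratedFDeriv ℝ n (𝒰.rep i (u q.1)) q.2.1 - iteratedFDeriv ℝ n (𝒰.rep i (u q.1)) q.2.2‖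
            / ‖q.2.1 - q.2.2‖ ^ (γ : ℝ)) (s₀, y, z) :=
        (c1.sub c2).norm.div c3 (Real.rpow_pos_of_pos hyz' _).ne'
      refine ⟨‖iteratedFDeriv ℝ n (𝒰.rep i (u s₀)) y - iteratedFDeriv ℝ n (𝒰.rep i (u s₀)) z‖
            / ‖y - z‖ ^ (γ : ℝ) + 1, ?_⟩
      filter_upwards [c4.eventually (gt_mem_nhds (lt_add_one _)),
        c3.eventually (lt_mem_nhds (Real.rpow_pos_of_pos hyz' _))] with q h3 h4
      exact (div_le_iff₀ h4).1 h3.le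
  obtain ⟨C, hC⟩ := h1
  by_cases h0 : γ = 0
  · refine ⟨2 * max C 0, by positivity, hC.mono fun s hs => ?_⟩
    exact crENorm_le_of_forall (le_max_right _ _) (fun i j hj y hy =>
      (hs i ⟨j, Nat.lt_succ_iff.2 hj⟩ y hy).trans (le_max_left _ _)) fun h => (h h0).elim
  · obtain ⟨D, hD⟩ := h2 h0
    refine ⟨2 * max (max C D) 0, by positivity, ?_⟩
    filter_upwards [hC, hD] with s hs hs'
    refine crENorm_le_of_forall (le_max_right _ _) (fun i j hj y hy =>
      (hs i ⟨j, Nat.lt_succ_iff.2 hj⟩ y hy).trans ((le_max_left _ _).trans (le_max_left _ _)))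
      fun _ i y hy z hz => (hs' i (y, z) ⟨hy, hz⟩).trans ?_
    gcongr
    exact (le_max_right _ _).trans (le_max_left _ _)

lemma MFam.eventually_isCr [CompactSpace M] (hγ : γ ≤ 1) {u : S → M → F} {s₀ : S}
    (h : ∀ x, MFam d γ n u s₀ x) (𝒰 : CoordCover d M) :
    ∀ᶠ s in 𝓝 s₀, IsCr 𝒰 n γ (u s) := by
  obtain ⟨C, -, hC⟩ := MFam.eventually_crENorm_le hγ h 𝒰
  filter_upwards [hC, MFam.eventually_contMDiff h] with s h1 h2
  exact ⟨h2, ne_top_of_le_ne_top ENNReal.ofReal_ne_top h1⟩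

/-- A family of class `C^n` on a compact manifold is continuous in the `C^n` norm. -/
lemma MFam.eventually_crENorm_sub_le [CompactSpace M] {u : S → M → F} {s₀ : S}
    (h : ∀ x, MFam d 0 n u s₀ x) (𝒰 : CoordCover d M) {δ : ℝ} (hδ : 0 < δ) :
    ∀ᶠ s in 𝓝 s₀, crENorm 𝒰 n 0 (u s - u s₀) ≤ ENNReal.ofReal δ := by
  have h0 : ContMDiff (𝓡 d) 𝓘(ℝ, F) n (u s₀) := (MFam.eventually_contMDiff h).self_of_nhds
  -- The bound δ / 2 compensates the factor 2 in `crENorm_le_of_forall`.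
  have h1 : ∀ᶠ s in 𝓝 s₀, ∀ i, ∀ j : Fin (n + 1), ∀ y ∈ 𝒰.dom i,
      ‖iteratedFDeriv ℝ (j : ℕ) (𝒰.rep i (u s)) y -
        iteratedFDeriv ℝ (j : ℕ) (𝒰.rep i (u s₀)) y‖ < δ / 2 := by
    refine eventually_all.2 fun i => eventually_all.2 fun j => ?_
    refine (𝒰.isCompact_dom i).eventually_forall_of_forall_eventually fun y hy => ?_
    have hj := Nat.lt_succ_iff.1 j.2
    have c1 := MFam.continuousAt_iteratedFDeriv zero_le_one hy h hj
    have c2 : ContinuousAt (fun q : S × Model d => iteratedFDeriv ℝ (j : ℕ) (𝒰.rep i (u s₀)) q.2)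
        (s₀, y) := ContinuousAt.comp (f := fun q : S × Model d => (s₀, q.2)) (x := (s₀, y))
          (MFam.continuousAt_iteratedFDeriv zero_le_one hy h hj) (by fun_prop)
    refine (c1.sub c2).norm.eventually (gt_mem_nhds ?_)
    simpa using hδ
  filter_upwards [h1, MFam.eventually_contMDiff h] with s h2 h3
  have : δ = 2 * (δ / 2) := by ring
  rw [this]
  refine crENorm_le_of_forall (by positivity) (fun i j hj y hy => ?_) (by simp)
  have e : iteratedFDeriv ℝ j (𝒰.rep i (u s - u s₀)) y =
      iteratedFDeriv ℝ j (𝒰.rep i (u s)) y - iteratedFDeriv ℝ j (𝒰.rep i (u s₀)) y :=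
    iteratedFDeriv_sub_apply ((contDiffAt_rep 𝒰 h3 i hy).of_le (by exact_mod_cast hj))
      ((contDiffAt_rep 𝒰 h0 i hy).of_le (by exact_mod_cast hj))
  rw [e]
  exact (h2 i ⟨j, Nat.lt_succ_iff.2 hj⟩ y hy).le

end UniformBounds

/-! ### Completeness of the spaces C^{n+γ}(M, F). -/

section Completeness

/-- Iterated differentiation of a limit: the first derivatives converge uniformly, their limit is
the derivative of `g`, and the induction continues with the derivatives in place of the functions.
-/
lemma contDiffAt_of_uniformCauchySeqOn {E F : Type} [NormedAddCommGroup E] [NormedSpace ℝ E]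
    [NormedAddCommGroup F] [NormedSpace ℝ F] [CompleteSpace F] {V : Set E} (hV : IsOpen V) {n : ℕ}
    {f : ℕ → E → F} {g : E → F} (hf : ∀ m, ∀ x ∈ V, ContDiffAt ℝ n (f m) x)
    (hc : ∀ j ≤ n, UniformCauchySeqOn (fun m => iteratedFDeriv ℝ j (f m)) atTop V)
    (hg : ∀ x ∈ V, Tendsto (fun m => f m x) atTop (𝓝 (g x))) :
    (∀ x ∈ V, ContDiffAt ℝ n g x) ∧ ∀ j ≤ n, ∀ x ∈ V,
      Tendsto (fun m => iteratedFDeriv ℝ j (f m) x) atTop (𝓝 (iteratedFDeriv ℝ j g x)) := by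
  have h00 : ∀ x ∈ V,
      Tendsto (fun m => iteratedFDeriv ℝ 0 (f m) x) atTop (𝓝 (iteratedFDeriv ℝ 0 g x)) :=
    fun x hx => ((continuousMultilinearCurryFin0 ℝ E F).symm.continuous.tendsto _).comp (hg x hx)
  induction n generalizing F with
  | zero =>
    refine ⟨fun x hx => ?_, fun j hj x hx => ?_⟩
    · rw [Nat.cast_zero, contDiffAt_zero]
      have h0 : UniformCauchySeqOn f atTop V :=
        (continuousMultilinearCurryFin0 ℝ E F).isometry.uniformContinuous.comp_uniformCauchySeqOn
          (hc 0 le_rfl)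
      refine ⟨V, hV.mem_nhds hx, (h0.tendstoUniformlyOn_of_tendsto hg).continuousOn ?_⟩
      exact Frequently.of_forall fun m y hy => (hf m y hy).continuousAt.continuousWithinAt
    · obtain rfl : j = 0 := by omega
      exact h00 x hx
  | succ n ih =>
    have e : ∀ j (h : E → F) x, iteratedFDeriv ℝ j (fderiv ℝ h) x =
        continuousMultilinearCurryRightEquiv' ℝ j E F (iteratedFDeriv ℝ (j + 1) h x) := by
      intro j h x; rw [iteratedFDeriv_succ_eq_comp_right]; simp
    have hc' : ∀ j ≤ n, UniformCauchySeqOn (fun m => iteratedFDeriv ℝ j (fderiv ℝ (f m)))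
        atTop V := by
      intro j hj
      have := (continuousMultilinearCurryRightEquiv' ℝ j E
        F).isometry.uniformContinuous.comp_uniformCauchySeqOn (hc (j + 1) (by omega))
      have he : (fun m => iteratedFDeriv ℝ j (fderiv ℝ (f m))) = fun m =>
          continuousMultilinearCurryRightEquiv' ℝ j E F ∘ iteratedFDeriv ℝ (j + 1) (f m) :=
        funext fun m => funext fun x => e j (f m) x
      rw [he]
      exact this
    have h0 : UniformCauchySeqOn (fun m => fderiv ℝ (f m)) atTop V :=
        (continuousMultilinearCurryFin0 ℝ E
          (E →L[ℝ] F)).isometry.uniformContinuous.comp_uniformCauchySeqOn (hc' 0 (Nat.zero_le n))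
    have hl : ∀ x, ∃ l, x ∈ V → Tendsto (fun m => fderiv ℝ (f m) x) atTop (𝓝 l) := by
      intro x
      by_cases hx : x ∈ V
      · obtain ⟨l, hl⟩ := cauchySeq_tendsto_of_complete (h0.cauchySeq hx)
        exact ⟨l, fun _ => hl⟩
      · exact ⟨0, fun h => (hx h).elim⟩
    choose g' hg' using hl
    have hd : ∀ x ∈ V, HasFDerivAt g (g' x) x := fun x hx =>
      hasFDerivAt_of_tendstoUniformlyOn hV (h0.tendstoUniformlyOn_of_tendsto hg')
        (fun m y hy => ((hf m y hy).differentiableAt (by simp)).hasFDerivAt) hg hx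
    have hg2 : ∀ x ∈ V, Tendsto (fun m => fderiv ℝ (f m) x) atTop (𝓝 (fderiv ℝ g x)) :=
      fun x hx => by rw [(hd x hx).fderiv]; exact hg' x hx
    obtain ⟨h1, h2⟩ := ih (fun m x hx => (hf m x hx).fderiv_right (by simp)) hc' hg2
      fun x hx => ((continuousMultilinearCurryFin0 ℝ E (E →L[ℝ] F)).symm.continuous.tendsto _).comp
        (hg2 x hx)
    refine ⟨fun x hx => ?_, fun j hj x hx => ?_⟩
    · rw [Nat.cast_succ]
      exact contDiffAt_succ_iff_hasFDerivAt.2 ⟨_, ⟨V, hV.mem_nhds hx,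
          fun x hx => (hd x hx).differentiableAt.hasFDerivAt⟩, h1 x hx⟩
    · cases j with
      | zero => exact h00 x hx
      | succ j =>
        have := ((continuousMultilinearCurryRightEquiv' ℝ j E F).symm.continuous.tendsto _).comp
          (h2 j (by omega) x hx)
        simpa [Function.comp_def, e] using this

variable {d : ℕ} {M : Type*} [TopologicalSpace M] [ChartedSpace (Model d) M]
variable {F : Type} [NormedAddCommGroup F] [NormedSpace ℝ F]
variable {n : ℕ} {γ : ℝ≥0} {𝒰 : CoordCover d M}

/-- The derivatives of a function in one chart are bounded by those in another chart. -/
lemma exists_norm_iteratedFDeriv_le_of_charts {φ ψ : OpenPartialHomeomorph M (Model d)}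
    (hφ : φ ∈ IsManifold.maximalAtlas (𝓡 d) ∞ M) (hψ : ψ ∈ IsManifold.maximalAtlas (𝓡 d) ∞ M)
    {x : M} (hxφ : x ∈ φ.source) (hxψ : x ∈ ψ.source) (j : ℕ) :
    ∃ K : ℝ, ∀ (v : M → F), ContMDiff (𝓡 d) 𝓘(ℝ, F) j v → ∀ C : ℝ,
      (∀ k ≤ j, ‖iteratedFDeriv ℝ k (v ∘ φ.symm) (φ x)‖ ≤ C) →
      ‖iteratedFDeriv ℝ j (v ∘ ψ.symm) (ψ x)‖ ≤ K * C := by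
  set V := ψ.target ∩ ψ.symm ⁻¹' φ.source with hVdef
  have hV : IsOpen V := ψ.symm.isOpen_inter_preimage φ.open_source
  have hτ : ContDiffOn ℝ j (φ ∘ ψ.symm) V :=
    (contDiffOn_transition hφ hψ).of_le (by exact_mod_cast le_top)
  have hxV : ψ x ∈ V := ⟨ψ.map_source hxψ, by simpa [hxψ] using hxφ⟩
  have hτx : (φ ∘ ψ.symm) (ψ x) = φ x := by simp [hxψ]
  obtain ⟨D, hD⟩ := ((finite_Iic j).image
    fun i => ‖iteratedFDerivWithin ℝ i (φ ∘ ψ.symm) V (ψ x)‖).bddAbove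
  -- Faà di Bruno bound j! · C · D^j. It asks that the k-th derivative of the inner map be at most
  -- D^k, which a bound by D gives once D ≥ 1.
  refine ⟨j.factorial * (max D 1) ^ j, fun v hv C hC => ?_⟩
  have hvφ : ContDiffOn ℝ j (v ∘ φ.symm) φ.target := fun z hz =>
    (ContMDiffAt.comp z hv.contMDiffAt ((contMDiffAt_symm_of_mem_maximalAtlas hφ hz).of_le
      (by exact_mod_cast le_top))).contDiffAt.contDiffWithinAt
  have hmaps : MapsTo (φ ∘ ψ.symm) V φ.target := fun z hz => φ.map_source hz.2
  have := norm_iteratedFDerivWithin_comp_le hvφ hτ le_rfl φ.open_target.uniqueDiffOn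
    hV.uniqueDiffOn hmaps hxV (C := C) (D := max D 1)
    (fun k hk => by
      rw [iteratedFDerivWithin_of_isOpen k φ.open_target (hmaps hxV), hτx]; exact hC k hk)
    (fun k hk hk' => ((hD ⟨k, hk', rfl⟩).trans (le_max_left _ _)).trans
      (le_self_pow₀ (le_max_right _ _) (by omega)))
  rw [iteratedFDerivWithin_of_isOpen j hV hxV] at this
  have e : iteratedFDeriv ℝ j ((v ∘ φ.symm) ∘ φ ∘ ψ.symm) (ψ x) =
      iteratedFDeriv ℝ j (v ∘ ψ.symm) (ψ x) := by
    refine (Filter.EventuallyEq.iteratedFDeriv (𝕜 := ℝ) ?_ j).self_of_nhds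
    filter_upwards [hV.mem_nhds hxV] with z hz
    simp [φ.left_inv hz.2]
  rw [e] at this
  linarith

lemma CrFun.norm_apply_le (w : CrFun F 𝒰 n γ) (x : M) : ‖w x‖ ≤ ‖w‖ := by
  obtain ⟨i, hi⟩ := 𝒰.exists_mem_interior x
  have := w.norm_iteratedFDeriv_le i (Nat.zero_le n) (mem_image_of_mem _ (interior_subset hi))
  rw [norm_iteratedFDeriv_zero] at this
  simpa [CoordCover.rep, (𝒰.chart i).left_inv (𝒰.core_subset i (interior_subset hi))] using this

lemma CrFun.norm_le_of_crENorm_le {w : CrFun F 𝒰 n γ} {C : ℝ} (hC : 0 ≤ C)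
    (h : crENorm 𝒰 n γ (w : M → F) ≤ ENNReal.ofReal C) : ‖w‖ ≤ C :=
  ENNReal.toReal_le_of_le_ofReal hC h

/-- The pointwise limit is C^n because derivatives converge uniformly inside the cores; the Cauchy
estimates, Hölder part included, then pass to the limit. -/
instance CrFun.completeSpace [CompleteSpace F] : CompleteSpace (CrFun F 𝒰 n γ) := by
  refine Metric.complete_of_cauchySeq_tendsto fun u hu => ?_
  have hl : ∀ x, ∃ l, Tendsto (fun m => u m x) atTop (𝓝 l) := by
    intro x
    refine cauchySeq_tendsto_of_complete (Metric.cauchySeq_iff.2 fun ε hε => ?_)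
    obtain ⟨N, hN⟩ := Metric.cauchySeq_iff.1 hu ε hε
    refine ⟨N, fun m hm l hl => lt_of_le_of_lt ?_ (hN m hm l hl)⟩
    rw [dist_eq_norm, dist_eq_norm]
    exact CrFun.norm_apply_le (u m - u l) x
  choose g hg using hl
  have hsub : ∀ i, ∀ j ≤ n, ∀ y ∈ 𝒰.dom i, ∀ m l, iteratedFDeriv ℝ j (𝒰.rep i (u m)) y -
      iteratedFDeriv ℝ j (𝒰.rep i (u l)) y =
        iteratedFDeriv ℝ j (𝒰.rep i (u m - u l : CrFun F 𝒰 n γ)) y := fun i j hj y hy m l =>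
    (iteratedFDeriv_sub_apply ((contDiffAt_rep 𝒰 (u m).2.1 i hy).of_le (by exact_mod_cast hj))
      ((contDiffAt_rep 𝒰 (u l).2.1 i hy).of_le (by exact_mod_cast hj))).symm
  have hloc : ∀ i, (∀ y ∈ 𝒰.chart i '' interior (𝒰.core i), ContDiffAt ℝ n (𝒰.rep i g) y) ∧
      ∀ j ≤ n, ∀ y ∈ 𝒰.chart i '' interior (𝒰.core i),
        Tendsto (fun m => iteratedFDeriv ℝ j (𝒰.rep i (u m)) y) atTop
          (𝓝 (iteratedFDeriv ℝ j (𝒰.rep i g) y)) := by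
    intro i
    refine contDiffAt_of_uniformCauchySeqOn (𝒰.isOpen_image i)
      (fun m y hy => contDiffAt_rep 𝒰 (u m).2.1 i (𝒰.image_subset i hy)) (fun j hj => ?_)
      fun y hy => hg _
    rw [Metric.uniformCauchySeqOn_iff]
    intro ε hε
    obtain ⟨N, hN⟩ := Metric.cauchySeq_iff.1 hu ε hε
    refine ⟨N, fun m hm l hl y hy => lt_of_le_of_lt ?_ (hN m hm l hl)⟩
    rw [dist_eq_norm, dist_eq_norm, hsub i j hj y (𝒰.image_subset i hy)]
    exact CrFun.norm_iteratedFDeriv_le _ i hj (𝒰.image_subset i hy)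
  have hgs : ContMDiff (𝓡 d) 𝓘(ℝ, F) n g := by
    intro x
    obtain ⟨i, hi⟩ := 𝒰.exists_mem_interior x
    exact contMDiffAt_of_contDiffAt_symm (𝒰.chart_mem i) (𝒰.core_subset i (interior_subset hi))
      ((hloc i).1 _ (mem_image_of_mem _ hi))
  have hsub' : ∀ i, ∀ j ≤ n, ∀ y ∈ 𝒰.dom i, ∀ m, iteratedFDeriv ℝ j (𝒰.rep i (u m)) y -
      iteratedFDeriv ℝ j (𝒰.rep i g) y = iteratedFDeriv ℝ j (𝒰.rep i ((u m : M → F) - g)) y :=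
    fun i j hj y hy m =>
    (iteratedFDeriv_sub_apply ((contDiffAt_rep 𝒰 (u m).2.1 i hy).of_le (by exact_mod_cast hj))
      ((contDiffAt_rep 𝒰 hgs i hy).of_le (by exact_mod_cast hj))).symm
  -- A boundary point of one core is out of reach of `hloc`, but it is interior to another core, and
  -- derivatives in one chart control those in the other.
  have hpt : ∀ i, ∀ j ≤ n, ∀ y ∈ 𝒰.dom i,
      Tendsto (fun m => iteratedFDeriv ℝ j (𝒰.rep i (u m)) y) atTop
          (𝓝 (iteratedFDeriv ℝ j (𝒰.rep i g) y)) := by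
    rintro i j hj _ ⟨x, hx, rfl⟩
    obtain ⟨k, hk⟩ := 𝒰.exists_mem_interior x
    have hkc := interior_subset hk
    obtain ⟨K, hK⟩ := exists_norm_iteratedFDeriv_le_of_charts (F := F) (𝒰.chart_mem k)
      (𝒰.chart_mem i) (𝒰.core_subset k hkc) (𝒰.core_subset i hx) j
    rw [tendsto_iff_norm_sub_tendsto_zero]
    have h0 : Tendsto (fun m => ∑ l ∈ Finset.range (j + 1), ‖iteratedFDeriv ℝ l (𝒰.rep k (u m))
        (𝒰.chart k x) - iteratedFDeriv ℝ l (𝒰.rep k g) (𝒰.chart k x)‖) atTop (𝓝 0) := by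
      rw [← Finset.sum_const_zero (s := Finset.range (j + 1)) (ι := ℕ)]
      refine tendsto_finsetSum _ fun l hl => ?_
      exact tendsto_iff_norm_sub_tendsto_zero.1
        ((hloc k).2 l (by simp at hl; omega) _ (mem_image_of_mem _ hk))
    refine squeeze_zero (fun _ => norm_nonneg _) (fun m => ?_) (by simpa using h0.const_mul K)
    rw [hsub' i j hj _ (mem_image_of_mem _ hx)]
    refine hK ((u m : M → F) - g) (((u m).2.1.sub hgs).of_le (by exact_mod_cast hj)) _ fun l hl => ?_
    have := hsub' k l (hl.trans hj) _ (mem_image_of_mem _ hkc) m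
    change ‖iteratedFDeriv ℝ l (𝒰.rep k ((u m : M → F) - g)) (𝒰.chart k x)‖ ≤ _
    rw [← this]
    exact Finset.single_le_sum (f := fun l => ‖iteratedFDeriv ℝ l (𝒰.rep k (u m))
        (𝒰.chart k x) - iteratedFDeriv ℝ l (𝒰.rep k g) (𝒰.chart k x)‖)
      (fun _ _ => norm_nonneg _) (Finset.mem_range.2 (by omega))
  have key : ∀ ε > 0, ∃ N, ∀ m ≥ N, crENorm 𝒰 n γ ((u m : M → F) - g) ≤ ENNReal.ofReal (2 * ε) := by
    intro ε hε
    obtain ⟨N, hN⟩ := Metric.cauchySeq_iff.1 hu ε hε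
    have hN' : ∀ m ≥ N, ∀ l ≥ N, ‖u m - u l‖ ≤ ε := fun m hm l hl => by
      rw [← dist_eq_norm]; exact (hN m hm l hl).le
    refine ⟨N, fun m hm => crENorm_le_of_forall hε.le (fun i j hj y hy => ?_)
      fun h0 i y hy z hz => ?_⟩
    · rw [← hsub' i j hj y hy]
      refine le_of_tendsto (tendsto_const_nhds.sub (hpt i j hj y hy)).norm ?_
      filter_upwards [eventually_ge_atTop N] with l hl
      rw [hsub i j hj y hy]
      exact (CrFun.norm_iteratedFDeriv_le _ i hj hy).trans (hN' m hm l hl)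
    · rw [← hsub' i n le_rfl y hy, ← hsub' i n le_rfl z hz]
      refine le_of_tendsto ((tendsto_const_nhds.sub (hpt i n le_rfl y hy)).sub
        (tendsto_const_nhds.sub (hpt i n le_rfl z hz))).norm ?_
      filter_upwards [eventually_ge_atTop N] with l hl
      rw [hsub i n le_rfl y hy, hsub i n le_rfl z hz]
      refine (CrFun.norm_iteratedFDeriv_sub_le h0 _ i hy hz).trans ?_
      gcongr
      exact hN' m hm l hl
  -- The limit has finite norm as the difference of `u N` and `u N - g`, both of class C^{n+γ}.
  have hgc : IsCr 𝒰 n γ g := by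
    obtain ⟨N, hN⟩ := key 1 one_pos
    have h1 : IsCr 𝒰 n γ ((u N : M → F) - g) :=
      ⟨(u N).2.1.sub hgs, ne_top_of_le_ne_top ENNReal.ofReal_ne_top (hN N le_rfl)⟩
    have := (crSubmodule F ℝ 𝒰 n γ).sub_mem (show (u N : M → F) ∈ crSubmodule F ℝ 𝒰 n γ from (u N).2) h1
    rwa [sub_sub_cancel] at this
  obtain ⟨G, hG⟩ : ∃ G : CrFun F 𝒰 n γ, (G : M → F) = g := ⟨⟨g, hgc⟩, rfl⟩
  subst hG
  refine ⟨G, Metric.tendsto_atTop.2 fun ε hε => ?_⟩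
  obtain ⟨N, hN⟩ := key (ε / 4) (by positivity)
  refine ⟨N, fun m hm => ?_⟩
  rw [dist_eq_norm]
  refine lt_of_le_of_lt (CrFun.norm_le_of_crENorm_le (w := u m - G) (by positivity) (hN m hm)) ?_
  linarith

end Completeness

/-! ### Derivatives of charts and self-maps as endomorphisms of the model space. -/

section ChartDerivatives

variable {d : ℕ} {M : Type*} [TopologicalSpace M] [ChartedSpace (Model d) M]
  [IsManifold (𝓡 d) ∞ M]

lemma mdifferentiable_of_mem_maximalAtlas {φ : OpenPartialHomeomorph M (Model d)}
    (hφ : φ ∈ IsManifold.maximalAtlas (𝓡 d) ∞ M) : φ.MDifferentiable (𝓡 d) (𝓡 d) :=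
  ⟨fun x hx => ((contMDiffAt_of_mem_maximalAtlas hφ hx).mdifferentiableAt
      (by simp)).mdifferentiableWithinAt,
    fun x hx => ((contMDiffAt_symm_of_mem_maximalAtlas hφ hx).mdifferentiableAt
      (by simp)).mdifferentiableWithinAt⟩

variable (d) in
/-- The derivative of a map between manifolds, as a linear map of the model space. -/
def mder (f : M → M) (y : M) : Model d →L[ℝ] Model d := mfderiv (𝓡 d) (𝓡 d) f y

/-- The derivative of a chart, as a linear map of the model space. -/
def chartDer (φ : OpenPartialHomeomorph M (Model d)) (y : M) : Model d →L[ℝ] Model d :=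
  mfderiv (𝓡 d) (𝓡 d) φ y

/-- The derivative of the inverse of a chart, as a linear map of the model space. -/
def chartSymmDer (φ : OpenPartialHomeomorph M (Model d)) (z : Model d) : Model d →L[ℝ] Model d :=
  mfderiv (𝓡 d) (𝓡 d) φ.symm z

lemma chartSymmDer_comp_chartDer {φ : OpenPartialHomeomorph M (Model d)}
    (hφ : φ ∈ IsManifold.maximalAtlas (𝓡 d) ∞ M) {y : M} (hy : y ∈ φ.source) :
    (chartSymmDer φ (φ y)).comp (chartDer φ y) = ContinuousLinearMap.id ℝ (Model d) :=
  (mdifferentiable_of_mem_maximalAtlas hφ).symm_comp_deriv hy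

lemma chartDer_comp_chartSymmDer {φ : OpenPartialHomeomorph M (Model d)}
    (hφ : φ ∈ IsManifold.maximalAtlas (𝓡 d) ∞ M) {y : M} (hy : y ∈ φ.source) :
    (chartDer φ y).comp (chartSymmDer φ (φ y)) = ContinuousLinearMap.id ℝ (Model d) := by
  have := (mdifferentiable_of_mem_maximalAtlas hφ).comp_symm_deriv (φ.map_source hy)
  rw [φ.left_inv hy] at this
  exact this

/-- The representation of a self-map in a pair of charts. -/
def chartMap (φ ψ : OpenPartialHomeomorph M (Model d)) (f : M → M) (z : Model d) : Model d :=
  φ (f (ψ.symm z))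

lemma hasFDerivAt_chartMap {φ ψ : OpenPartialHomeomorph M (Model d)}
    (hφ : φ ∈ IsManifold.maximalAtlas (𝓡 d) ∞ M) (hψ : ψ ∈ IsManifold.maximalAtlas (𝓡 d) ∞ M)
    {f : M → M} {y : M} (hf : MDifferentiableAt (𝓡 d) (𝓡 d) f y) (hy : y ∈ ψ.source)
    (hfy : f y ∈ φ.source) : HasFDerivAt (chartMap φ ψ f)
      ((chartDer φ (f y)).comp ((mder d f y).comp (chartSymmDer ψ (ψ y)))) (ψ y) := by
  have hsymm : ψ.symm (ψ y) = y := ψ.left_inv hy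
  have h1 : HasMFDerivAt (𝓡 d) (𝓡 d) ψ.symm (ψ y) (chartSymmDer ψ (ψ y)) :=
    (((mdifferentiable_of_mem_maximalAtlas hψ).2 _ (ψ.map_source hy)).mdifferentiableAt
      (ψ.open_target.mem_nhds (ψ.map_source hy))).hasMFDerivAt
  have h2 : HasMFDerivAt (𝓡 d) (𝓡 d) f (ψ.symm (ψ y)) (mder d f y) := by
    rw [hsymm]; exact hf.hasMFDerivAt
  have h3 : HasMFDerivAt (𝓡 d) (𝓡 d) φ (f (ψ.symm (ψ y))) (chartDer φ (f y)) := by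
    rw [hsymm]
    exact (((mdifferentiable_of_mem_maximalAtlas hφ).1 _ hfy).mdifferentiableAt
      (φ.open_source.mem_nhds hfy)).hasMFDerivAt
  exact (h3.comp (ψ y) (h2.comp (ψ y) h1)).hasFDerivAt

lemma mder_eq {φ ψ : OpenPartialHomeomorph M (Model d)}
    (hφ : φ ∈ IsManifold.maximalAtlas (𝓡 d) ∞ M) (hψ : ψ ∈ IsManifold.maximalAtlas (𝓡 d) ∞ M)
    {f : M → M} {y : M} (hf : MDifferentiableAt (𝓡 d) (𝓡 d) f y) (hy : y ∈ ψ.source)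
    (hfy : f y ∈ φ.source) : mder d f y = (chartSymmDer φ (φ (f y))).comp
      ((fderiv ℝ (chartMap φ ψ f) (ψ y)).comp (chartDer ψ y)) := by
  rw [(hasFDerivAt_chartMap hφ hψ hf hy hfy).fderiv]
  ext1 v
  have h1 := congrArg (fun L : Model d →L[ℝ] Model d => L v) (chartSymmDer_comp_chartDer hψ hy)
  have h2 := congrArg (fun L : Model d →L[ℝ] Model d => L (mder d f y v))
    (chartSymmDer_comp_chartDer hφ hfy)
  simp only [ContinuousLinearMap.comp_apply, ContinuousLinearMap.id_apply] at h1 h2 ⊢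
  rw [h1, h2]

lemma det_clm_comp (A B : Model d →L[ℝ] Model d) : (A.comp B).det = A.det * B.det :=
  LinearMap.det_comp _ _

lemma det_chartDer_ne_zero {φ : OpenPartialHomeomorph M (Model d)}
    (hφ : φ ∈ IsManifold.maximalAtlas (𝓡 d) ∞ M) {y : M} (hy : y ∈ φ.source) :
    (chartDer φ y).det ≠ 0 := by
  intro h
  have := congrArg ContinuousLinearMap.det (chartSymmDer_comp_chartDer hφ hy)
  rw [det_clm_comp, h] at this
  simp [ContinuousLinearMap.det] at this

lemma chartSymmDer_injective {φ : OpenPartialHomeomorph M (Model d)}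
    (hφ : φ ∈ IsManifold.maximalAtlas (𝓡 d) ∞ M) {z : Model d} (hz : z ∈ φ.target) :
    Function.Injective (chartSymmDer φ z) := by
  have := chartDer_comp_chartSymmDer hφ (φ.map_target hz)
  rw [φ.right_inv hz] at this
  exact Function.LeftInverse.injective fun v => DFunLike.congr_fun this v

end ChartDerivatives

/-! ### The Riemannian metric in charts: volume densities and Jacobians. -/

section Metric

variable {d : ℕ} {M : Type*} [TopologicalSpace M] [ChartedSpace (Model d) M]
  [IsManifold (𝓡 d) ∞ M] [Bundle.RiemannianBundle (fun x : M => TangentSpace (𝓡 d) x)]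

/-- The Riemannian metric at `x`, as a function on the model space. -/
def tangentInner (x : M) (v w : Model d) : ℝ :=
  inner ℝ (show TangentSpace (𝓡 d) x from v) (show TangentSpace (𝓡 d) x from w)

/-- The Riemannian norm at `x`, as a function on the model space. -/
def tangentNorm (x : M) (v : Model d) : ℝ := ‖(show TangentSpace (𝓡 d) x from v)‖

lemma tangentInner_add_left (x : M) (u v w : Model d) :
    tangentInner x (u + v) w = tangentInner x u w + tangentInner x v w :=
  inner_add_left (𝕜 := ℝ) (E := TangentSpace (𝓡 d) x) u v w

lemma tangentInner_smul_left (x : M) (c : ℝ) (v w : Model d) :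
    tangentInner x (c • v) w = c * tangentInner x v w :=
  real_inner_smul_left (F := TangentSpace (𝓡 d) x) v w c

lemma tangentInner_comm (x : M) (v w : Model d) : tangentInner x v w = tangentInner x w v :=
  real_inner_comm (F := TangentSpace (𝓡 d) x) w v

/-- The Riemannian metric at `x` as a bilinear map. -/
def tangentBilin (x : M) : Model d →ₗ[ℝ] Model d →ₗ[ℝ] ℝ :=
  LinearMap.mk₂ ℝ (tangentInner x) (tangentInner_add_left x) (tangentInner_smul_left x)
    (fun u v w => by
      rw [tangentInner_comm, tangentInner_add_left, tangentInner_comm x v, tangentInner_comm x w])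
    (fun c v w => by
      rw [tangentInner_comm, tangentInner_smul_left, tangentInner_comm x w, smul_eq_mul])

lemma tangentNorm_eq_sqrt (x : M) (v : Model d) : tangentNorm x v = √(tangentInner x v v) :=
  norm_eq_sqrt_real_inner (F := TangentSpace (𝓡 d) x) v

lemma tangentNorm_smul (x : M) (c : ℝ) (v : Model d) :
    tangentNorm x (c • v) = |c| * tangentNorm x v :=
  norm_smul (β := TangentSpace (𝓡 d) x) c v

lemma tangentNorm_pos (x : M) {v : Model d} (hv : v ≠ 0) : 0 < tangentNorm x v :=
  norm_pos_iff (E := TangentSpace (𝓡 d) x) |>.2 hv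

lemma tangentNorm_nonneg (x : M) (v : Model d) : 0 ≤ tangentNorm x v :=
  norm_nonneg (E := TangentSpace (𝓡 d) x) v

lemma tangentNorm_zero (x : M) : tangentNorm x (0 : Model d) = 0 :=
  norm_zero (E := TangentSpace (𝓡 d) x)

/-- The `a`-th vector of the standard basis of the model space. -/
abbrev stdVec (a : Fin d) : Model d := EuclideanSpace.single a (1 : ℝ)

lemma model_eq_sum (v : Model d) : v = ∑ a, v a • stdVec a := by
  have := (EuclideanSpace.basisFun (Fin d) ℝ).sum_repr v
  simpa using this.symm

/-- The Gram matrix at `x` of the image of the standard basis under `T`. -/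
def gramMat (x : M) (T : Model d →L[ℝ] Model d) : Matrix (Fin d) (Fin d) ℝ :=
  Matrix.of fun a b => tangentInner x (T (stdVec a)) (T (stdVec b))

/-- The Riemannian volume of the image of the unit cube under `T`. -/
def linVol (x : M) (T : Model d →L[ℝ] Model d) : ℝ := √(gramMat x T).det

/-- If A is the matrix of S and G the Gram matrix of T, then T ∘ S has Gram matrix AᵀGA; the square
root of its determinant picks up |det A|. -/
lemma linVol_comp (x : M) (T S : Model d →L[ℝ] Model d) :
    linVol x (T.comp S) = |S.det| * linVol x T := by
  set A := LinearMap.toMatrix (EuclideanSpace.basisFun (Fin d) ℝ).toBasis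
    (EuclideanSpace.basisFun (Fin d) ℝ).toBasis (S : Model d →ₗ[ℝ] Model d) with hA
  have hAe : ∀ a, S (stdVec a) = ∑ c, A c a • stdVec c := by
    intro a
    rw [model_eq_sum (S (stdVec a))]
    refine Finset.sum_congr rfl fun c _ => ?_
    rw [hA, LinearMap.toMatrix_apply]
    simp
  have hdet : S.det = A.det := by rw [hA, LinearMap.det_toMatrix]
  have hg : gramMat x (T.comp S) = A.transpose * gramMat x T * A := by
    ext a b
    have : gramMat x (T.comp S) a b = tangentBilin x (T (S (stdVec a))) (T (S (stdVec b))) := rfl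
    rw [this, hAe, hAe]
    simp only [map_sum, map_smul, LinearMap.sum_apply, LinearMap.smul_apply, smul_eq_mul,
      Matrix.mul_apply, Matrix.transpose_apply, Finset.sum_mul, Finset.mul_sum]
    refine Finset.sum_congr rfl fun c _ => Finset.sum_congr rfl fun c' _ => ?_
    change A c b * (A c' a * gramMat x T c' c) = _
    ring
  rw [linVol, linVol, hg, Matrix.det_mul, Matrix.det_mul, Matrix.det_transpose, hdet,
    show A.det * (gramMat x T).det * A.det = A.det ^ 2 * (gramMat x T).det by ring,
    Real.sqrt_mul (sq_nonneg _), Real.sqrt_sq_eq_abs]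

lemma linVol_pos (x : M) {T : Model d →L[ℝ] Model d} (hT : Function.Injective T) :
    0 < linVol x T := by
  have hli : LinearIndependent ℝ fun a => T (stdVec a : Model d) := by
    have h := (EuclideanSpace.basisFun (Fin d) ℝ).toBasis.linearIndependent.map'
      (T : Model d →ₗ[ℝ] Model d) (LinearMap.ker_eq_bot.2 hT)
    have e : (⇑(T : Model d →ₗ[ℝ] Model d) ∘ (EuclideanSpace.basisFun (Fin d) ℝ).toBasis) =
      fun a => T (stdVec a : Model d) := by funext a; simp
    rwa [e] at h
  exact Real.sqrt_pos.2 (Matrix.posDef_gram_of_linearIndependent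
    (E := TangentSpace (𝓡 d) x) (𝕜 := ℝ) hli).det_pos

lemma volDensity_eq_linVol (φ : OpenPartialHomeomorph M (Model d)) (z : Model d) :
    volDensity φ z = linVol (φ.symm z) (chartSymmDer φ z) := rfl

lemma volDensity_pos {φ : OpenPartialHomeomorph M (Model d)}
    (hφ : φ ∈ IsManifold.maximalAtlas (𝓡 d) ∞ M) {z : Model d} (hz : z ∈ φ.target) :
    0 < volDensity φ z := linVol_pos _ (chartSymmDer_injective hφ hz)

lemma absDet_eq_linVol (f : M → M) (y : M) :
    absDet d f y = linVol (f y) (mder d f y) / linVol y (ContinuousLinearMap.id ℝ (Model d)) := rfl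

/-- The Jacobian of a self-map, computed in charts. -/
lemma absDet_eq {φ ψ : OpenPartialHomeomorph M (Model d)}
    (hφ : φ ∈ IsManifold.maximalAtlas (𝓡 d) ∞ M) (hψ : ψ ∈ IsManifold.maximalAtlas (𝓡 d) ∞ M)
    {f : M → M} {y : M} (hf : MDifferentiableAt (𝓡 d) (𝓡 d) f y) (hy : y ∈ ψ.source)
    (hfy : f y ∈ φ.source) : absDet d f y =
      volDensity φ (φ (f y)) * |(fderiv ℝ (chartMap φ ψ f) (ψ y)).det| / volDensity ψ (ψ y) := by
  -- Numerator and denominator of the Jacobian both carry the factor |det| of the derivative of ψ at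
  -- `y`, which cancels.
  have h1 : linVol y (ContinuousLinearMap.id ℝ (Model d)) =
      |(chartDer ψ y).det| * volDensity ψ (ψ y) := by
    rw [volDensity_eq_linVol, ψ.left_inv hy, ← linVol_comp, chartSymmDer_comp_chartDer hψ hy]
  have h2 : linVol (f y) (mder d f y) = |(chartDer ψ y).det| *
      (|(fderiv ℝ (chartMap φ ψ f) (ψ y)).det| * volDensity φ (φ (f y))) := by
    rw [volDensity_eq_linVol, φ.left_inv hfy, ← linVol_comp, ← linVol_comp, mder_eq hφ hψ hf hy hfy,
      ContinuousLinearMap.comp_assoc]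
  rw [absDet_eq_linVol, h1, h2, mul_div_mul_left _ _ (abs_ne_zero.2 (det_chartDer_ne_zero hψ hy)),
    mul_comm (volDensity φ _)]

variable [IsContMDiffRiemannianBundle (𝓡 d) ∞ (Model d) (fun x : M => TangentSpace (𝓡 d) x)]

/-- The coordinate fields of a chart are smooth sections of the tangent bundle, being the tangent
map of the inverse chart applied to constant fields; a smooth metric pairs them smoothly. -/
lemma contDiffOn_tangentInner {φ : OpenPartialHomeomorph M (Model d)}
    (hφ : φ ∈ IsManifold.maximalAtlas (𝓡 d) ∞ M) (v w : Model d) :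
    ContDiffOn ℝ ∞ (fun z => tangentInner (φ.symm z) (chartSymmDer φ z v) (chartSymmDer φ z w))
      φ.target := by
  have hs : ContMDiffOn (𝓡 d) (𝓡 d) ∞ φ.symm φ.target := fun z hz =>
    (contMDiffAt_symm_of_mem_maximalAtlas hφ hz).contMDiffWithinAt
  have ht := hs.contMDiffOn_tangentMapWithin (m := ∞) (by simp) φ.open_target.uniqueMDiffOn
  have hsec : ∀ v : Model d, ContMDiffOn (𝓡 d) ((𝓡 d).prod 𝓘(ℝ, Model d)) ∞
      (fun z => (⟨φ.symm z, chartSymmDer φ z v⟩ : TangentBundle (𝓡 d) M)) φ.target := by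
    intro v
    have hc : ContMDiff (𝓡 d) ((𝓡 d).prod 𝓘(ℝ, Model d)) ∞
        (fun z : Model d => (⟨z, v⟩ : TangentBundle (𝓡 d) (Model d))) := by
      intro z
      exact contMDiffAt_vectorSpace_iff_contDiffAt.2 contDiffAt_const
    refine (ht.comp hc.contMDiffOn fun z hz => hz).congr fun z hz => ?_
    simp only [Function.comp, tangentMapWithin]
    rw [mfderivWithin_of_isOpen φ.open_target hz]
    rfl
  have := ContMDiffOn.inner_bundle (IB := 𝓡 d) (F := Model d)
    (E := fun x : M => TangentSpace (𝓡 d) x) (hsec v) (hsec w)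
  exact this.contDiffOn

lemma contDiffOn_volDensity {φ : OpenPartialHomeomorph M (Model d)}
    (hφ : φ ∈ IsManifold.maximalAtlas (𝓡 d) ∞ M) : ContDiffOn ℝ ∞ (volDensity φ) φ.target := by
  have h1 : ContDiffOn ℝ ∞ (fun z => (gramMat (φ.symm z) (chartSymmDer φ z)).det) φ.target := by
    simp only [Matrix.det_apply]
    refine ContDiffOn.sum fun σ _ => ContDiffOn.const_smul _ ?_
    exact contDiffOn_prod fun a _ => contDiffOn_tangentInner hφ _ _
  refine h1.sqrt fun z hz => ?_
  exact (Real.sqrt_pos.1 (volDensity_pos hφ hz)).ne'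

end Metric

/-! ### Families of self-maps, measured through the Euclidean embedding. -/

section SelfFamilies

variable {S : Type*} [TopologicalSpace S] {S' : Type*} [TopologicalSpace S']
variable {d : ℕ} {M : Type*} [TopologicalSpace M] [ChartedSpace (Model d) M]
  [IsManifold (𝓡 d) ∞ M]
variable {N : ℕ} {n : ℕ} {γ : ℝ≥0}

/-- Every chart is locally the restriction of a map on the ambient Euclidean space. -/
lemma EuclideanEmbedding.exists_chart_eq (e : EuclideanEmbedding d M N)
    {φ : OpenPartialHomeomorph M (Model d)} (hφ : φ ∈ IsManifold.maximalAtlas (𝓡 d) ∞ M)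
    {x₀ : M} (hx₀ : x₀ ∈ φ.source) (k : ℕ) :
    ∃ (κ : EuclideanSpace ℝ (Fin N) → Model d) (V : Set (EuclideanSpace ℝ (Fin N))) (O : Set M),
      IsOpen V ∧ ContDiffOn ℝ k κ V ∧ IsOpen O ∧ x₀ ∈ O ∧ O ⊆ φ.source ∧
      ∀ x ∈ O, e.toFun x ∈ V ∧ κ (e.toFun x) = φ x := by
  have hsymm : φ.symm (φ x₀) = x₀ := φ.left_inv hx₀
  have ht := φ.map_source hx₀
  have hE : ContDiffAt ℝ ∞ (fun z => e.toFun (φ.symm z)) (φ x₀) :=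
    (ContMDiffAt.comp (φ x₀) (g := e.toFun) e.contMDiff.contMDiffAt
      (contMDiffAt_symm_of_mem_maximalAtlas hφ ht)).contDiffAt
  obtain ⟨A, hA, hAinj⟩ : ∃ A : Model d →L[ℝ] EuclideanSpace ℝ (Fin N),
      HasFDerivAt (fun z => e.toFun (φ.symm z)) A (φ x₀) ∧ Function.Injective A := by
    have h1 : HasMFDerivAt (𝓡 d) (𝓡 d) φ.symm (φ x₀) (chartSymmDer φ (φ x₀)) :=
      (((mdifferentiable_of_mem_maximalAtlas hφ).2 _ ht).mdifferentiableAt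
        (φ.open_target.mem_nhds ht)).hasMFDerivAt
    have h2 : HasMFDerivAt (𝓡 d) (𝓡 N) e.toFun (φ.symm (φ x₀))
        (mfderiv (𝓡 d) (𝓡 N) e.toFun (φ.symm (φ x₀))) :=
      (e.contMDiff.contMDiffAt.mdifferentiableAt (by simp)).hasMFDerivAt
    refine ⟨_, (h2.comp (φ x₀) h1).hasFDerivAt, ?_⟩
    exact (e.injective_mfderiv (φ.symm (φ x₀))).comp (chartSymmDer_injective hφ ht)
  -- With B a left inverse of the derivative of e ∘ φ⁻¹, the map B ∘ e ∘ φ⁻¹ has derivative the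
  -- identity and a local inverse κ₀. Then κ₀ ∘ B recovers φ from the embedded point.
  obtain ⟨B, hB⟩ := LinearMap.exists_leftInverse_of_injective
    (A : Model d →ₗ[ℝ] EuclideanSpace ℝ (Fin N)) (LinearMap.ker_eq_bot.2 hAinj)
  set B' : EuclideanSpace ℝ (Fin N) →L[ℝ] Model d := LinearMap.toContinuousLinearMap B
  set g : Model d → Model d := fun z => B' (e.toFun (φ.symm z)) with hg
  have hgs : ContDiffAt ℝ ∞ g (φ x₀) := B'.contDiff.contDiffAt.comp _ hE
  have hgd : HasFDerivAt g ((ContinuousLinearEquiv.refl ℝ (Model d) : Model d →L[ℝ] Model d))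
      (φ x₀) := by
    have h := B'.hasFDerivAt.comp (φ x₀) hA
    have heq : (ContinuousLinearEquiv.refl ℝ (Model d) : Model d →L[ℝ] Model d) = B'.comp A := by
      ext1 v
      exact (LinearMap.congr_fun hB v).symm
    rw [heq]
    exact h
  have hinf : (∞ : ℕ∞ω) ≠ 0 := by simp
  set κ₀ := hgs.localInverse hgd hinf
  have hκ₀ : ContDiffAt ℝ ∞ κ₀ (g (φ x₀)) := hgs.to_localInverse hgd hinf
  have hleft : ∀ᶠ z in 𝓝 (φ x₀), κ₀ (g z) = z :=
    (hgs.hasStrictFDerivAt' hgd hinf).eventually_left_inverse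
  have hκ : ContDiffAt ℝ k (fun y => κ₀ (B' y)) (e.toFun x₀) := by
    have : ContDiffAt ℝ k κ₀ (B' (e.toFun x₀)) := by
      have h := hκ₀.of_le (m := k) (by exact_mod_cast le_top)
      simpa only [hg, hsymm] using h
    exact this.comp _ B'.contDiff.contDiffAt
  -- A finite order `k` at a point persists on a neighbourhood; for order `∞` the neighbourhood
  -- could shrink with the order.
  set V := interior {y | ContDiffAt ℝ k (fun y => κ₀ (B' y)) y}
  have hV : V ∈ 𝓝 (e.toFun x₀) :=
    interior_mem_nhds.2 (hκ.eventually (by simp))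
  have hO : {x | x ∈ φ.source ∧ e.toFun x ∈ V ∧ κ₀ (B' (e.toFun x)) = φ x} ∈ 𝓝 x₀ := by
    filter_upwards [φ.open_source.mem_nhds hx₀,
      (φ.continuousAt hx₀).eventually hleft,
      e.contMDiff.continuous.continuousAt.eventually hV] with x h1 h2 h3
    refine ⟨h1, h3, ?_⟩
    simpa only [hg, φ.left_inv h1] using h2
  refine ⟨fun y => κ₀ (B' y), V, interior _, isOpen_interior, fun y hy => ?_, isOpen_interior,
    mem_interior_iff_mem_nhds.2 hO, fun x hx => (interior_subset hx).1,
    fun x hx => (interior_subset hx).2⟩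
  have hy' : y ∈ {y | ContDiffAt ℝ k (fun y => κ₀ (B' y)) y} := interior_subset hy
  exact ContDiffAt.contDiffWithinAt hy'

/-- The family of self-maps `u s : M → M` is of class `C^{n+γ}` near `(s₀, x₀)`. -/
def SelfFam (e : EuclideanEmbedding d M N) (γ : ℝ≥0) (n : ℕ) (u : S → M → M) (s₀ : S) (x₀ : M) :
    Prop :=
  MFam d γ n (fun s x => e.toFun (u s x)) s₀ x₀

variable {e : EuclideanEmbedding d M N}

lemma SelfFam.continuousAt [CompactSpace M] {u : S → M → M} {s₀ : S} {x₀ : M}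
    (h : SelfFam e γ n u s₀ x₀) : ContinuousAt (fun z : S × M => u z.1 z.2) (s₀, x₀) := by
  have : Topology.IsClosedEmbedding e.toFun :=
    e.contMDiff.continuous.isClosedEmbedding e.injective
  exact this.isInducing.continuousAt_iff.2 (MFam.continuousAt h)

lemma continuousAt_symm_param {φ : OpenPartialHomeomorph M (Model d)} {x₀ : M}
    (hx : x₀ ∈ φ.source) (s₀ : S) :
    ContinuousAt (fun q : S × Model d => (q.1, φ.symm q.2)) (s₀, φ x₀) :=
  continuousAt_fst.prodMk (ContinuousAt.comp (f := Prod.snd) (x := (s₀, φ x₀))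
    (φ.continuousAt_symm (φ.map_source hx)) continuousAt_snd)

lemma tendsto_symm_param {φ : OpenPartialHomeomorph M (Model d)} {x₀ : M}
    (hx : x₀ ∈ φ.source) (s₀ : S) :
    Tendsto (fun q : S × Model d => (q.1, φ.symm q.2)) (𝓝 (s₀, φ x₀)) (𝓝 (s₀, x₀)) := by
  have := (continuousAt_symm_param hx s₀).tendsto
  simpa only [φ.left_inv hx] using this

/-- The representation of a family of self-maps in charts is a family of the same class. -/
lemma SelfFam.famCr_chartMap [CompactSpace M] (hγ : γ ≤ 1) {u : S → M → M} {s₀ : S} {x₀ : M}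
    (h : SelfFam e γ n u s₀ x₀) {φ ψ : OpenPartialHomeomorph M (Model d)}
    (hφ : φ ∈ IsManifold.maximalAtlas (𝓡 d) ∞ M) (hψ : ψ ∈ IsManifold.maximalAtlas (𝓡 d) ∞ M)
    (hxφ : u s₀ x₀ ∈ φ.source) (hxψ : x₀ ∈ ψ.source) :
    ∃ W : Set (S × Model d), IsOpen W ∧ (s₀, ψ x₀) ∈ W ∧
      (∀ q ∈ W, q.2 ∈ ψ.target ∧ u q.1 (ψ.symm q.2) ∈ φ.source) ∧
      FamCr γ n (fun q : S × Model d => chartMap φ ψ (u q.1) q.2) W := by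
  -- Locally the chart representation is κ applied to the embedded family; the extra order is the
  -- one consumed by `FamCr.contDiffOn_comp`.
  obtain ⟨κ, V, O, hV, hκ, hO, hxO, hOφ, hκe⟩ := e.exists_chart_eq hφ hxφ (n + 1)
  obtain ⟨W, hW, hm, hWt, hf⟩ := MFam.famCr hγ h hψ hxψ
  have h1 : ∀ᶠ q in 𝓝 (s₀, ψ x₀), u q.1 (ψ.symm q.2) ∈ O :=
    (tendsto_symm_param hxψ s₀).eventually (h.continuousAt.eventually (hO.mem_nhds hxO))
  set W' := W ∩ interior {q | u q.1 (ψ.symm q.2) ∈ O}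
  have hW' : IsOpen W' := hW.inter isOpen_interior
  have hWO : ∀ q ∈ W', u q.1 (ψ.symm q.2) ∈ O := fun q hq =>
    interior_subset (s := {q : S × Model d | u q.1 (ψ.symm q.2) ∈ O}) hq.2
  refine ⟨W', hW', ⟨hm, mem_interior_iff_mem_nhds.2 h1⟩,
    fun q hq => ⟨hWt q hq.1, hOφ (hWO q hq)⟩, ?_⟩
  exact ((hf.mono inter_subset_left).contDiffOn_comp hγ hW' hV hκ
    fun q hq => (hκe _ (hWO q hq)).1).congr hW' fun q hq => (hκe _ (hWO q hq)).2

/-- Composition of families on a manifold. -/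
lemma MFam.comp_self [CompactSpace M] (hγ : γ ≤ 1) {F : Type} [NormedAddCommGroup F]
    [NormedSpace ℝ F] {m : ℕ} (hnm : n ≤ m) (hm : 1 ≤ m) {v : S → M → F} {u : S → M → M} {s₀ : S}
    {x₀ : M} (hv : MFam d γ n v s₀ (u s₀ x₀)) (hu : SelfFam e γ m u s₀ x₀) :
    MFam d γ n (fun s x => v s (u s x)) s₀ x₀ := by
  have hψ := IsManifold.chart_mem_maximalAtlas (I := 𝓡 d) (n := ∞) x₀
  obtain ⟨φ, hφ, hxφ, V, hV, hmV, hf⟩ := hv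
  obtain ⟨W, hW, hmW, hWt, hg⟩ :=
    hu.famCr_chartMap hγ hφ hψ hxφ (mem_chart_source (Model d) x₀)
  have hc : ContinuousOn (fun q : S × Model d =>
      (q.1, chartMap φ (chartAt (Model d) x₀) (u q.1) q.2)) W :=
    continuousOn_fst.prodMk hg.continuousOn
  -- Order at least 1 of the inner family is what makes it Lipschitz.
  have hL := (hg.of_le hγ hW hm).locHolder_of_succ le_rfl hW
  refine ⟨_, hψ, mem_chart_source (Model d) x₀, _, hc.isOpen_inter_preimage hW hV,
    ⟨hmW, ?_⟩, ?_⟩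
  · simpa [chartMap] using hmV
  · refine (hf.comp hγ (hc.isOpen_inter_preimage hW hV)
      ((hg.of_le hγ hW hnm).mono inter_subset_left) (hL.mono inter_subset_left)
      fun q hq => hq.2).congr (hc.isOpen_inter_preimage hW hV) fun q hq => ?_
    simp only [chartMap]
    rw [φ.left_inv (hWt q hq.1).2]

lemma SelfFam.comp [CompactSpace M] (hγ : γ ≤ 1) (hn : 1 ≤ n) {v u : S → M → M} {s₀ : S}
    {x₀ : M} (hv : SelfFam e γ n v s₀ (u s₀ x₀)) (hu : SelfFam e γ n u s₀ x₀) :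
    SelfFam e γ n (fun s x => v s (u s x)) s₀ x₀ :=
  MFam.comp_self (v := fun s x => e.toFun (v s x)) hγ le_rfl hn hv hu

variable {𝒰 : CoordCover d M}

lemma CrSelf.continuous_emb : Continuous (CrSelf.emb (𝒰 := 𝒰) (e := e) (n := n) (γ := γ)) :=
  continuous_induced_dom

lemma selfFam_eval (g : CrSelf 𝒰 e n γ) (x : M) :
    SelfFam e γ n (fun (g : CrSelf 𝒰 e n γ) x => g x) g x :=
  MFam.reparam (u := fun (w : CrFun (EuclideanSpace ℝ (Fin N)) 𝒰 n γ) x => w x)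
    CrSelf.continuous_emb (mfam_eval 𝒰 g.emb x)

lemma CrSelf.mdifferentiable (g : CrSelf 𝒰 e (n + 1) γ) : MDifferentiable (𝓡 d) (𝓡 d) g :=
  g.2.1.mdifferentiable (by simp)

end SelfFamilies

/-! ### Regularity of the quotient by the Jacobian. -/

section Jacobian

variable {d : ℕ}

lemma contDiff_det : ContDiff ℝ ∞ fun A : Model d →L[ℝ] Model d => A.det := by
  have h : (fun A : Model d →L[ℝ] Model d => A.det) = fun A =>
      (Matrix.of fun a b : Fin d => A (stdVec b) a).det := by
    funext A
    have : A.det = (LinearMap.toMatrix (EuclideanSpace.basisFun (Fin d) ℝ).toBasis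
      (EuclideanSpace.basisFun (Fin d) ℝ).toBasis (A : Model d →ₗ[ℝ] Model d)).det := by
      rw [LinearMap.det_toMatrix]
    rw [this]
    congr 1
  rw [h]
  simp only [Matrix.det_apply]
  refine ContDiff.sum fun σ _ => ContDiff.const_smul _ ?_
  refine contDiff_prod fun a _ => ?_
  have : ContDiff ℝ ∞ fun A : Model d →L[ℝ] Model d =>
      (EuclideanSpace.proj (σ a) : Model d →L[ℝ] ℝ) (A (stdVec a)) := by fun_prop
  exact this

variable {S : Type*} [TopologicalSpace S]
variable {M : Type*} [TopologicalSpace M] [ChartedSpace (Model d) M]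
  [IsManifold (𝓡 d) ∞ M]
variable {N : ℕ} {p : ℕ} {γ : ℝ≥0} {e : EuclideanEmbedding d M N}

lemma FamCr.fderiv {E F : Type} [NormedAddCommGroup E] [NormedSpace ℝ E] [NormedAddCommGroup F]
    [NormedSpace ℝ F] {n : ℕ} {W : Set (S × E)} (hW : IsOpen W) {u : S × E → F}
    (h : FamCr γ (n + 1) u W) :
    (∀ q ∈ W, HasFDerivAt (fun x => u (q.1, x)) (fderiv ℝ (fun x => u (q.1, x)) q.2) q.2) ∧
      FamCr γ n (fun q : S × E => fderiv ℝ (fun x => u (q.1, x)) q.2) W := by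
  obtain ⟨-, u', hd, h'⟩ := h
  exact ⟨fun q hq => (hd q hq).differentiableAt.hasFDerivAt,
    h'.congr hW fun q hq => (hd q hq).fderiv.symm⟩

/-- A point at which a self-map is immersive, seen in charts. -/
lemma det_fderiv_chartMap_ne_zero {φ ψ : OpenPartialHomeomorph M (Model d)}
    (hφ : φ ∈ IsManifold.maximalAtlas (𝓡 d) ∞ M) (hψ : ψ ∈ IsManifold.maximalAtlas (𝓡 d) ∞ M)
    {f : M → M} {y : M} (hf : MDifferentiableAt (𝓡 d) (𝓡 d) f y) (hy : y ∈ ψ.source)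
    (hfy : f y ∈ φ.source) (hinj : Function.Injective (mder d f y)) :
    (fderiv ℝ (chartMap φ ψ f) (ψ y)).det ≠ 0 := by
  intro h
  have h1 := congrArg ContinuousLinearMap.det (mder_eq hφ hψ hf hy hfy)
  rw [det_clm_comp, det_clm_comp, h, zero_mul, mul_zero] at h1
  have h2 : IsUnit (mder d f y : Model d →ₗ[ℝ] Model d) :=
    (LinearMap.isUnit_iff_ker_eq_bot _).2 (LinearMap.ker_eq_bot.2 hinj)
  have h3 := (LinearMap.isUnit_iff_isUnit_det _).1 h2
  exact h3.ne_zero h1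

variable [Bundle.RiemannianBundle (fun x : M => TangentSpace (𝓡 d) x)]
variable [IsContMDiffRiemannianBundle (𝓡 d) ∞ (Model d) (fun x : M => TangentSpace (𝓡 d) x)]

/-- The quotient of a family of functions by the Jacobians of a family of self-maps. -/
lemma MFam.div_absDet [CompactSpace M] (hγ : γ ≤ 1) {u : S → M → M} {w : S → M → ℂ} {s₀ : S}
    {y₀ : M} (hu : SelfFam e γ (p + 1) u s₀ y₀) (hw : MFam d γ p w s₀ y₀)
    (hd : ∀ s, MDifferentiable (𝓡 d) (𝓡 d) (u s)) (hinj : Function.Injective (mder d (u s₀) y₀)) :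
    MFam d γ p (fun s y => w s y / (absDet d (u s) y : ℂ)) s₀ y₀ := by
  set ψ := chartAt (Model d) y₀ with hψdef
  set φ := chartAt (Model d) (u s₀ y₀) with hφdef
  have hψ : ψ ∈ IsManifold.maximalAtlas (𝓡 d) ∞ M := IsManifold.chart_mem_maximalAtlas y₀
  have hφ : φ ∈ IsManifold.maximalAtlas (𝓡 d) ∞ M := IsManifold.chart_mem_maximalAtlas _
  have hyψ : y₀ ∈ ψ.source := mem_chart_source _ _
  have hyφ : u s₀ y₀ ∈ φ.source := mem_chart_source _ _
  obtain ⟨W₁, hW₁, hm₁, ht₁, hG⟩ := hu.famCr_chartMap hγ hφ hψ hyφ hyψ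
  obtain ⟨W₂, hW₂, hm₂, -, hw₂⟩ := hw.famCr hγ hψ hyψ
  obtain ⟨-, hG'⟩ := hG.fderiv hW₁
  set D : S × Model d → Model d →L[ℝ] Model d :=
    fun q => _root_.fderiv ℝ (chartMap φ ψ (u q.1)) q.2 with hD
  have hDc : ContinuousOn (fun q => (D q).det) W₁ :=
    contDiff_det.continuous.comp_continuousOn hG'.continuousOn
  set W := (W₁ ∩ (fun q => (D q).det) ⁻¹' {0}ᶜ) ∩ W₂ with hWdef
  have hW : IsOpen W := (hDc.isOpen_inter_preimage hW₁ isOpen_compl_singleton).inter hW₂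
  have hWW₁ : W ⊆ W₁ := fun q hq => hq.1.1
  -- In charts the quotient is one fixed smooth function of the value, the point, the image point
  -- and the derivative. On `V` the determinant does not vanish, so its absolute value is smooth.
  set V : Set (ℂ × Model d × Model d × (Model d →L[ℝ] Model d)) :=
    {t | t.2.1 ∈ ψ.target ∧ t.2.2.1 ∈ φ.target ∧ t.2.2.2.det ≠ 0} with hVdef
  have hV : IsOpen V := by
    refine (ψ.open_target.preimage (by fun_prop)).inter ((φ.open_target.preimage (by fun_prop)).inter
      (isOpen_compl_singleton.preimage (contDiff_det.continuous.comp (by fun_prop))))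
  have hΦ : ContDiffOn ℝ ∞ (fun t : ℂ × Model d × Model d × (Model d →L[ℝ] Model d) =>
      (volDensity ψ t.2.1 / (volDensity φ t.2.2.1 * |t.2.2.2.det|)) • t.1) V := by
    have a : ContDiffOn ℝ ∞ (fun t : ℂ × Model d × Model d × (Model d →L[ℝ] Model d) =>
        volDensity ψ t.2.1) V :=
      (contDiffOn_volDensity hψ).comp (by fun_prop) fun t ht => ht.1
    have b : ContDiffOn ℝ ∞ (fun t : ℂ × Model d × Model d × (Model d →L[ℝ] Model d) =>
        volDensity φ t.2.2.1) V :=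
      (contDiffOn_volDensity hφ).comp (by fun_prop) fun t ht => ht.2.1
    have c : ContDiffOn ℝ ∞ (fun t : ℂ × Model d × Model d × (Model d →L[ℝ] Model d) =>
        |t.2.2.2.det|) V := by
      intro t ht
      have h1 : ContDiffAt ℝ ∞ (fun t : ℂ × Model d × Model d × (Model d →L[ℝ] Model d) =>
        t.2.2.2.det) t := (contDiff_det.comp (by fun_prop)).contDiffAt
      exact ((contDiffAt_abs ht.2.2).comp t h1).contDiffWithinAt
    refine (a.div (b.mul c) fun t ht => ?_).smul (by fun_prop)
    exact mul_ne_zero (volDensity_pos hφ ht.2.1).ne' (abs_ne_zero.2 ht.2.2)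
  have htup : FamCr γ p (fun q : S × Model d =>
      (w q.1 (ψ.symm q.2), q.2, chartMap φ ψ (u q.1) q.2, D q)) W :=
    (hw₂.mono fun q hq => hq.2).prodMk ((FamCr.snd hγ).prodMk
      (((hG.of_succ hγ hW₁).mono hWW₁).prodMk (hG'.mono hWW₁)))
  refine ⟨ψ, hψ, hyψ, W, hW, ⟨⟨hm₁, ?_⟩, hm₂⟩, ?_⟩
  · exact det_fderiv_chartMap_ne_zero hφ hψ (hd s₀ y₀) hyψ hyφ hinj
  · refine (htup.smooth_comp hγ hW hV hΦ fun q hq => ⟨(ht₁ q (hWW₁ hq)).1,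
      φ.map_source (ht₁ q (hWW₁ hq)).2, hq.1.2⟩).congr hW fun q hq => ?_
    have hq1 := ht₁ q (hWW₁ hq)
    have hsrc := ψ.map_target hq1.1
    have := absDet_eq hφ hψ (hd q.1 (ψ.symm q.2)) hsrc hq1.2
    rw [ψ.right_inv hq1.1] at this
    simp only [this, hD, chartMap]
    rw [div_eq_mul_inv (w q.1 (ψ.symm q.2)), mul_comm (w q.1 (ψ.symm q.2)), Complex.real_smul,
      ← Complex.ofReal_inv, inv_div]

end Jacobian

/-! ### An inverse function theorem with parameters. -/

section ParametricInverse

variable {S : Type*} [TopologicalSpace S]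
variable {E : Type} [NormedAddCommGroup E] [NormedSpace ℝ E] [CompleteSpace E]
variable {n : ℕ} {γ : ℝ≥0}

/-- The inverse function theorem, locally uniformly with respect to a parameter. -/
lemma FamCr.exists_inverse (hγ : γ ≤ 1) {W : Set (S × E)} (hW : IsOpen W) {g : S × E → E}
    (hg : FamCr γ (n + 1) g W) {s₀ : S} {z₀ : E} (h₀ : (s₀, z₀) ∈ W)
    (hinv : (_root_.fderiv ℝ (fun x => g (s₀, x)) z₀).IsInvertible) {T : Set E} (hT : T ∈ 𝓝 z₀) :
    ∃ Y : Set E, IsOpen Y ∧ z₀ ∈ Y ∧ Y ⊆ T ∧ ∃ W' : Set (S × E), IsOpen W' ∧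
      (s₀, g (s₀, z₀)) ∈ W' ∧ ∃ h : S × E → E, FamCr γ (n + 1) h W' ∧
      ∀ q ∈ W', h q ∈ Y ∧ (q.1, h q) ∈ W ∧ g (q.1, h q) = q.2 ∧
        ∀ z ∈ Y, g (q.1, z) = q.2 → z = h q := by
  obtain ⟨hd, hg'⟩ := hg.fderiv hW
  set g' : S × E → E →L[ℝ] E := fun q => _root_.fderiv ℝ (fun x => g (q.1, x)) q.2 with hg'def
  obtain ⟨A, hA⟩ := hinv
  have hO : IsOpen {L : E →L[ℝ] E | L.IsInvertible} := by
    have : {L : E →L[ℝ] E | L.IsInvertible} = range ((↑) : (E ≃L[ℝ] E) → E →L[ℝ] E) := rfl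
    rw [this]; exact ContinuousLinearEquiv.isOpen
  have hgc := hg'.continuousOn.continuousAt (hW.mem_nhds h₀)
  -- After composition with A⁻¹ the maps become, uniformly in the parameter, perturbations of the
  -- identity with Lipschitz constant 1/2. Injectivity and surjectivity both rest on this.
  have e1 : ∀ᶠ q in 𝓝 (s₀, z₀),
      ‖(A.symm : E →L[ℝ] E).comp (g' q) - ContinuousLinearMap.id ℝ E‖ < 1 / 2 := by
    have hc : ContinuousAt
        (fun q => ‖(A.symm : E →L[ℝ] E).comp (g' q) - ContinuousLinearMap.id ℝ E‖) (s₀, z₀) :=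
      ((continuousAt_const.clm_comp hgc).sub continuousAt_const).norm
    refine hc.eventually (gt_mem_nhds ?_)
    have : g' (s₀, z₀) = A := hA.symm
    beta_reduce
    rw [this, ContinuousLinearEquiv.coe_symm_comp_coe, sub_self, norm_zero]
    norm_num
  have e2 : ∀ᶠ q in 𝓝 (s₀, z₀), (g' q).IsInvertible :=
    hgc.eventually (hO.mem_nhds ⟨A, hA⟩)
  have e3 : ∀ᶠ q : S × E in 𝓝 (s₀, z₀), q.2 ∈ T := continuousAt_snd.eventually hT
  obtain ⟨N', hN', r, hr, hNr'⟩ :=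
    exists_ball_of_eventually (e1.and (e2.and (e3.and (hW.mem_nhds h₀))))
  set N := interior N' with hNdef
  have hN : IsOpen N := isOpen_interior
  have hs₀ : s₀ ∈ N := mem_interior_iff_mem_nhds.2 hN'
  have hNr : ∀ s ∈ N, ∀ z ∈ Metric.ball z₀ r, _ := fun s hs => hNr' s (interior_subset hs)
  set H : S → E → E := fun s z => A.symm (g (s, z)) with hH
  have happ : ∀ s ∈ N, ∀ z ∈ Metric.ball z₀ r, ∀ z' ∈ Metric.ball z₀ r,
      ‖H s z - H s z' - (z - z')‖ ≤ 1 / 2 * ‖z - z'‖ := by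
    intro s hs z hz z' hz'
    have := (convex_ball z₀ r).norm_image_sub_le_of_norm_hasFDerivWithin_le
      (f := fun z => H s z - z) (C := 1 / 2)
      (fun x hx => (((A.symm : E →L[ℝ] E).hasFDerivAt.comp x
        (hd (s, x) (hNr s hs x hx).2.2.2)).sub (hasFDerivAt_id x)).hasFDerivWithinAt)
      (fun x hx => (hNr s hs x hx).1.le) hz' hz
    refine le_trans (le_of_eq ?_) this
    congr 1; abel
  have hlip : ∀ s ∈ N, ∀ z ∈ Metric.ball z₀ r, ∀ z' ∈ Metric.ball z₀ r,
      ‖z - z'‖ ≤ 2 * ‖H s z - H s z'‖ := by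
    intro s hs z hz z' hz'
    have h1 := happ s hs z hz z' hz'
    have h2 : ‖z - z'‖ ≤ ‖H s z - H s z'‖ + ‖H s z - H s z' - (z - z')‖ := by
      have := norm_sub_le (H s z - H s z') (H s z - H s z' - (z - z'))
      rwa [sub_sub_cancel] at this
    linarith
  have hball : Metric.closedBall z₀ (r / 2) ⊆ Metric.ball z₀ r :=
    Metric.closedBall_subset_ball (by linarith)
  have hz₀r : z₀ ∈ Metric.ball z₀ r := Metric.mem_ball_self hr
  -- The image radius is (1 - 1/2) · r/2 = r/4.
  have hsurj : ∀ s ∈ N, SurjOn (H s) (Metric.closedBall z₀ (r / 2))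
      (Metric.closedBall (H s z₀) (r / 4)) := by
    intro s hs
    have hap : ApproximatesLinearOn (H s) (ContinuousLinearMap.id ℝ E) (Metric.ball z₀ r)
        (1 / 2 : ℝ≥0) := by
      intro z hz z' hz'
      simpa using happ s hs z hz z' hz'
    have := hap.surjOn_closedBall_of_nonlinearRightInverse
      (f'symm := ⟨id, 1, fun y => by simp, fun y => rfl⟩) (ε := r / 2) (by positivity) hball
    refine this.mono Subset.rfl (Metric.closedBall_subset_closedBall ?_)
    simp only [NNReal.coe_one, inv_one]
    norm_num
    linarith
  have hHc : ∀ z ∈ Metric.ball z₀ r, ContinuousOn (fun q : S × E => H q.1 z) (N ×ˢ univ) := by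
    intro z hz
    refine A.symm.continuous.comp_continuousOn (hg.continuousOn.comp (f := fun q : S × E => (q.1, z))
      (by fun_prop) fun q hq => (hNr q.1 hq.1 z hz).2.2.2)
  set W' : Set (S × E) := (N ×ˢ univ) ∩ {q | ‖A.symm q.2 - H q.1 z₀‖ < r / 4} with hW'def
  have hW'o : IsOpen W' := by
    have hc : ContinuousOn (fun q : S × E => ‖A.symm q.2 - H q.1 z₀‖) (N ×ˢ univ) :=
      ((A.symm.continuous.comp continuous_snd).continuousOn.sub (hHc z₀ hz₀r)).norm
    exact hc.isOpen_inter_preimage (hN.prod isOpen_univ) isOpen_Iio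
  have hex : ∀ q : S × E, ∃ z, q ∈ W' → z ∈ Metric.closedBall z₀ (r / 2) ∧ g (q.1, z) = q.2 := by
    intro q
    by_cases hq : q ∈ W'
    · have h1 : A.symm q.2 ∈ Metric.closedBall (H q.1 z₀) (r / 4) := by
        rw [mem_closedBall_iff_norm]; exact le_of_lt hq.2
      obtain ⟨z, hz, hz'⟩ := hsurj q.1 hq.1.1 h1
      exact ⟨z, fun _ => ⟨hz, A.symm.injective hz'⟩⟩
    · exact ⟨0, fun h => (hq h).elim⟩
  choose h hh using hex
  have hhball : ∀ q ∈ W', h q ∈ Metric.ball z₀ r := fun q hq => hball (hh q hq).1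
  have hHh : ∀ q ∈ W', H q.1 (h q) = A.symm q.2 := fun q hq => by
    simp only [hH]; rw [(hh q hq).2]
  -- By `hlip`, the distance from `h q` to `h q₁` is at most twice that of A⁻¹ q.2 to H q.1 (h q₁).
  -- The latter involves `h` only at the fixed point q₁ and tends to 0.
  have hcont : ContinuousOn h W' := by
    intro q₁ hq₁
    refine ContinuousAt.continuousWithinAt ?_
    have hc : ContinuousAt (fun q : S × E => 2 * ‖A.symm q.2 - H q.1 (h q₁)‖) q₁ := by
      have := (hHc (h q₁) (hhball q₁ hq₁)).continuousAt
        ((hN.prod isOpen_univ).mem_nhds hq₁.1)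
      exact continuousAt_const.mul
        (((A.symm.continuous.comp continuous_snd).continuousAt.sub this).norm)
    have hc0 : Tendsto (fun q : S × E => 2 * ‖A.symm q.2 - H q.1 (h q₁)‖) (𝓝 q₁) (𝓝 0) := by
      have := hc.tendsto
      simpa [hHh q₁ hq₁] using this
    refine tendsto_iff_norm_sub_tendsto_zero.2 (squeeze_zero' ?_ ?_ hc0)
    · exact Eventually.of_forall fun _ => norm_nonneg _
    · filter_upwards [hW'o.mem_nhds hq₁] with q hq
      rw [← hHh q hq]
      exact hlip q.1 hq.1.1 _ (hhball q hq) _ (hhball q₁ hq₁)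
  refine ⟨Metric.ball z₀ r, Metric.isOpen_ball, hz₀r, fun z hz => (hNr s₀ hs₀ z hz).2.2.1, W', hW'o,
    ⟨⟨hs₀, trivial⟩, ?_⟩, h, ?_, fun q hq => ⟨hhball q hq,
      (hNr q.1 hq.1.1 _ (hhball q hq)).2.2.2, (hh q hq).2, fun z hz hgz => ?_⟩⟩
  · simp only [hH, mem_ofPred_eq, sub_self, norm_zero]
    positivity
  · refine FamCr.of_inverse hγ hW'o (V := N ×ˢ Metric.ball z₀ r) (hN.prod Metric.isOpen_ball)
      (g := g) (g' := g') (fun q hq => hd q (hNr q.1 hq.1 q.2 hq.2).2.2.2)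
      (hg'.mono fun q hq => (hNr q.1 hq.1 q.2 hq.2).2.2.2)
      (fun q hq => (hNr q.1 hq.1 q.2 hq.2).2.1) hcont
      (fun q hq => ⟨hq.1.1, hhball q hq⟩) fun q hq => (hh q hq).2
  · have h1 := hlip q.1 hq.1.1 z hz _ (hhball q hq)
    rw [hHh q hq] at h1
    simp only [hH] at h1
    rw [hgz, sub_self, norm_zero, mul_zero] at h1
    exact sub_eq_zero.1 (norm_le_zero_iff.1 h1)

end ParametricInverse

/-! ### Inverse branches and sums over fibers. -/

section Branches

variable {S : Type*} [TopologicalSpace S]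
variable {d : ℕ} {M : Type*} [TopologicalSpace M] [ChartedSpace (Model d) M]
  [IsManifold (𝓡 d) ∞ M] [CompactSpace M]
variable {N : ℕ} {p : ℕ} {γ : ℝ≥0} {e : EuclideanEmbedding d M N}

lemma isInvertible_of_det_ne_zero {A : Model d →L[ℝ] Model d} (h : A.det ≠ 0) :
    A.IsInvertible := by
  have h1 : IsUnit (A : Model d →ₗ[ℝ] Model d).det := isUnit_iff_ne_zero.2 h
  refine ⟨(LinearEquiv.ofIsUnitDet (v := (EuclideanSpace.basisFun (Fin d) ℝ).toBasis)
    (v' := (EuclideanSpace.basisFun (Fin d) ℝ).toBasis)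
    (f := (A : Model d →ₗ[ℝ] Model d)) ?_).toContinuousLinearEquiv, ?_⟩
  · rwa [LinearMap.det_toMatrix]
  · ext1 v; rfl

/-- A local branch of the inverses of a family of self-maps, along which a family of functions is
of class `C^{p+γ}`. -/
lemma SelfFam.exists_branch (hγ : γ ≤ 1) {u : S → M → M} {v : S → M → ℂ} {s₀ : S} {y₀ : M}
    (hu : SelfFam e γ (p + 1) u s₀ y₀) (hv : MFam d γ p v s₀ y₀)
    (hd : MDifferentiable (𝓡 d) (𝓡 d) (u s₀)) (hinj : Function.Injective (mder d (u s₀) y₀))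
    {φ : OpenPartialHomeomorph M (Model d)} (hφ : φ ∈ IsManifold.maximalAtlas (𝓡 d) ∞ M)
    (hyφ : u s₀ y₀ ∈ φ.source) {T : Set M} (hT : T ∈ 𝓝 y₀) :
    ∃ Y : Set M, IsOpen Y ∧ y₀ ∈ Y ∧ Y ⊆ T ∧ ∃ W : Set (S × Model d), IsOpen W ∧
      (s₀, φ (u s₀ y₀)) ∈ W ∧ ∃ h : S × Model d → M,
      FamCr γ p (fun q : S × Model d => v q.1 (h q)) W ∧
      ∀ q ∈ W, h q ∈ Y ∧ u q.1 (h q) = φ.symm q.2 ∧ ∀ y ∈ Y, u q.1 y = φ.symm q.2 → y = h q := by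
  set ψ := chartAt (Model d) y₀ with hψdef
  have hψ : ψ ∈ IsManifold.maximalAtlas (𝓡 d) ∞ M := IsManifold.chart_mem_maximalAtlas y₀
  have hyψ : y₀ ∈ ψ.source := mem_chart_source _ _
  obtain ⟨W₁, hW₁, hm₁, ht₁, hG⟩ := hu.famCr_chartMap hγ hφ hψ hyφ hyψ
  obtain ⟨W₂, hW₂, hm₂, -, hv₂⟩ := hv.famCr hγ hψ hyψ
  have hinv : (_root_.fderiv ℝ (fun z => chartMap φ ψ (u s₀) z) (ψ y₀)).IsInvertible :=
    isInvertible_of_det_ne_zero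
      (det_fderiv_chartMap_ne_zero hφ hψ (hd y₀) hyψ hyφ hinj)
  have hT' : ψ.symm ⁻¹' T ∈ 𝓝 (ψ y₀) := by
    have := (ψ.continuousAt_symm (ψ.map_source hyψ)).preimage_mem_nhds (t := T)
    rw [ψ.left_inv hyψ] at this
    exact this hT
  obtain ⟨Y, hY, hyY, hYT, W', hW', hmW', h, hh, hprop⟩ := (hG.mono
    (inter_subset_left (t := W₂))).exists_inverse hγ (hW₁.inter hW₂) ⟨hm₁, hm₂⟩ hinv hT'
  have hW'' : IsOpen (W' ∩ univ ×ˢ φ.target) := hW'.inter (isOpen_univ.prod φ.open_target)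
  refine ⟨ψ.source ∩ ψ ⁻¹' Y, ψ.isOpen_inter_preimage hY, ⟨hyψ, hyY⟩, fun y hy => ?_,
    W' ∩ univ ×ˢ φ.target, hW'', ⟨?_, trivial, φ.map_source hyφ⟩, fun q => ψ.symm (h q), ?_, ?_⟩
  · have := hYT hy.2
    rwa [mem_preimage, ψ.left_inv hy.1] at this
  · simpa [chartMap, ψ.left_inv hyψ] using hmW'
  · exact hv₂.comp hγ hW'' ((hh.of_succ hγ hW').mono inter_subset_left)
      ((hh.locHolder_of_succ le_rfl hW').mono inter_subset_left)
      fun q hq => (hprop q hq.1).2.1.2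
  · rintro q ⟨hq, -, hqφ⟩
    obtain ⟨h1, h2, h3, h4⟩ := hprop q hq
    have h5 := ht₁ _ h2.1
    refine ⟨⟨ψ.map_target h5.1, by simpa [ψ.right_inv h5.1] using h1⟩, ?_, fun y hy huy => ?_⟩
    · rw [← h3]
      simp only [chartMap]
      rw [φ.left_inv h5.2]
    · have := h4 (ψ y) hy.2 (by simp only [chartMap]; rw [ψ.left_inv hy.1, huy, φ.right_inv hqφ])
      change y = ψ.symm (h q)
      rw [← this, ψ.left_inv hy.1]

/-- A sum over the fibers of a family of immersive self-maps is a family of the same class. -/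
lemma MFam.finsum_fiber [T2Space M] (hγ : γ ≤ 1) {u : S → M → M} {v : S → M → ℂ} {s₀ : S}
    (hu : ∀ y, SelfFam e γ (p + 1) u s₀ y) (hv : ∀ y, MFam d γ p v s₀ y)
    (hd : MDifferentiable (𝓡 d) (𝓡 d) (u s₀))
    (hinj : ∀ y, Function.Injective (mder d (u s₀) y)) (x₀ : M) :
    (u s₀ ⁻¹' {x₀}).Finite ∧ MFam d γ p (fun s x => ∑ᶠ (y : M) (_ : u s y = x), v s y) s₀ x₀ := by
  classical
  set φ := chartAt (Model d) x₀ with hφdef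
  have hφ : φ ∈ IsManifold.maximalAtlas (𝓡 d) ∞ M := IsManifold.chart_mem_maximalAtlas x₀
  have hxφ : x₀ ∈ φ.source := mem_chart_source _ _
  have huc : ∀ y, ContinuousAt (fun z : S × M => u z.1 z.2) (s₀, y) := fun y => (hu y).continuousAt
  have hfin : (u s₀ ⁻¹' {x₀}).Finite := by
    -- The fiber is discrete, by uniqueness of branches, and M is compact.
    have key : ∀ y₀, ∃ Y ∈ 𝓝 y₀, (Y ∩ u s₀ ⁻¹' {x₀}).Finite := by
      intro y₀
      by_cases hy₀ : u s₀ y₀ = x₀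
      · obtain ⟨Y, hY, hyY, -, W, -, hmW, h, -, hprop⟩ := (hu y₀).exists_branch hγ (hv y₀) hd
          (hinj y₀) hφ (by rw [hy₀]; exact hxφ) univ_mem
        refine ⟨Y, hY.mem_nhds hyY, (finite_singleton (h (s₀, φ x₀))).subset ?_⟩
        rintro y ⟨hy, hyx⟩
        rw [hy₀] at hmW
        refine (hprop _ hmW).2.2 y hy ?_
        rw [φ.left_inv hxφ]
        exact hyx
      · have : ∀ᶠ y in 𝓝 y₀, u s₀ y ≠ x₀ := by
          have hc : ContinuousAt (u s₀) y₀ := (hd y₀).continuousAt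
          exact hc.eventually_ne hy₀
        refine ⟨_, this, Set.Finite.subset finite_empty ?_⟩
        rintro y ⟨hy, hyx⟩
        exact hy hyx
    have := isCompact_univ.induction_on (p := fun K => (K ∩ u s₀ ⁻¹' {x₀}).Finite) (by simp)
      (fun s t hst ht => ht.subset (inter_subset_inter_left _ hst))
      (fun s t hs ht => by rw [union_inter_distrib_right]; exact hs.union ht)
      (fun y _ => by
        obtain ⟨Y, hY, hf⟩ := key y
        exact ⟨Y, mem_nhdsWithin_of_mem_nhds hY, hf⟩)
    rwa [univ_inter] at this
  refine ⟨hfin, ?_⟩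
  -- Disjoint neighbourhoods of the points of the fiber keep the branches distinct, so that no
  -- preimage is counted twice.
  obtain ⟨U, hU, hUd⟩ := hfin.t2_separation
  have hbr : ∀ y : M, ∃ Y : Set M, ∃ W : Set (S × Model d), ∃ h : S × Model d → M,
      u s₀ y = x₀ → IsOpen Y ∧ y ∈ Y ∧ Y ⊆ U y ∧ IsOpen W ∧ (s₀, φ x₀) ∈ W ∧
      FamCr γ p (fun q : S × Model d => v q.1 (h q)) W ∧
      ∀ q ∈ W, h q ∈ Y ∧ u q.1 (h q) = φ.symm q.2 ∧ ∀ y ∈ Y, u q.1 y = φ.symm q.2 → y = h q := by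
    intro y
    by_cases hy : u s₀ y = x₀
    · obtain ⟨Y, hY, hyY, hYU, W, hW, hmW, h, hf, hprop⟩ := (hu y).exists_branch hγ (hv y) hd
        (hinj y) hφ (by rw [hy]; exact hxφ) ((hU y).2.mem_nhds (hU y).1)
      rw [hy] at hmW
      exact ⟨Y, W, h, fun _ => ⟨hY, hyY, hYU, hW, hmW, hf, hprop⟩⟩
    · exact ⟨∅, ∅, fun _ => y, fun h => (hy h).elim⟩
  choose Y W h hbr using hbr
  set Fs := hfin.toFinset with hFs
  have hmemF : ∀ y, y ∈ Fs ↔ u s₀ y = x₀ := fun y => by simp [hFs]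
  -- No preimage may appear away from the branches: on this compact set `u s₀` misses `x₀`, and this
  -- persists for nearby parameters and points.
  have hK : IsCompact (⋃ y ∈ Fs, Y y)ᶜ :=
    (isOpen_biUnion fun y hy => (hbr y ((hmemF y).1 hy)).1).isClosed_compl.isCompact
  have havoid : ∀ᶠ z in 𝓝 (s₀, x₀), ∀ y ∈ (⋃ y ∈ Fs, Y y)ᶜ, u z.1 y ≠ z.2 := by
    refine hK.eventually_forall_of_forall_eventually (P := fun (z : S × M) y => u z.1 y ≠ z.2)
      fun y hy => ?_
    have hne : u s₀ y ≠ x₀ := by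
      intro hyx
      refine hy (mem_iUnion₂.2 ⟨y, (hmemF y).2 hyx, (hbr y hyx).2.1⟩)
    have c1 : ContinuousAt (fun z : (S × M) × M => u z.1.1 z.2) ((s₀, x₀), y) :=
      ContinuousAt.comp (f := fun z : (S × M) × M => (z.1.1, z.2)) (x := ((s₀, x₀), y))
        (huc y) (by fun_prop)
    have c2 : ContinuousAt (fun z : (S × M) × M => z.1.2) ((s₀, x₀), y) := by fun_prop
    exact (c1.prodMk c2).eventually
      ((isClosed_diagonal.isOpen_compl).mem_nhds (by simpa using hne))
  have havoid' : ∀ᶠ q in 𝓝 (s₀, φ x₀), ∀ y ∈ (⋃ y ∈ Fs, Y y)ᶜ, u q.1 y ≠ φ.symm q.2 :=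
    (tendsto_symm_param hxφ s₀).eventually havoid
  set W₀ : Set (S × Model d) := (⋂ y ∈ Fs, W y) ∩
    interior {q | ∀ y ∈ (⋃ y ∈ Fs, Y y)ᶜ, u q.1 y ≠ φ.symm q.2} with hW₀def
  have hW₀ : IsOpen W₀ :=
    (isOpen_biInter_finset fun y hy => (hbr y ((hmemF y).1 hy)).2.2.2.1).inter isOpen_interior
  have hWy : ∀ q ∈ W₀, ∀ y ∈ Fs, q ∈ W y := fun q hq y hy => mem_iInter₂.1 hq.1 y hy
  refine ⟨φ, hφ, hxφ, W₀, hW₀, ⟨mem_iInter₂.2 fun y hy => (hbr y ((hmemF y).1 hy)).2.2.2.2.1,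
    mem_interior_iff_mem_nhds.2 havoid'⟩, ?_⟩
  have hsum : FamCr γ p (fun q : S × Model d => ∑ y ∈ Fs, v q.1 (h y q)) W₀ :=
    FamCr.sum Fs fun y hy => (hbr y ((hmemF y).1 hy)).2.2.2.2.2.1.mono fun q hq => hWy q hq y hy
  refine hsum.congr hW₀ fun q hq => ?_
  have hprop : ∀ y ∈ Fs, h y q ∈ Y y ∧ u q.1 (h y q) = φ.symm q.2 ∧
      ∀ y' ∈ Y y, u q.1 y' = φ.symm q.2 → y' = h y q := fun y hy =>
    (hbr y ((hmemF y).1 hy)).2.2.2.2.2.2 q (hWy q hq y hy)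
  have hset : {y | u q.1 y = φ.symm q.2} = ↑(Fs.image fun y => h y q) := by
    ext y
    simp only [mem_ofPred_eq, Finset.coe_image, mem_image, Finset.mem_coe]
    constructor
    · intro hy
      have hq2 : q ∈ {q : S × Model d | ∀ y ∈ (⋃ y ∈ Fs, Y y)ᶜ, u q.1 y ≠ φ.symm q.2} :=
        interior_subset hq.2
      by_cases hmem : y ∈ ⋃ y ∈ Fs, Y y
      · obtain ⟨y', hy', hyy'⟩ := mem_iUnion₂.1 hmem
        exact ⟨y', hy', ((hprop y' hy').2.2 y hyy' hy).symm⟩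
      · exact (hq2 y hmem hy).elim
    · rintro ⟨y', hy', rfl⟩
      exact (hprop y' hy').2.1
  have hinj' : Set.InjOn (fun y => h y q) Fs := by
    intro y hy y' hy' heq
    by_contra hne
    have hdis := hUd (show y ∈ u s₀ ⁻¹' {x₀} from (hmemF y).1 hy)
      (show y' ∈ u s₀ ⁻¹' {x₀} from (hmemF y').1 hy') hne
    refine Set.disjoint_left.1 hdis ((hbr y ((hmemF y).1 hy)).2.2.1 (hprop y hy).1) ?_
    have heq' : h y q = h y' q := heq
    rw [heq']
    exact (hbr y' ((hmemF y').1 hy')).2.2.1 (hprop y' hy').1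
  have e1 : (∑ᶠ (y : M) (_ : u q.1 y = φ.symm q.2), v q.1 y) =
      ∑ᶠ (y : M) (_ : y ∈ (↑(Fs.image fun y => h y q) : Set M)), v q.1 y := by
    rw [← hset]; rfl
  change (∑ y ∈ Fs, v q.1 (h y q)) = ∑ᶠ (y : M) (_ : u q.1 y = φ.symm q.2), v q.1 y
  rw [e1, finsum_mem_coe_finset, Finset.sum_image hinj']

end Branches

/-! ### The transfer operator as a family in the map and the function. -/

section Transfer

variable {d : ℕ} {M : Type*} [TopologicalSpace M] [ChartedSpace (Model d) M]
  [IsManifold (𝓡 d) ∞ M] [CompactSpace M] [T2Space M]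
  [Bundle.RiemannianBundle (fun x : M => TangentSpace (𝓡 d) x)]
  [IsContMDiffRiemannianBundle (𝓡 d) ∞ (Model d) (fun x : M => TangentSpace (𝓡 d) x)]
variable {𝒰 : CoordCover d M} {N : ℕ} {p : ℕ} {γ : ℝ≥0} {e : EuclideanEmbedding d M N}

/-- The fibers of an immersive map are finite, and its transfer operator depends regularly on the
map, the function and the point. -/
lemma mfam_transferFun (hγ : γ ≤ 1) {g : CrSelf 𝒰 e (p + 1) γ}
    (hg : ∀ y, Function.Injective (mder d g y)) (w : CrFun ℂ 𝒰 p γ) (x : M) :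
    (g ⁻¹' {x}).Finite ∧
    MFam d γ p (fun s : CrSelf 𝒰 e (p + 1) γ × CrFun ℂ 𝒰 p γ => transferFun d s.1 s.2) (g, w) x := by
  have hu : ∀ y, SelfFam e γ (p + 1) (fun (s : CrSelf 𝒰 e (p + 1) γ × CrFun ℂ 𝒰 p γ) x => s.1 x)
      (g, w) y := fun y =>
    MFam.reparam (u := fun (g : CrSelf 𝒰 e (p + 1) γ) x => e.toFun (g x)) continuous_fst
      (selfFam_eval g y)
  have hw : ∀ y, MFam d γ p (fun (s : CrSelf 𝒰 e (p + 1) γ × CrFun ℂ 𝒰 p γ) x => s.2 x)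
      (g, w) y := fun y =>
    MFam.reparam (u := fun (w : CrFun ℂ 𝒰 p γ) x => w x) continuous_snd (mfam_eval 𝒰 w y)
  exact MFam.finsum_fiber hγ hu
    (fun y => MFam.div_absDet (e := e) hγ (hu y) (hw y) (fun s => s.1.mdifferentiable) (hg y))
    g.mdifferentiable hg x

end Transfer

/-! ### Expanding maps are immersive and form an open set. -/

section Expansion

variable {d : ℕ} {M : Type*} [TopologicalSpace M] [ChartedSpace (Model d) M]
  [IsManifold (𝓡 d) ∞ M] [Bundle.RiemannianBundle (fun x : M => TangentSpace (𝓡 d) x)]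

lemma mder_comp {f g : M → M} (hf : MDifferentiable (𝓡 d) (𝓡 d) f)
    (hg : MDifferentiable (𝓡 d) (𝓡 d) g) (y : M) :
    mder d (f ∘ g) y = (mder d f (g y)).comp (mder d g y) :=
  mfderiv_comp y (hf (g y)) (hg y)

lemma mdifferentiable_iterate {g : M → M} (hg : MDifferentiable (𝓡 d) (𝓡 d) g) (k : ℕ) :
    MDifferentiable (𝓡 d) (𝓡 d) g^[k] := by
  induction k with
  | zero => exact mdifferentiable_id
  | succ k ih => rw [Function.iterate_succ]; exact ih.comp hg

lemma mder_id (y : M) : mder d (id : M → M) y = ContinuousLinearMap.id ℝ (Model d) :=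
  mfderiv_id

/-- A lower bound for the derivative of a map gives one for the iterates. -/
lemma pow_mul_tangentNorm_le {g : M → M} (hg : MDifferentiable (𝓡 d) (𝓡 d) g) {a : ℝ}
    (ha : 0 ≤ a) (h : ∀ y v, a * tangentNorm y v ≤ tangentNorm (g y) (mder d g y v)) (k : ℕ)
    (y : M) (v : Model d) :
    a ^ k * tangentNorm y v ≤ tangentNorm (g^[k] y) (mder d g^[k] y v) := by
  induction k generalizing y v with
  | zero => rw [Function.iterate_zero, mder_id]; simp
  | succ k ih =>
    rw [Function.iterate_succ, mder_comp (mdifferentiable_iterate hg k) hg]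
    calc a ^ (k + 1) * tangentNorm y v = a ^ k * (a * tangentNorm y v) := by ring
      _ ≤ a ^ k * tangentNorm (g y) (mder d g y v) := by gcongr; exact h y v
      _ ≤ _ := ih _ _

lemma isExpanding_iff {g : M → M} : IsExpanding d g ↔ ∃ C > (0 : ℝ), ∃ l > (1 : ℝ),
    ∀ n : ℕ, 1 ≤ n → ∀ (x : M) (v : Model d),
      C * l ^ n * tangentNorm x v ≤ tangentNorm (g^[n] x) (mder d g^[n] x v) := Iff.rfl

/-- A map is expanding if its derivative is bounded below and some iterate doubles the length of
tangent vectors. -/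
lemma isExpanding_of_iterate {g : M → M} (hg : MDifferentiable (𝓡 d) (𝓡 d) g) {c : ℝ}
    (hc : 0 < c) (h : ∀ y v, c * tangentNorm y v ≤ tangentNorm (g y) (mder d g y v)) {n : ℕ}
    (hn : n ≠ 0) (h2 : ∀ y v, 2 * tangentNorm y v ≤ tangentNorm (g^[n] y) (mder d g^[n] y v)) :
    IsExpanding d g := by
  set c' := min c 1 with hc'
  have hc'0 : 0 < c' := lt_min hc one_pos
  have hc'1 : c' ≤ 1 := min_le_right _ _
  have h' : ∀ y v, c' * tangentNorm y v ≤ tangentNorm (g y) (mder d g y v) := fun y v =>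
    (mul_le_mul_of_nonneg_right (min_le_left _ _) (tangentNorm_nonneg y v)).trans (h y v)
  set l : ℝ := (2 : ℝ) ^ ((n : ℝ)⁻¹) with hl
  have hl1 : 1 < l := Real.one_lt_rpow (by norm_num) (by positivity)
  have hln : l ^ n = 2 := Real.rpow_inv_natCast_pow (by norm_num) hn
  -- Write m = n(m / n) + m % n. The remaining m % n steps lose at most c'^n, because c' ≤ 1, and
  -- l^m exceeds 2^(m / n) by at most a factor 2; the constant absorbs both.
  refine isExpanding_iff.2 ⟨c' ^ n / 2, by positivity, l, hl1, fun m _ y v => ?_⟩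
  have hm : g^[m] = (g^[n])^[m / n] ∘ g^[m % n] := by
    rw [← Function.iterate_mul, ← Function.iterate_add, Nat.div_add_mod]
  have hr : m % n < n := Nat.mod_lt _ (Nat.pos_of_ne_zero hn)
  have hlm : l ^ m ≤ 2 ^ (m / n) * 2 := by
    conv_lhs => rw [← Nat.div_add_mod m n, pow_add, pow_mul, hln]
    gcongr
    rw [← hln]
    exact pow_le_pow_right₀ hl1.le hr.le
  have hcr : c' ^ n ≤ c' ^ (m % n) := pow_le_pow_of_le_one hc'0.le hc'1 hr.le
  have hgn := mdifferentiable_iterate hg n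
  rw [hm, mder_comp (mdifferentiable_iterate hgn _) (mdifferentiable_iterate hg _)]
  have hv := tangentNorm_nonneg y v
  calc c' ^ n / 2 * l ^ m * tangentNorm y v
      ≤ c' ^ (m % n) / 2 * (2 ^ (m / n) * 2) * tangentNorm y v := by gcongr
    _ = 2 ^ (m / n) * (c' ^ (m % n) * tangentNorm y v) := by ring
    _ ≤ 2 ^ (m / n) * tangentNorm (g^[m % n] y) (mder d g^[m % n] y v) := by
      gcongr; exact pow_mul_tangentNorm_le hg hc'0.le h' _ y v
    _ ≤ _ := pow_mul_tangentNorm_le hgn zero_le_two h2 _ _ _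

lemma IsExpanding.injective_mder {g : M → M} (hg : IsExpanding d g) (y : M) :
    Function.Injective (mder d g y) := by
  obtain ⟨C, hC, l, hl, h⟩ := isExpanding_iff.1 hg
  refine (injective_iff_map_eq_zero _).2 fun v hv => ?_
  by_contra hne
  have h1 := h 1 le_rfl y v
  have h2 : 0 < C * l ^ 1 * tangentNorm y v := by
    have := tangentNorm_pos y hne
    positivity
  rw [Function.iterate_one, hv, tangentNorm_zero] at h1
  linarith

variable [IsContMDiffRiemannianBundle (𝓡 d) ∞ (Model d) (fun x : M => TangentSpace (𝓡 d) x)]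

/-- The Riemannian norm in a chart is jointly continuous. -/
lemma continuousOn_tangentNorm_chart {φ : OpenPartialHomeomorph M (Model d)}
    (hφ : φ ∈ IsManifold.maximalAtlas (𝓡 d) ∞ M) :
    ContinuousOn (fun t : Model d × Model d => tangentNorm (φ.symm t.1) (chartSymmDer φ t.1 t.2))
      (φ.target ×ˢ univ) := by
  have h : ∀ t : Model d × Model d, tangentNorm (φ.symm t.1) (chartSymmDer φ t.1 t.2) =
      √(∑ a, ∑ b, t.2 a * (t.2 b * tangentInner (φ.symm t.1) (chartSymmDer φ t.1 (stdVec a))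
        (chartSymmDer φ t.1 (stdVec b)))) := by
    intro t
    rw [tangentNorm_eq_sqrt]
    congr 1
    have h1 : chartSymmDer φ t.1 t.2 = ∑ a, t.2 a • chartSymmDer φ t.1 (stdVec a) := by
      conv_lhs => rw [model_eq_sum t.2]
      rw [map_sum]
      simp only [map_smul]
    rw [h1]
    change tangentBilin _ _ _ = ∑ a, ∑ b, t.2 a * (t.2 b * tangentBilin _ _ _)
    simp only [map_sum, LinearMap.sum_apply, map_smul, LinearMap.smul_apply, smul_eq_mul,
      Finset.mul_sum]
    rw [Finset.sum_comm]
    refine Finset.sum_congr rfl fun a _ => Finset.sum_congr rfl fun b _ => by ring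
  simp only [h]
  refine Real.continuous_sqrt.comp_continuousOn (continuousOn_finsetSum _ fun a _ =>
    continuousOn_finsetSum _ fun b _ => ?_)
  have h1 := ((contDiffOn_tangentInner hφ (stdVec a) (stdVec b)).continuousOn.comp
    (f := Prod.fst) (s := φ.target ×ˢ (univ : Set (Model d))) continuousOn_fst fun t ht => ht.1)
  have c1 : Continuous fun t : Model d × Model d => t.2 a := by fun_prop
  have c2 : Continuous fun t : Model d × Model d => t.2 b := by fun_prop
  exact c1.continuousOn.mul (c2.continuousOn.mul h1)

variable [CompactSpace M] {S : Type*} [TopologicalSpace S] {N p : ℕ} {γ : ℝ≥0}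
  {e : EuclideanEmbedding d M N}

/-- A strict lower bound for the derivative of a self-map persists under small perturbations. -/
lemma SelfFam.eventually_mul_tangentNorm_le (hγ : γ ≤ 1) {u : S → M → M} {s₀ : S}
    (hu : ∀ y, SelfFam e γ (p + 1) u s₀ y) (hd : ∀ s, MDifferentiable (𝓡 d) (𝓡 d) (u s)) {a : ℝ}
    (ha : ∀ y v, v ≠ 0 → a * tangentNorm y v < tangentNorm (u s₀ y) (mder d (u s₀) y v)) :
    ∀ᶠ s in 𝓝 s₀, ∀ y v, a * tangentNorm y v ≤ tangentNorm (u s y) (mder d (u s) y v) := by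
  have key : ∀ y₀ : M, ∀ᶠ t : S × M in 𝓝 (s₀, y₀), ∀ v,
      a * tangentNorm t.2 v ≤ tangentNorm (u t.1 t.2) (mder d (u t.1) t.2 v) := by
    intro y₀
    set ψ := chartAt (Model d) y₀ with hψdef
    set φ := chartAt (Model d) (u s₀ y₀) with hφdef
    have hψ : ψ ∈ IsManifold.maximalAtlas (𝓡 d) ∞ M := IsManifold.chart_mem_maximalAtlas y₀
    have hφ : φ ∈ IsManifold.maximalAtlas (𝓡 d) ∞ M := IsManifold.chart_mem_maximalAtlas _
    have hyψ : y₀ ∈ ψ.source := mem_chart_source _ _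
    have hyφ : u s₀ y₀ ∈ φ.source := mem_chart_source _ _
    obtain ⟨W, hW, hmW, htW, hG⟩ := (hu y₀).famCr_chartMap hγ hφ hψ hyφ hyψ
    obtain ⟨-, hG'⟩ := hG.fderiv hW
    set D : S × Model d → Model d →L[ℝ] Model d :=
      fun q => _root_.fderiv ℝ (chartMap φ ψ (u q.1)) q.2 with hD
    set nφ : Model d × Model d → ℝ := fun t => tangentNorm (φ.symm t.1) (chartSymmDer φ t.1 t.2)
    set nψ : Model d × Model d → ℝ := fun t => tangentNorm (ψ.symm t.1) (chartSymmDer ψ t.1 t.2)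
    have htr : ∀ s y, (s, ψ y) ∈ W → y ∈ ψ.source → ∀ v : Model d,
        tangentNorm (u s y) (mder d (u s) y v) =
          nφ (chartMap φ ψ (u s) (ψ y), D (s, ψ y) (chartDer ψ y v)) ∧
        tangentNorm y v = nψ (ψ y, chartDer ψ y v) := by
      intro s y hs hy v
      have h1 := (htW _ hs).2
      simp only [ψ.left_inv hy] at h1
      have h2 := mder_eq hφ hψ (hd s y) hy h1
      simp only [nφ, nψ, chartMap, ψ.left_inv hy, φ.left_inv h1]
      refine ⟨by rw [h2]; rfl, ?_⟩
      have h3 := DFunLike.congr_fun (chartSymmDer_comp_chartDer hψ hy) v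
      rw [ContinuousLinearMap.comp_apply, ContinuousLinearMap.id_apply] at h3
      rw [h3]
    -- The strict inequality is open and the unit sphere compact, so it holds on the whole sphere
    -- for nearby parameters; homogeneity extends it to all nonzero vectors.
    have hsph : ∀ᶠ q in 𝓝 (s₀, ψ y₀), ∀ η ∈ Metric.sphere (0 : Model d) 1,
        a * nψ (q.2, η) < nφ (chartMap φ ψ (u q.1) q.2, D q η) := by
      refine (isCompact_sphere (0 : Model d) 1).eventually_forall_of_forall_eventually
        (P := fun (q : S × Model d) η => a * nψ (q.2, η) < nφ (chartMap φ ψ (u q.1) q.2, D q η))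
        fun η hη => ?_
      have cG : ContinuousAt (fun q : S × Model d => chartMap φ ψ (u q.1) q.2) (s₀, ψ y₀) :=
        hG.continuousOn.continuousAt (hW.mem_nhds hmW)
      have cD : ContinuousAt D (s₀, ψ y₀) := hG'.continuousOn.continuousAt (hW.mem_nhds hmW)
      have cφ : ContinuousAt nφ (chartMap φ ψ (u s₀) (ψ y₀), D (s₀, ψ y₀) η) :=
        (continuousOn_tangentNorm_chart hφ).continuousAt
          ((φ.open_target.prod isOpen_univ).mem_nhds ⟨φ.map_source (htW _ hmW).2, trivial⟩)
      have cψ : ContinuousAt nψ (ψ y₀, η) :=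
        (continuousOn_tangentNorm_chart hψ).continuousAt
          ((ψ.open_target.prod isOpen_univ).mem_nhds ⟨ψ.map_source hyψ, trivial⟩)
      have c1 : ContinuousAt (fun z : (S × Model d) × Model d => a * nψ (z.1.2, z.2))
          ((s₀, ψ y₀), η) :=
        continuousAt_const.mul (ContinuousAt.comp (f := fun z : (S × Model d) × Model d =>
          (z.1.2, z.2)) (x := ((s₀, ψ y₀), η)) cψ (by fun_prop))
      have c2 : ContinuousAt (fun z : (S × Model d) × Model d =>
          nφ (chartMap φ ψ (u z.1.1) z.1.2, D z.1 z.2)) ((s₀, ψ y₀), η) := by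
        refine ContinuousAt.comp (f := fun z : (S × Model d) × Model d =>
          (chartMap φ ψ (u z.1.1) z.1.2, D z.1 z.2)) (x := ((s₀, ψ y₀), η)) cφ ?_
        refine ContinuousAt.prodMk ?_ ?_
        · exact ContinuousAt.comp (f := Prod.fst) (x := ((s₀, ψ y₀), η)) cG continuousAt_fst
        · exact ContinuousAt.clm_apply
            (ContinuousAt.comp (f := Prod.fst) (x := ((s₀, ψ y₀), η)) cD continuousAt_fst)
            continuousAt_snd
      refine c1.eventually_lt c2 ?_
      have hη0 : η ≠ 0 := by
        rintro rfl
        simp at hη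
      have h1 := DFunLike.congr_fun (chartDer_comp_chartSymmDer hψ hyψ) η
      rw [ContinuousLinearMap.comp_apply, ContinuousLinearMap.id_apply] at h1
      have h2 := htr s₀ y₀ hmW hyψ (chartSymmDer ψ (ψ y₀) η)
      rw [h1] at h2
      change a * nψ (ψ y₀, η) < nφ (chartMap φ ψ (u s₀) (ψ y₀), D (s₀, ψ y₀) η)
      rw [← h2.1, ← h2.2]
      refine ha y₀ _ fun h0 => hη0 ?_
      rw [← h1, h0, map_zero]
    have hnhds : Tendsto (fun t : S × M => (t.1, ψ t.2)) (𝓝 (s₀, y₀)) (𝓝 (s₀, ψ y₀)) :=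
      (continuousAt_fst.prodMk (ContinuousAt.comp (f := Prod.snd) (x := (s₀, y₀))
        (ψ.continuousAt hyψ) continuousAt_snd))
    filter_upwards [hnhds.eventually (hsph.and (hW.mem_nhds hmW)),
      continuousAt_snd.eventually (ψ.open_source.mem_nhds hyψ)] with t ht hts v
    obtain ⟨h1, h2⟩ := htr t.1 t.2 ht.2 hts v
    set η := chartDer ψ t.2 v
    by_cases hη : η = 0
    · rw [h1, h2, hη, map_zero]
      simp only [nφ, nψ, map_zero, tangentNorm_zero, mul_zero, le_refl]
    · have hn : 0 < ‖η‖ := norm_pos_iff.2 hη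
      have h3 := ht.1 (‖η‖⁻¹ • η) (by simp [norm_smul, hn.ne'])
      simp only [nφ, nψ, map_smul, tangentNorm_smul, abs_inv, abs_norm] at h3
      rw [h1, h2]
      simp only [nφ, nψ]
      rw [mul_left_comm] at h3
      exact (le_of_mul_le_mul_left h3.le (by positivity))
  have := isCompact_univ.eventually_forall_of_forall_eventually (x₀ := s₀) (K := (univ : Set M))
    (P := fun s y => ∀ v, a * tangentNorm y v ≤ tangentNorm (u s y) (mder d (u s) y v))
    fun y _ => key y
  filter_upwards [this] with s hs y using hs y trivial

lemma selfFam_iterate (hγ : γ ≤ 1) {u : S → M → M} {s₀ : S}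
    (hu : ∀ y, SelfFam e γ (p + 1) u s₀ y) (k : ℕ) (y : M) :
    SelfFam e γ (p + 1) (fun s => (u s)^[k + 1]) s₀ y := by
  induction k generalizing y with
  | zero => exact hu y
  | succ k ih =>
    have := (ih (u s₀ y)).comp hγ (Nat.le_add_left 1 p) (hu y)
    exact this

/-- Expanding maps form an open set. -/
lemma IsExpanding.eventually {𝒰 : CoordCover d M} (hγ : γ ≤ 1) {f₀ : CrSelf 𝒰 e (p + 1) γ}
    (hf₀ : IsExpanding d f₀) :
    ∀ᶠ g : CrSelf 𝒰 e (p + 1) γ in 𝓝 f₀, IsExpanding d g := by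
  obtain ⟨C, hC, l, hl, h⟩ := isExpanding_iff.1 hf₀
  obtain ⟨n, hn⟩ := pow_unbounded_of_one_lt (2 / C) hl
  have hn2 : 2 < C * l ^ (n + 1) := by
    rw [div_lt_iff₀ hC] at hn
    have : l ^ n ≤ l ^ (n + 1) := pow_le_pow_right₀ hl.le n.le_succ
    nlinarith
  have hl0 : 0 < l := one_pos.trans hl
  -- The halved constant makes the inequality strict; any positive lower bound for the first
  -- derivative is enough.
  have h1 := SelfFam.eventually_mul_tangentNorm_le (e := e) hγ (fun y => selfFam_eval f₀ y)
    (fun g => g.mdifferentiable) (a := C * l / 2) fun y v hv => by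
      refine lt_of_lt_of_le ?_ (h 1 le_rfl y v)
      have := tangentNorm_pos y hv
      rw [pow_one]
      have : 0 < C * l := by positivity
      gcongr
      linarith
  have h2 := SelfFam.eventually_mul_tangentNorm_le (e := e) hγ
    (selfFam_iterate (e := e) hγ (fun y => selfFam_eval f₀ y) n)
    (fun g => mdifferentiable_iterate g.mdifferentiable (n + 1)) (a := 2) fun y v hv => by
      refine lt_of_lt_of_le ?_ (h (n + 1) (Nat.le_add_left 1 n) y v)
      have := tangentNorm_pos y hv
      gcongr
  filter_upwards [h1, h2] with g hg1 hg2
  exact isExpanding_of_iterate g.mdifferentiable (by positivity) hg1 (Nat.succ_ne_zero n) hg2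

end Expansion

/-! ### From measures of images to integrals. -/

section AbstractChangeOfVariables

variable {α : Type*} [MeasurableSpace α] {μ : Measure α} {B : Set α} {g : α → α} {J : α → ℝ}
variable {F : Type*} [NormedAddCommGroup F] [NormedSpace ℝ F]

/-- A formula for measures of images of subsets is the same as an identity of measures: `g` carries
J·μ on B to μ on g(B). Integrals of arbitrary functions can then be transported. -/
lemma map_domRestrict_eq (hB : MeasurableSet B) (hg : MeasurableEmbedding (B.domRestrict g))
    (h : ∀ A ⊆ B, MeasurableSet A → μ (g '' A) = ∫⁻ x in A, ENNReal.ofReal (J x) ∂μ) :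
    Measure.map (B.domRestrict g)
      (Measure.comap (↑) (μ.withDensity fun x => ENNReal.ofReal (J x))) = μ.restrict (g '' B) := by
  ext T hT
  have hemb := MeasurableEmbedding.subtype_coe hB
  have hpre : MeasurableSet (B.domRestrict g ⁻¹' T) := hg.measurable hT
  have hA : MeasurableSet (Subtype.val '' (B.domRestrict g ⁻¹' T)) :=
    hemb.measurableSet_image.2 hpre
  have himg : g '' (Subtype.val '' (B.domRestrict g ⁻¹' T)) = T ∩ g '' B := by
    ext x
    constructor
    · rintro ⟨_, ⟨y, hy, rfl⟩, rfl⟩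
      exact ⟨hy, y, y.2, rfl⟩
    · rintro ⟨hx, y, hy, rfl⟩
      exact ⟨y, ⟨⟨y, hy⟩, hx, rfl⟩, rfl⟩
  rw [Measure.map_apply hg.measurable hT, hemb.comap_apply, withDensity_apply _ hA,
    ← h _ (by rintro _ ⟨y, -, rfl⟩; exact y.2) hA, himg, Measure.restrict_apply hT]

lemma setIntegral_image_eq (hB : MeasurableSet B) (hg : MeasurableEmbedding (B.domRestrict g))
    (hJ : Measurable J) (hJ0 : ∀ x, 0 ≤ J x)
    (h : ∀ A ⊆ B, MeasurableSet A → μ (g '' A) = ∫⁻ x in A, ENNReal.ofReal (J x) ∂μ) (K : α → F) :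
    (IntegrableOn K (g '' B) μ ↔ IntegrableOn (fun x => J x • K (g x)) B μ) ∧
      ∫ x in g '' B, K x ∂μ = ∫ x in B, J x • K (g x) ∂μ := by
  have hJm : AEMeasurable (fun x => Real.toNNReal (J x)) (μ.restrict B) :=
    (hJ.real_toNNReal).aemeasurable
  constructor
  · rw [IntegrableOn, ← map_domRestrict_eq hB hg h, hg.integrable_map_iff]
    simp only [Set.domRestrict_eq, ← Function.comp_assoc, ENNReal.ofReal]
    rw [← (MeasurableEmbedding.subtype_coe hB).integrable_map_iff, map_comap_subtype_coe hB,
      restrict_withDensity hB, integrable_withDensity_iff_integrable_coe_smul₀ hJm]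
    simp_rw [IntegrableOn, Real.coe_toNNReal _ (hJ0 _), Function.comp_apply]
  · rw [← map_domRestrict_eq hB hg h, hg.integral_map]
    simp only [Set.domRestrict_apply, ← Function.comp_apply (f := K), ENNReal.ofReal]
    rw [← (MeasurableEmbedding.subtype_coe hB).integral_map (g := fun x => (K ∘ g) x),
      map_comap_subtype_coe hB, setIntegral_withDensity_eq_setIntegral_smul₀ hJm _ hB]
    refine integral_congr_ae (Eventually.of_forall fun x => ?_)
    simp only [NNReal.smul_def, Real.coe_toNNReal _ (hJ0 x)]

end AbstractChangeOfVariables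

/-! ### The Riemannian volume in charts and its change of variables. -/

section ChartVolume

variable {d : ℕ} {M : Type*} [TopologicalSpace M] [ChartedSpace (Model d) M]
  [IsManifold (𝓡 d) ∞ M] [Bundle.RiemannianBundle (fun x : M => TangentSpace (𝓡 d) x)]
  [IsContMDiffRiemannianBundle (𝓡 d) ∞ (Model d) (fun x : M => TangentSpace (𝓡 d) x)]
  [MeasurableSpace M] [BorelSpace M]

/-- The Riemannian volume on the domain of a chart. -/
def chartVol (φ : OpenPartialHomeomorph M (Model d)) : Measure M :=
  Measure.map φ.symm ((volume.restrict φ.target).withDensity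
    fun y => ENNReal.ofReal (volDensity φ y))

/-- Lusin–Souslin: an injective continuous image of a Borel subset of a Polish space is Borel. -/
lemma measurableSet_chart_image [PolishSpace M] (φ : OpenPartialHomeomorph M (Model d)) {B : Set M}
    (hB : MeasurableSet B) (hBφ : B ⊆ φ.source) : MeasurableSet (φ '' B) :=
  hB.image_of_continuousOn_injOn (φ.continuousOn.mono hBφ) (φ.injOn.mono hBφ)

lemma setLIntegral_chartVol [PolishSpace M] {φ : OpenPartialHomeomorph M (Model d)}
    (hφ : φ ∈ IsManifold.maximalAtlas (𝓡 d) ∞ M) {B : Set M} (hB : MeasurableSet B)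
    (hBφ : B ⊆ φ.source) {F : M → ℝ≥0∞} (hF : Measurable F) :
    ∫⁻ x in B, F x ∂(chartVol φ) =
      ∫⁻ z in φ '' B, ENNReal.ofReal (volDensity φ z) * F (φ.symm z) := by
  have hsymm : AEMeasurable φ.symm (volume.restrict φ.target) :=
    φ.continuousOn_symm.aemeasurable φ.open_target.measurableSet
  have hρ : AEMeasurable (fun y => ENNReal.ofReal (volDensity φ y))
      (volume.restrict φ.target) :=
    ((contDiffOn_volDensity hφ).continuousOn.aemeasurable
      φ.open_target.measurableSet).ennreal_ofReal
  have hind : Measurable (B.indicator F) := hF.indicator hB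
  rw [← lintegral_indicator hB, chartVol, lintegral_map' hind.aemeasurable
    (hsymm.mono_ac (withDensity_absolutelyContinuous _ _)),
    lintegral_withDensity_eq_lintegral_mul₀ (g := fun z => B.indicator F (φ.symm z)) hρ
      (hind.comp_aemeasurable hsymm)]
  have himg : φ '' B ∩ φ.target = φ '' B :=
    inter_eq_left.2 (by rintro _ ⟨x, hx, rfl⟩; exact φ.map_source (hBφ hx))
  conv_rhs => rw [← himg, ← setLIntegral_indicator (measurableSet_chart_image φ hB hBφ)]
  refine setLIntegral_congr_fun φ.open_target.measurableSet fun z hz => ?_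
  have hiff : φ.symm z ∈ B ↔ z ∈ φ '' B := by
    constructor
    · exact fun h => ⟨_, h, φ.right_inv hz⟩
    · rintro ⟨x, hx, rfl⟩
      rwa [φ.left_inv (hBφ hx)]
  by_cases h : z ∈ φ '' B
  · simp [indicator_of_mem h, indicator_of_mem (hiff.2 h)]
  · simp [indicator_of_notMem h, indicator_of_notMem (mt hiff.1 h)]

/-- The change of variables formula for an injective map between the domains of two charts. -/
lemma chartVol_image [PolishSpace M] [T2Space M] {φ ψ : OpenPartialHomeomorph M (Model d)}
    (hφ : φ ∈ IsManifold.maximalAtlas (𝓡 d) ∞ M) (hψ : ψ ∈ IsManifold.maximalAtlas (𝓡 d) ∞ M)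
    {g : M → M} {B : Set M} (hB : MeasurableSet B) (hBψ : B ⊆ ψ.source) (hgB : MapsTo g B φ.source)
    (hinj : InjOn g B) (hg : MDifferentiable (𝓡 d) (𝓡 d) g) (hJ : Measurable (absDet d g)) :
    chartVol φ (g '' B) = ∫⁻ x in B, ENNReal.ofReal (absDet d g x) ∂(chartVol ψ) := by
  have hgBm : MeasurableSet (g '' B) :=
    hB.image_of_continuousOn_injOn hg.continuous.continuousOn hinj
  have himg : φ '' (g '' B) = chartMap φ ψ g '' (ψ '' B) := by
    rw [image_image, image_image]
    refine image_congr fun y hy => ?_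
    simp only [chartMap, ψ.left_inv (hBψ hy)]
  have hd : ∀ z ∈ ψ '' B, HasFDerivWithinAt (chartMap φ ψ g) (fderiv ℝ (chartMap φ ψ g) z)
      (ψ '' B) z := by
    rintro _ ⟨y, hy, rfl⟩
    exact (hasFDerivAt_chartMap hφ hψ (hg y) (hBψ hy)
      (hgB hy)).differentiableAt.hasFDerivAt.hasFDerivWithinAt
  have hinj' : InjOn (chartMap φ ψ g) (ψ '' B) := by
    rintro _ ⟨y, hy, rfl⟩ _ ⟨y', hy', rfl⟩ h
    simp only [chartMap, ψ.left_inv (hBψ hy), ψ.left_inv (hBψ hy')] at h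
    rw [hinj hy hy' (φ.injOn (hgB hy) (hgB hy') h)]
  have hgφ : g '' B ⊆ φ.source := by rintro _ ⟨y, hy, rfl⟩; exact hgB hy
  have hψB := measurableSet_chart_image ψ hB hBψ
  rw [← setLIntegral_one, setLIntegral_chartVol hφ hgBm hgφ measurable_const, himg,
    lintegral_image_eq_lintegral_abs_det_fderiv_mul volume hψB hd hinj',
    setLIntegral_chartVol hψ hB hBψ hJ.ennreal_ofReal]
  refine setLIntegral_congr_fun hψB ?_
  rintro _ ⟨y, hy, rfl⟩
  have h1 := absDet_eq hφ hψ (hg y) (hBψ hy) (hgB hy)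
  have hpos := volDensity_pos hψ (ψ.map_source (hBψ hy))
  have hpos' := volDensity_pos hφ (φ.map_source (hgB hy))
  simp only [ψ.left_inv (hBψ hy), mul_one, chartMap] at h1 ⊢
  rw [← ENNReal.ofReal_mul (abs_nonneg _), ← ENNReal.ofReal_mul hpos.le, h1]
  congr 1
  field_simp

lemma absDet_id (y : M) : absDet d (id : M → M) y = 1 := by
  rw [absDet_eq_linVol, mder_id]
  exact div_self (linVol_pos y (T := ContinuousLinearMap.id ℝ (Model d)) fun _ _ h => h).ne'

/-- Change of variables for the identity map, whose Jacobian is 1, read in two different charts. -/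
lemma chartVol_eq [PolishSpace M] [T2Space M] {φ ψ : OpenPartialHomeomorph M (Model d)}
    (hφ : φ ∈ IsManifold.maximalAtlas (𝓡 d) ∞ M) (hψ : ψ ∈ IsManifold.maximalAtlas (𝓡 d) ∞ M)
    {B : Set M} (hB : MeasurableSet B) (hBφ : B ⊆ φ.source) (hBψ : B ⊆ ψ.source) :
    chartVol φ B = chartVol ψ B := by
  have hJ : absDet d (id : M → M) = fun _ => 1 := funext absDet_id
  have := chartVol_image hφ hψ hB hBψ (g := id) hBφ (injOn_id _) mdifferentiable_id
    (by rw [hJ]; exact measurable_const)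
  simpa [absDet_id] using this

/-- The Riemannian volume has density `√(det g_{ab})` in every chart. -/
lemma riemannianVolume_apply [PolishSpace M] [T2Space M] (𝒰 : CoordCover d M)
    {φ : OpenPartialHomeomorph M (Model d)} (hφ : φ ∈ IsManifold.maximalAtlas (𝓡 d) ∞ M)
    {B : Set M} (hB : MeasurableSet B) (hBφ : B ⊆ φ.source) :
    riemannianVolume 𝒰 B = chartVol φ B := by
  set C : Fin 𝒰.card → Set M := fun i => 𝒰.core i \ ⋃ j : Fin 𝒰.card, ⋃ _ : j < i, 𝒰.core j
    with hC
  have hcore : ∀ i, MeasurableSet (𝒰.core i) := fun i => (𝒰.isCompact_core i).measurableSet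
  have hCm : ∀ i, MeasurableSet (C i) := fun i =>
    (hcore i).diff (MeasurableSet.iUnion fun j => MeasurableSet.iUnion fun _ => hcore j)
  have hdisj : ∀ i j, i < j → Disjoint (C i) (C j) := fun i j hij =>
    Set.disjoint_left.2 fun x hi hj => hj.2 (mem_iUnion₂.2 ⟨i, hij, hi.1⟩)
  have hpair : Pairwise (Function.onFun Disjoint fun i => B ∩ C i) := fun i j hij =>
    ((lt_or_gt_of_ne hij).elim (hdisj i j) fun h => (hdisj j i h).symm).mono
      inter_subset_right inter_subset_right
  have hcover : ⋃ i, B ∩ C i = B := by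
    rw [← inter_iUnion, inter_eq_left]
    intro x _
    have hex : ∃ i, x ∈ 𝒰.core i := by
      obtain ⟨i, hi⟩ := mem_iUnion.1 (𝒰.iUnion_interior.symm ▸ mem_univ x)
      exact ⟨i, interior_subset hi⟩
    obtain ⟨i, hi, hmin⟩ := WellFounded.has_min (wellFounded_lt (α := Fin 𝒰.card))
      {i | x ∈ 𝒰.core i} hex
    refine mem_iUnion.2 ⟨i, hi, fun h => ?_⟩
    obtain ⟨j, hj, hxj⟩ := mem_iUnion₂.1 h
    exact hmin j hxj hj
  have h1 : riemannianVolume 𝒰 B = ∑ i, chartVol (𝒰.chart i) (B ∩ C i) := by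
    rw [riemannianVolume, Measure.finsetSum_apply]
    refine Finset.sum_congr rfl fun i _ => ?_
    rw [Measure.restrict_apply hB]
    rfl
  rw [h1]
  conv_rhs => rw [← hcover, measure_iUnion hpair fun i => hB.inter (hCm i), tsum_fintype]
  refine Finset.sum_congr rfl fun i _ => ?_
  exact chartVol_eq (𝒰.chart_mem i) hφ (hB.inter (hCm i))
    (fun x hx => 𝒰.core_subset i hx.2.1) fun x hx => hBφ hx.1

lemma leb_image [PolishSpace M] [T2Space M] (𝒰 : CoordCover d M)
    {φ ψ : OpenPartialHomeomorph M (Model d)}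
    (hφ : φ ∈ IsManifold.maximalAtlas (𝓡 d) ∞ M) (hψ : ψ ∈ IsManifold.maximalAtlas (𝓡 d) ∞ M)
    {g : M → M} {B : Set M} (hB : MeasurableSet B) (hBψ : B ⊆ ψ.source) (hgB : MapsTo g B φ.source)
    (hinj : InjOn g B) (hg : MDifferentiable (𝓡 d) (𝓡 d) g) (hJ : Measurable (absDet d g)) :
    leb 𝒰 (g '' B) = ∫⁻ x in B, ENNReal.ofReal (absDet d g x) ∂(leb 𝒰) := by
  have hgBm : MeasurableSet (g '' B) :=
    hB.image_of_continuousOn_injOn hg.continuous.continuousOn hinj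
  have hgφ : g '' B ⊆ φ.source := by rintro _ ⟨y, hy, rfl⟩; exact hgB hy
  have hr : (riemannianVolume 𝒰).restrict B = (chartVol ψ).restrict B := by
    ext A hA
    rw [Measure.restrict_apply hA, Measure.restrict_apply hA]
    exact riemannianVolume_apply 𝒰 hψ (hA.inter hB) (inter_subset_right.trans hBψ)
  rw [leb, Measure.smul_apply, riemannianVolume_apply 𝒰 hφ hgBm hgφ,
    chartVol_image hφ hψ hB hBψ hgB hinj hg hJ, Measure.restrict_smul, lintegral_smul_measure, hr]

end ChartVolume

/-! ### The transfer operator preserves integrals. -/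

section TransferIntegral

variable {d : ℕ} {M : Type*} [TopologicalSpace M] [ChartedSpace (Model d) M]
  [IsManifold (𝓡 d) ∞ M] [CompactSpace M] [T2Space M]
  [Bundle.RiemannianBundle (fun x : M => TangentSpace (𝓡 d) x)]
  [IsContMDiffRiemannianBundle (𝓡 d) ∞ (Model d) (fun x : M => TangentSpace (𝓡 d) x)]
variable {𝒰 : CoordCover d M} {N : ℕ} {p : ℕ} {γ : ℝ≥0} {e : EuclideanEmbedding d M N}

lemma EuclideanEmbedding.polishSpace (e : EuclideanEmbedding d M N) : PolishSpace M :=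
  (e.contMDiff.continuous.isClosedEmbedding e.injective).polishSpace

lemma mfam_const {S : Type*} [TopologicalSpace S] {n : ℕ} (c : ℂ) (s₀ : S) (x₀ : M) :
    MFam d γ n (fun (_ : S) (_ : M) => c) s₀ x₀ :=
  ⟨_, IsManifold.chart_mem_maximalAtlas x₀, mem_chart_source (Model d) x₀, univ, isOpen_univ,
    trivial, FamCr.const c⟩

lemma absDet_pos {g : M → M} {y : M} (hg : Function.Injective (mder d g y)) :
    0 < absDet d g y := by
  rw [absDet_eq_linVol]
  exact div_pos (linVol_pos _ hg)
    (linVol_pos y (T := ContinuousLinearMap.id ℝ (Model d)) fun _ _ h => h)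

lemma measurable_absDet [MeasurableSpace M] [BorelSpace M] (hγ : γ ≤ 1)
    {g : CrSelf 𝒰 e (p + 1) γ} (hg : ∀ y, Function.Injective (mder d g y)) :
    Measurable (absDet d g) := by
  -- The quotient lemma with numerator 1 makes the reciprocal of the Jacobian continuous; inverting
  -- it gives back the Jacobian.
  have hc : Continuous fun y => (1 : ℂ) / (absDet d g y : ℂ) := by
    refine continuous_iff_continuousAt.2 fun y => ?_
    have h := (MFam.div_absDet (e := e) hγ (selfFam_eval g y)
      (mfam_const (n := p) (γ := γ) 1 g y) (fun s => s.mdifferentiable) (hg y)).continuousAt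
    exact ContinuousAt.comp (f := fun y => (g, y)) (x := y) h (by fun_prop)
  have h : absDet d g = fun y => (((1 : ℂ) / (absDet d g y : ℂ))⁻¹).re := by
    funext y; simp
  rw [h]
  exact Complex.measurable_re.comp hc.measurable.inv

/-- An immersive self-map is locally injective. -/
lemma exists_injOn_nhds (hγ : γ ≤ 1) {g : CrSelf 𝒰 e (p + 1) γ}
    (hg : ∀ y, Function.Injective (mder d g y)) (y₀ : M)
    {φ : OpenPartialHomeomorph M (Model d)} (hφ : φ ∈ IsManifold.maximalAtlas (𝓡 d) ∞ M)
    (hyφ : g y₀ ∈ φ.source) {T : Set M} (hT : T ∈ 𝓝 y₀) :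
    ∃ U : Set M, IsOpen U ∧ y₀ ∈ U ∧ U ⊆ T ∧ MapsTo g U φ.source ∧ InjOn g U := by
  obtain ⟨Y, hY, hyY, hYT, W, hW, hmW, h, -, hprop⟩ :=
    (selfFam_eval g y₀).exists_branch hγ (mfam_const (n := p) (γ := γ) 1 g y₀)
      g.mdifferentiable (hg y₀) hφ hyφ hT
  have hgc : Continuous g := g.mdifferentiable.continuous
  have hev : ∀ᶠ y in 𝓝 y₀, y ∈ Y ∧ g y ∈ φ.source ∧ (g, φ (g y)) ∈ W := by
    have hc : ContinuousAt (fun y => (g, φ (g y))) y₀ :=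
      continuousAt_const.prodMk (ContinuousAt.comp (f := g) (x := y₀) (φ.continuousAt hyφ)
        hgc.continuousAt)
    exact (hY.eventually_mem hyY).and
      ((hgc.continuousAt.eventually (φ.open_source.eventually_mem hyφ)).and
        (hc.eventually (hW.eventually_mem hmW)))
  obtain ⟨U, hU, hUo, hyU⟩ := eventually_nhds_iff.1 hev
  refine ⟨U, hUo, hyU, fun y hy => hYT (hU y hy).1, fun y hy => (hU y hy).2.1, ?_⟩
  intro y hy y' hy' heq
  obtain ⟨h1, h2, h3⟩ := hU y hy
  have h4 := (hprop _ h3).2.2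
  rw [h4 y h1 (φ.left_inv h2).symm, h4 y' (hU y' hy').1 (heq.symm.trans (φ.left_inv h2).symm)]

/-- Finiteness of the fibers matters: `finsum` is 0 on infinite supports and is not additive there.
-/
lemma transferFun_add {g : M → M} (hfin : ∀ x, (g ⁻¹' {x}).Finite) (w₁ w₂ : M → ℂ) :
    transferFun d g (w₁ + w₂) = transferFun d g w₁ + transferFun d g w₂ := by
  funext x
  simp only [transferFun, Pi.add_apply, add_div]
  exact finsum_mem_add_distrib (hfin x)

variable [MeasurableSpace M] [BorelSpace M]

/-- The integral of the transfer operator applied to a function supported on a set on which the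
map is injective. -/
lemma integral_transferFun_indicator (hγ : γ ≤ 1) {g : CrSelf 𝒰 e (p + 1) γ}
    (hg : ∀ y, Function.Injective (mder d g y)) {φ ψ : OpenPartialHomeomorph M (Model d)}
    (hφ : φ ∈ IsManifold.maximalAtlas (𝓡 d) ∞ M) (hψ : ψ ∈ IsManifold.maximalAtlas (𝓡 d) ∞ M)
    {B : Set M} (hB : MeasurableSet B) (hBψ : B ⊆ ψ.source) (hgB : MapsTo g B φ.source)
    (hinj : InjOn g B) {w : M → ℂ} (hw : Integrable w (leb 𝒰)) :
    Integrable (transferFun d g (B.indicator w)) (leb 𝒰) ∧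
      ∫ x, transferFun d g (B.indicator w) x ∂(leb 𝒰) = ∫ x in B, w x ∂(leb 𝒰) := by
  have : PolishSpace M := e.polishSpace
  have hgc : Continuous g := g.mdifferentiable.continuous
  have hJ := measurable_absDet hγ hg
  have hgBm : MeasurableSet (g '' B) := hB.image_of_continuousOn_injOn hgc.continuousOn hinj
  set K := transferFun d g (B.indicator w) with hK
  -- Of the fiber through `y`, only `y` lies in `B`; the indicator removes all other terms.
  have hKg : ∀ y ∈ B, K (g y) = w y / (absDet d g y : ℂ) := by
    intro y hy
    have h1 : K (g y) = ∑ᶠ (y' : M) (_ : y' ∈ ({y} : Set M)),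
        B.indicator w y' / (absDet d g y' : ℂ) := by
      simp only [hK, transferFun]
      refine finsum_congr fun y' => ?_
      by_cases hyy : y' = y
      · subst hyy; simp
      · by_cases hy' : y' ∈ B
        · have : g y' ≠ g y := fun h => hyy (hinj hy' hy h)
          simp [this, hyy]
        · simp [hyy, indicator_of_notMem hy']
    rw [h1, finsum_mem_singleton, indicator_of_mem hy]
  have hK0 : ∀ x, x ∉ g '' B → K x = 0 := by
    intro x hx
    simp only [hK, transferFun]
    refine finsum_mem_eq_zero_of_forall_eq_zero (s := {y | g y = x}) fun y hy => ?_
    have : y ∉ B := fun h => hx ⟨y, h, hy⟩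
    simp [indicator_of_notMem this]
  have hJK : ∀ y ∈ B, absDet d g y • K (g y) = w y := by
    intro y hy
    have h0 : (absDet d g y : ℂ) ≠ 0 := Complex.ofReal_ne_zero.2 (absDet_pos (hg y)).ne'
    rw [hKg y hy, Complex.real_smul, mul_div_cancel₀ _ h0]
  have hmain := setIntegral_image_eq (μ := leb 𝒰) (J := absDet d g) hB
    (hgc.continuousOn.measurableEmbedding hB hinj) hJ (fun y => (absDet_pos (hg y)).le)
    (fun A hA hAm => leb_image 𝒰 hφ hψ hAm (hA.trans hBψ) (hgB.mono_left hA) (hinj.mono hA)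
      g.mdifferentiable hJ) K
  constructor
  · have h1 : IntegrableOn K (g '' B) (leb 𝒰) :=
      hmain.1.2 ((integrableOn_congr_fun hJK hB).2 hw.integrableOn)
    exact (integrableOn_iff_integrable_of_support_subset fun x hx => by
      by_contra h; exact hx (hK0 x h)).1 h1
  · rw [← setIntegral_eq_integral_of_forall_compl_eq_zero (s := g '' B) hK0, hmain.2]
    exact setIntegral_congr_fun hB hJK

/-- The transfer operator of an immersive self-map preserves integrals. -/
lemma integral_transferFun (hγ : γ ≤ 1) {g : CrSelf 𝒰 e (p + 1) γ}
    (hg : ∀ y, Function.Injective (mder d g y)) (hfin : ∀ x, (g ⁻¹' {x}).Finite) {w : M → ℂ}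
    (hw : Integrable w (leb 𝒰)) :
    ∫ x, transferFun d g w x ∂(leb 𝒰) = ∫ x, w x ∂(leb 𝒰) := by
  -- The property is asked for all measurable subsets of `U`, so that over a union a set can be cut
  -- into two disjoint pieces. Integrability is carried along to add the integrals.
  have key := isCompact_univ.induction_on (X := M) (p := fun K => ∃ U, K ⊆ U ∧ MeasurableSet U ∧
      ∀ A ⊆ U, MeasurableSet A → Integrable (transferFun d g (A.indicator w)) (leb 𝒰) ∧
        ∫ x, transferFun d g (A.indicator w) x ∂(leb 𝒰) = ∫ x in A, w x ∂(leb 𝒰)) ?_ ?_ ?_ ?_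
  · obtain ⟨U, hU, -, h⟩ := key
    have := (h univ hU MeasurableSet.univ).2
    simpa using this
  · refine ⟨∅, Subset.rfl, MeasurableSet.empty, fun A hA _ => ?_⟩
    have h0 : transferFun d g (A.indicator w) = 0 := by
      funext x
      simp [transferFun, subset_empty_iff.1 hA]
    rw [h0, subset_empty_iff.1 hA]
    exact ⟨integrable_zero _ _ _, by simp⟩
  · rintro s t hst ⟨U, hU, h⟩
    exact ⟨U, hst.trans hU, h⟩
  · rintro s t ⟨U, hsU, hUm, hU⟩ ⟨V, htV, hVm, hV⟩
    refine ⟨U ∪ V, union_subset_union hsU htV, hUm.union hVm, fun A hA hAm => ?_⟩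
    have hdisj : Disjoint (A ∩ U) (A \ U) := disjoint_sdiff_right.mono_left inter_subset_right
    have h1 := hU (A ∩ U) inter_subset_right (hAm.inter hUm)
    have h2 := hV (A \ U) (fun x hx => (hA hx.1).resolve_left hx.2) (hAm.diff hUm)
    have h3 : transferFun d g (A.indicator w) =
        transferFun d g ((A ∩ U).indicator w) + transferFun d g ((A \ U).indicator w) := by
      rw [← transferFun_add hfin]
      congr 1
      conv_lhs => rw [← inter_union_sdiff A U]
      exact indicator_union_of_disjoint hdisj w
    refine ⟨by rw [h3]; exact h1.1.add h2.1, ?_⟩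
    rw [h3]
    conv_rhs => rw [← inter_union_sdiff A U]
    rw [setIntegral_union hdisj (hAm.diff hUm) hw.integrableOn hw.integrableOn, ← h1.2, ← h2.2]
    exact integral_add h1.1 h2.1
  · intro y _
    have hφ : chartAt (Model d) (g y) ∈ IsManifold.maximalAtlas (𝓡 d) ∞ M :=
      IsManifold.chart_mem_maximalAtlas _
    have hψ : chartAt (Model d) y ∈ IsManifold.maximalAtlas (𝓡 d) ∞ M :=
      IsManifold.chart_mem_maximalAtlas _
    obtain ⟨U, hU, hyU, hUT, hUm, hUi⟩ := exists_injOn_nhds hγ hg y hφ (mem_chart_source _ _)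
      (chart_source_mem_nhds (Model d) y)
    exact ⟨U, mem_nhdsWithin_of_mem_nhds (hU.mem_nhds hyU), U, Subset.rfl, hU.measurableSet,
      fun A hA hAm => integral_transferFun_indicator hγ hg hφ hψ hAm (hA.trans hUT)
        (hUm.mono_left hA) (hUi.mono hA) hw⟩

end TransferIntegral

/-! ### Constant fiber integrals and the base transfer operator. -/

section FiberIntegral

variable {d : ℕ} {M : Type*} [TopologicalSpace M] [ChartedSpace (Model d) M]
  [IsManifold (𝓡 d) ∞ M] [CompactSpace M]
  [Bundle.RiemannianBundle (fun x : M => TangentSpace (𝓡 d) x)]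
  [MeasurableSpace M] [BorelSpace M]
variable {𝒰 : CoordCover d M} {p : ℕ} {γ : ℝ≥0}
variable {Ω : Type*} [MeasurableSpace Ω] {P : Measure Ω}

variable (𝒰 p γ) in
/-- The integral with respect to the normalized volume as a bounded linear functional. -/
def integralCLM : CrFun ℂ 𝒰 p γ →L[ℂ] ℂ :=
  LinearMap.mkContinuous
    { toFun := fun u => ∫ x, u x ∂(leb 𝒰)
      map_add' := fun u v => integral_add u.integrable v.integrable
      map_smul' := fun c u => integral_const_mul c _ } ((leb 𝒰).real univ) fun u => by
        rw [mul_comm]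
        exact norm_integral_le_of_norm_le_const (Eventually.of_forall u.norm_apply_le)

lemma fiberIntegral_eq (u : Ω → CrFun ℂ 𝒰 p γ) (s : Ω) :
    fiberIntegral u s = integralCLM 𝒰 p γ (u s) := rfl

lemma aestronglyMeasurable_fiberIntegral {u : Ω → CrFun ℂ 𝒰 p γ}
    (hu : AEStronglyMeasurable u P) : AEStronglyMeasurable (fiberIntegral u) P :=
  (integralCLM 𝒰 p γ).continuous.comp_aestronglyMeasurable hu

/-- The constants are a finite-dimensional, hence closed, subspace of L^∞(Ω); the space in question
is their preimage under composition with the integral functional. -/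
lemma isClosed_constFiberIntegral [IsFiniteMeasure P] :
    IsClosed (constFiberIntegral P 𝒰 p γ : Set (Lp (CrFun ℂ 𝒰 p γ) ⊤ P)) := by
  have h1 : IsClosed (LinearMap.range (Lp.constL ⊤ P ℂ : ℂ →L[ℂ] Lp ℂ ⊤ P).toLinearMap :
      Set (Lp ℂ ⊤ P)) := Submodule.closed_of_finiteDimensional _
  have h2 : (constFiberIntegral P 𝒰 p γ : Set (Lp (CrFun ℂ 𝒰 p γ) ⊤ P)) =
      (integralCLM 𝒰 p γ).compLpL ⊤ P ⁻¹'
        (LinearMap.range (Lp.constL ⊤ P ℂ : ℂ →L[ℂ] Lp ℂ ⊤ P).toLinearMap) := by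
    ext u
    refine exists_congr fun c => ?_
    have hc : ((Lp.constL ⊤ P ℂ : ℂ →L[ℂ] Lp ℂ ⊤ P) c : Ω → ℂ) =ᵐ[P] fun _ => c :=
      Lp.coeFn_const ⊤ P c
    have hu := (integralCLM 𝒰 p γ).coeFn_compLpL (p := ⊤) (μ := P) u
    constructor
    · intro h
      refine Lp.ext ?_
      filter_upwards [h, hc, hu] with s h1 h2 h3
      change ((Lp.constL ⊤ P ℂ : ℂ →L[ℂ] Lp ℂ ⊤ P) c : Ω → ℂ) s = _
      rw [h2, h3, ← h1]
      rfl
    · intro h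
      have h' : (Lp.constL ⊤ P ℂ : ℂ →L[ℂ] Lp ℂ ⊤ P) c = (integralCLM 𝒰 p γ).compLpL ⊤ P u := h
      rw [← h'] at hu
      filter_upwards [hc, hu] with s h1 h2
      rw [fiberIntegral_eq, ← h2, h1]
  rw [h2]
  exact h1.preimage (ContinuousLinearMap.continuous _)

/-- The transfer operator of a measure-preserving map fixes constants. -/
lemma IsBaseTransfer.ae_eq_const [IsFiniteMeasure P] {θ : Ω → Ω} (hθ : MeasurePreserving θ P P)
    {u v : Ω → ℂ} (h : IsBaseTransfer θ P u v) {c : ℂ} (hu : ∀ᵐ s ∂P, u s = c) :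
    ∀ᵐ s ∂P, v s = c := by
  have hv : Integrable v P := h.1.integrable le_top
  -- Testing against the indicator of A turns the integral of `v` over A into c ∫ 1_A ∘ θ dP = c
  -- P(A), by invariance of P.
  refine Integrable.ae_eq_of_forall_setIntegral_eq v (fun _ => c) hv (integrable_const c)
    fun A hA _ => ?_
  have hφ : Integrable (A.indicator fun _ => (1 : ℂ)) P := (integrable_const 1).indicator hA
  have h1 := h.2 _ hφ
  have h2 : ∫ s, u s * A.indicator (fun _ => (1 : ℂ)) (θ s) ∂P =
      ∫ s, c * A.indicator (fun _ => (1 : ℂ)) (θ s) ∂P := by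
    refine integral_congr_ae ?_
    filter_upwards [hu] with s hs
    rw [hs]
  have h3 : ∫ s, A.indicator (fun _ => (1 : ℂ)) (θ s) ∂P =
      ∫ s, A.indicator (fun _ => (1 : ℂ)) s ∂P := by
    conv_rhs => rw [← hθ.map_eq]
    rw [integral_map hθ.measurable.aemeasurable]
    rw [hθ.map_eq]
    exact hφ.aestronglyMeasurable
  rw [h2, integral_const_mul, h3, ← integral_const_mul] at h1
  rw [← integral_indicator hA, ← integral_indicator hA]
  have e : ∀ w : Ω → ℂ, (fun s => w s * A.indicator (fun _ => (1 : ℂ)) s) = A.indicator w := by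
    intro w; funext s
    by_cases hs : s ∈ A <;> simp [hs]
  rw [e, e fun _ => c] at h1
  exact h1

end FiberIntegral

/-! ### Boundedness, continuity and measurability of the transfer operators. -/

section Operators

variable {d : ℕ} {M : Type*} [TopologicalSpace M] [ChartedSpace (Model d) M]
  [IsManifold (𝓡 d) ∞ M] [CompactSpace M] [T2Space M]
  [Bundle.RiemannianBundle (fun x : M => TangentSpace (𝓡 d) x)]
  [IsContMDiffRiemannianBundle (𝓡 d) ∞ (Model d) (fun x : M => TangentSpace (𝓡 d) x)]
variable {𝒰 : CoordCover d M} {N : ℕ} {p : ℕ} {γ : ℝ≥0} {e : EuclideanEmbedding d M N}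

/-- The default value 0 never occurs for immersive maps: a C^{p+γ} family has members of class
C^{p+γ}, in particular at the base parameter. -/
lemma transferOp_coe (hγ : γ ≤ 1) {g : CrSelf 𝒰 e (p + 1) γ}
    (hg : ∀ y, Function.Injective (mder d g y)) (w : CrFun ℂ 𝒰 p γ) :
    (transferOp g w : M → ℂ) = transferFun d g w := by
  have h : IsCr 𝒰 p γ (transferFun d g w) :=
    (MFam.eventually_isCr hγ (fun x => (mfam_transferFun hγ hg w x).2) 𝒰).self_of_nhds
  have h1 : transferOp g w = (⟨transferFun d g w, h⟩ : CrFun ℂ 𝒰 p γ) := dif_pos h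
  rw [h1]
  rfl

lemma finite_fiber (hγ : γ ≤ 1) {g : CrSelf 𝒰 e (p + 1) γ}
    (hg : ∀ y, Function.Injective (mder d g y)) (x : M) : (g ⁻¹' {x}).Finite :=
  (mfam_transferFun hγ hg 0 x).1

lemma transferOp_add (hγ : γ ≤ 1) {g : CrSelf 𝒰 e (p + 1) γ}
    (hg : ∀ y, Function.Injective (mder d g y)) (w₁ w₂ : CrFun ℂ 𝒰 p γ) :
    transferOp g (w₁ + w₂) = transferOp g w₁ + transferOp g w₂ := by
  refine DFunLike.coe_injective ?_
  rw [CrFun.coe_add, transferOp_coe hγ hg, transferOp_coe hγ hg, transferOp_coe hγ hg,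
    CrFun.coe_add, transferFun_add (finite_fiber hγ hg)]

lemma transferOp_smul (hγ : γ ≤ 1) {g : CrSelf 𝒰 e (p + 1) γ}
    (hg : ∀ y, Function.Injective (mder d g y)) (c : ℂ) (w : CrFun ℂ 𝒰 p γ) :
    transferOp g (c • w) = c • transferOp g w := by
  refine DFunLike.coe_injective ?_
  rw [CrFun.coe_smul, transferOp_coe hγ hg, transferOp_coe hγ hg, CrFun.coe_smul]
  funext x
  simp only [transferFun, Pi.smul_apply, smul_eq_mul, mul_div_assoc]
  exact (mul_finsum_mem _ c).symm

lemma integralCLM_transferOp [MeasurableSpace M] [BorelSpace M] (hγ : γ ≤ 1)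
    {g : CrSelf 𝒰 e (p + 1) γ} (hg : ∀ y, Function.Injective (mder d g y)) (w : CrFun ℂ 𝒰 p γ) :
    integralCLM 𝒰 p γ (transferOp g w) = integralCLM 𝒰 p γ w := by
  change ∫ x, transferOp g w x ∂(leb 𝒰) = ∫ x, w x ∂(leb 𝒰)
  rw [transferOp_coe hγ hg]
  exact integral_transferFun hγ hg (finite_fiber hγ hg) w.integrable

/-- The transfer operators of the maps close to an expanding map are uniformly bounded. -/
lemma eventually_norm_transferOp_le (hγ : γ ≤ 1) {f₀ : CrSelf 𝒰 e (p + 1) γ}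
    (hf₀ : IsExpanding d f₀) : ∃ C : ℝ, 0 ≤ C ∧
      ∀ᶠ g : CrSelf 𝒰 e (p + 1) γ in 𝓝 f₀, ∀ w : CrFun ℂ 𝒰 p γ, ‖transferOp g w‖ ≤ C * ‖w‖ := by
  -- The local bound is used at w = 0: it holds for g near f₀ and ‖w‖ < δ with one constant, and
  -- homogeneity in w extends it to all w.
  obtain ⟨C, hC, hev⟩ := MFam.eventually_crENorm_le hγ
    (fun x => (mfam_transferFun hγ hf₀.injective_mder (0 : CrFun ℂ 𝒰 p γ) x).2) 𝒰
  rw [nhds_prod_eq, eventually_prod_iff] at hev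
  obtain ⟨A, hA, B, hB, hAB⟩ := hev
  obtain ⟨δ, hδ, hball⟩ := Metric.eventually_nhds_iff.1 hB
  refine ⟨C * (2 / δ), by positivity, ?_⟩
  filter_upwards [hA, hf₀.eventually hγ] with g hgA hg w
  have hinj := hg.injective_mder
  by_cases hw : ‖w‖ = 0
  · have h0 : w = 0 := norm_eq_zero.1 hw
    have h1 : transferOp g (0 : CrFun ℂ 𝒰 p γ) = 0 := by
      simpa using transferOp_smul hγ hinj 0 (0 : CrFun ℂ 𝒰 p γ)
    simp [h0, h1]
  · have hwpos : 0 < ‖w‖ := lt_of_le_of_ne (norm_nonneg w) (Ne.symm hw)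
    -- The factor c scales w to norm δ / 2; dividing the bound C by c gives C (2 / δ) ‖w‖.
    set c : ℝ := δ / 2 / ‖w‖ with hc
    have hcpos : 0 < c := by positivity
    have hcn : ‖(c : ℂ)‖ = c := by rw [Complex.norm_real, Real.norm_of_nonneg hcpos.le]
    have hsmall : dist ((c : ℂ) • w) 0 < δ := by
      rw [dist_zero_right, norm_smul, hcn, hc, div_mul_cancel₀ _ hw]
      linarith
    have h1 := hAB hgA (hball hsmall)
    rw [← transferOp_coe hγ hinj] at h1
    have h2 := CrFun.norm_le_of_crENorm_le hC h1
    rw [transferOp_smul hγ hinj, norm_smul, hcn] at h2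
    have h3 : ‖transferOp g w‖ ≤ C / c := by
      rw [le_div_iff₀ hcpos, mul_comm]; exact h2
    refine h3.trans (le_of_eq ?_)
    rw [hc]
    field_simp

/-- In integer smoothness the transfer operator is jointly continuous at expanding maps. -/
lemma continuousAt_transferOp {g : CrSelf 𝒰 e (p + 1) 0} (hg : IsExpanding d g)
    (w : CrFun ℂ 𝒰 p 0) :
    ContinuousAt (fun s : CrSelf 𝒰 e (p + 1) 0 × CrFun ℂ 𝒰 p 0 => transferOp s.1 s.2) (g, w) := by
  have hγ : (0 : ℝ≥0) ≤ 1 := zero_le_one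
  rw [ContinuousAt, tendsto_iff_norm_sub_tendsto_zero, Metric.tendsto_nhds]
  intro δ hδ
  have h1 := MFam.eventually_crENorm_sub_le
    (fun x => (mfam_transferFun hγ hg.injective_mder w x).2) 𝒰 (half_pos hδ)
  have h2 : ∀ᶠ s : CrSelf 𝒰 e (p + 1) 0 × CrFun ℂ 𝒰 p 0 in 𝓝 (g, w), IsExpanding d s.1 :=
    have h3 : Tendsto Prod.fst (𝓝 (g, w)) (𝓝 g) := continuousAt_fst
    h3.eventually (hg.eventually hγ)
  filter_upwards [h1, h2] with s hs hs2
  have h3 : ‖transferOp s.1 s.2 - transferOp g w‖ ≤ δ / 2 := by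
    refine CrFun.norm_le_of_crENorm_le (half_pos hδ).le ?_
    have e1 : ((transferOp s.1 s.2 - transferOp g w : CrFun ℂ 𝒰 p 0) : M → ℂ) =
        transferFun d s.1 s.2 - transferFun d g w := by
      rw [sub_eq_add_neg, CrFun.coe_add, CrFun.coe_neg, transferOp_coe hγ hs2.injective_mder,
        transferOp_coe hγ hg.injective_mder, ← sub_eq_add_neg]
    rw [e1]
    exact hs
  rw [dist_zero_right, norm_norm]
  linarith

variable {Ω : Type*} [MeasurableSpace Ω] {P : Measure Ω}

/-- A map that is continuous at the points of an open ball preserves measurability of functions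
with values in a smaller ball. -/
lemma aestronglyMeasurable_comp_of_ball {X Y Z : Type*} [PseudoMetricSpace X] [TopologicalSpace Y]
    [NormedAddCommGroup Z] [NormedSpace ℝ Z] {Φ : X × Y → Z} {x₀ : X} {r : ℝ}
    (hΦ : ∀ x y, dist x x₀ < r → ContinuousAt Φ (x, y)) {f : Ω → X} {u : Ω → Y}
    (hf : StronglyMeasurable f) (hu : AEStronglyMeasurable u P)
    (h : ∀ᵐ s ∂P, dist (f s) x₀ < r / 2) :
    AEStronglyMeasurable (fun s => Φ (f s, u s)) P := by
  -- Nothing is known of Φ far from `x₀`. The cutoff χ makes χ · Φ continuous everywhere and is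
  -- positive almost surely along `f`, so it can be divided out after composition.
  set χ : X → ℝ := fun x => max 0 (r / 2 - dist x x₀) with hχ
  have hχc : Continuous χ := by fun_prop
  have hc : Continuous fun t : X × Y => χ t.1 • Φ t := by
    refine continuous_iff_continuousAt.2 fun t => ?_
    rcases le_or_gt (dist t.1 x₀) (r / 2) with ht | ht
    · rcases lt_or_ge 0 r with hr | hr
      · exact (hχc.continuousAt.comp continuousAt_fst).smul (hΦ t.1 t.2 (by linarith))
      · have h0 : ∀ x, χ x = 0 := fun x => max_eq_left (by linarith [dist_nonneg (x := x) (y := x₀)])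
        simp only [h0, zero_smul]
        exact continuousAt_const
    · have hev : ∀ᶠ t' : X × Y in 𝓝 t, r / 2 < dist t'.1 x₀ :=
        (by fun_prop : Continuous fun t' : X × Y => dist t'.1 x₀).continuousAt.eventually
          (lt_mem_nhds ht)
      refine (continuousAt_const (y := (0 : Z))).congr ?_
      filter_upwards [hev] with t' ht'
      have : χ t'.1 = 0 := max_eq_left (by linarith)
      rw [this, zero_smul]
  have h1 : AEStronglyMeasurable (fun s => χ (f s) • Φ (f s, u s)) P :=
    hc.comp_aestronglyMeasurable (hf.aestronglyMeasurable.prodMk hu)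
  have h2 : AEStronglyMeasurable (fun s => (χ (f s))⁻¹) P :=
    ((hχc.comp_stronglyMeasurable hf).measurable.inv).aestronglyMeasurable
  refine (h2.smul h1).congr ?_
  filter_upwards [h] with s hs
  have hpos : 0 < χ (f s) := lt_max_of_lt_right (by linarith)
  change (χ (f s))⁻¹ • (χ (f s) • Φ (f s, u s)) = _
  rw [smul_smul, inv_mul_cancel₀ hpos.ne', one_smul]

lemma aestronglyMeasurable_fiberTransfer (hγ : γ = 0) {f₀ : CrSelf 𝒰 e (p + 1) γ} {r : ℝ}
    (hr : ∀ g : CrSelf 𝒰 e (p + 1) γ, dist g f₀ < r → IsExpanding d g)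
    {f : Ω → CrSelf 𝒰 e (p + 1) γ} (hf : StronglyMeasurable f)
    (h : ∀ᵐ s ∂P, dist (f s) f₀ < r / 2) {u : Ω → CrFun ℂ 𝒰 p γ} (hu : AEStronglyMeasurable u P) :
    AEStronglyMeasurable (fiberTransfer f u) P := by
  subst hγ
  exact aestronglyMeasurable_comp_of_ball
    (Φ := fun s : CrSelf 𝒰 e (p + 1) 0 × CrFun ℂ 𝒰 p 0 => transferOp s.1 s.2)
    (fun g w hg => continuousAt_transferOp (hr g hg) w) hf hu h

lemma memLp_fiberTransfer {f : Ω → CrSelf 𝒰 e (p + 1) γ} {C : ℝ} (hC : 0 ≤ C)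
    (hb : ∀ᵐ s ∂P, ∀ w : CrFun ℂ 𝒰 p γ, ‖transferOp (f s) w‖ ≤ C * ‖w‖)
    (u : Lp (CrFun ℂ 𝒰 p γ) ⊤ P) (hm : AEStronglyMeasurable (fiberTransfer f u) P) :
    MemLp (fiberTransfer f u) ⊤ P := by
  refine memLp_top_of_bound hm (C * ‖u‖) ?_
  have hu : ∀ᵐ s ∂P, ‖u s‖ ≤ ‖u‖ := by
    have h1 := ae_le_eLpNormEssSup (f := u) (μ := P)
    filter_upwards [h1] with s hs
    rw [Lp.norm_def, eLpNorm_exponent_top]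
    have h2 := (Lp.memLp u).2
    rw [eLpNorm_exponent_top] at h2
    have := ENNReal.toReal_mono h2.ne hs
    rwa [toReal_enorm] at this
  filter_upwards [hb, hu] with s h1 h2
  exact (h1 _).trans (mul_le_mul_of_nonneg_left h2 hC)

/-- The fiberwise transfer operators as a bounded operator. -/
lemma exists_fiberTransfer_clm (hγ : γ ≤ 1) {f : Ω → CrSelf 𝒰 e (p + 1) γ}
    (hexp : ∀ᵐ s ∂P, IsExpanding d (f s)) {C : ℝ}
    (hb : ∀ᵐ s ∂P, ∀ w : CrFun ℂ 𝒰 p γ, ‖transferOp (f s) w‖ ≤ C * ‖w‖)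
    (hm : ∀ u : Lp (CrFun ℂ 𝒰 p γ) ⊤ P, MemLp (fiberTransfer f u) ⊤ P) :
    ∃ T : Lp (CrFun ℂ 𝒰 p γ) ⊤ P →L[ℂ] Lp (CrFun ℂ 𝒰 p γ) ⊤ P, ∀ u, T u = (hm u).toLp (fiberTransfer f u) := by
  refine ⟨LinearMap.mkContinuous
    { toFun := fun u => (hm u).toLp (fiberTransfer f u)
      map_add' := fun u v => Lp.ext ?_
      map_smul' := fun c u => Lp.ext ?_ } C fun u => ?_, fun u => rfl⟩
  · filter_upwards [(hm (u + v)).coeFn_toLp, (hm u).coeFn_toLp, (hm v).coeFn_toLp,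
      Lp.coeFn_add u v, Lp.coeFn_add (hm u).toLp (hm v).toLp, hexp] with s h1 h2 h3 h4 h5 h6
    rw [h1, h5, Pi.add_apply, h2, h3]
    simp only [fiberTransfer]
    rw [h4]
    exact transferOp_add hγ h6.injective_mder _ _
  · filter_upwards [(hm (c • u)).coeFn_toLp, (hm u).coeFn_toLp, Lp.coeFn_smul c u,
      Lp.coeFn_smul c (hm u).toLp, hexp] with s h1 h2 h3 h4 h5
    rw [RingHom.id_apply, h1, h4, Pi.smul_apply, h2]
    simp only [fiberTransfer]
    rw [h3]
    exact transferOp_smul hγ h5.injective_mder _ _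
  · refine Lp.norm_le_mul_norm_of_ae_le_mul ?_
    filter_upwards [(hm u).coeFn_toLp, hb] with s h1 h2
    change ‖((hm u).toLp (fiberTransfer f u) : Ω → CrFun ℂ 𝒰 p γ) s‖ ≤ _
    rw [h1]
    exact h2 _

end Operators

end SkewTransfer

end

/-! ### The main theorem. -/

open SkewTransfer in
theorem proposition5
    {d : ℕ} {M : Type*} [TopologicalSpace M] [T2Space M] [CompactSpace M]
    [ChartedSpace (Model d) M] [IsManifold (𝓡 d) ∞ M]
    [Bundle.RiemannianBundle (fun x : M => TangentSpace (𝓡 d) x)]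
    [IsContMDiffRiemannianBundle (𝓡 d) ∞ (Model d) (fun x : M => TangentSpace (𝓡 d) x)]
    [MeasurableSpace M] [BorelSpace M]
    (𝒰 : CoordCover d M) {N : ℕ} (e : EuclideanEmbedding d M N)
    -- regularity `r = p + 1 + γ > 1`
    (p : ℕ) (γ : ℝ≥0) (hγ : γ ≤ 1) (hr : 0 < (p : ℝ) + γ)
    {Ω : Type*} [MetricSpace Ω] [TopologicalSpace.SeparableSpace Ω]
    [MeasurableSpace Ω] [OpensMeasurableSpace Ω]
    (P : Measure Ω) [IsProbabilityMeasure P]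
    (θ : Ω → Ω) (hθ : MeasurePreserving θ P P)
    (ell : Lp (CrFun ℂ 𝒰 p γ) ⊤ P →L[ℂ] Lp (CrFun ℂ 𝒰 p γ) ⊤ P)
    (hell : IsTransferLift θ P ell)
    (f₀ : CrSelf 𝒰 e (p + 1) γ) (hf₀ : IsExpanding d f₀)
    (f : ℝ → Ω → CrSelf 𝒰 e (p + 1) γ) (hf : ∀ ε > 0, Continuous (f ε))
    (hlim : Tendsto (fun ε => essSup (fun s => edist (f ε s) f₀) P) (𝓝[>] 0) (𝓝 0)) :
    -- fiber integrals are measurable, and the space is a closed subspace, hence Banach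
    (∀ u : Lp (CrFun ℂ 𝒰 p γ) ⊤ P, AEStronglyMeasurable (fiberIntegral u) P) ∧
    IsClosed (constFiberIntegral P 𝒰 p γ : Set (Lp (CrFun ℂ 𝒰 p γ) ⊤ P)) ∧
    CompleteSpace (constFiberIntegral P 𝒰 p γ) ∧
    -- the lift of the base transfer operator preserves constant fiber integrals
    (∀ (u : Lp (CrFun ℂ 𝒰 p γ) ⊤ P) (c : ℂ), (∀ᵐ s ∂P, fiberIntegral u s = c) →
      ∀ᵐ s ∂P, fiberIntegral (ell u) s = c) ∧
    -- `L(g)` maps `C^{r-1}(M)` into itself for every expanding `g` of class `C^r`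
    (∀ g : CrSelf 𝒰 e (p + 1) γ, IsExpanding d g → ∀ x : M, (g ⁻¹' {x}).Finite ∧
      ∀ w : CrFun ℂ 𝒰 p γ, transferOp g w x = transferFun d g w x) ∧
    -- the fiber transfer operators preserve fiber integrals, and the skew-product transfer
    -- operator preserves the space
    (∀ ε > 0, (∀ᵐ s ∂P, IsExpanding d (f ε s)) → ∀ u : Lp (CrFun ℂ 𝒰 p γ) ⊤ P,
      (∀ᵐ s ∂P, fiberIntegral (fiberTransfer (f ε) u) s = fiberIntegral u s) ∧
      ∀ h : MemLp (fiberTransfer (f ε) u) ⊤ P, u ∈ constFiberIntegral P 𝒰 p γ →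
        h.toLp ∈ constFiberIntegral P 𝒰 p γ ∧ ell h.toLp ∈ constFiberIntegral P 𝒰 p γ) ∧
    -- for small `ε` the operators are uniformly bounded, and for integer `r` the skew-product
    -- transfer operator is a bounded operator on the whole of `L^∞` that preserves the space
    (∀ᶠ ε in 𝓝[>] (0 : ℝ),
      (∀ᵐ s ∂P, IsExpanding d (f ε s)) ∧
      (∃ C : ℝ, ∀ᵐ s ∂P, ∀ w : CrFun ℂ 𝒰 p γ, ‖transferOp (f ε s) w‖ ≤ C * ‖w‖) ∧
      (∀ u : Lp (CrFun ℂ 𝒰 p γ) ⊤ P, AEStronglyMeasurable (fiberTransfer (f ε) u) P →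
        ∃ h : MemLp (fiberTransfer (f ε) u) ⊤ P,
          u ∈ constFiberIntegral P 𝒰 p γ → ell h.toLp ∈ constFiberIntegral P 𝒰 p γ) ∧
      (γ = 0 → ∃ L : Lp (CrFun ℂ 𝒰 p γ) ⊤ P →L[ℂ] Lp (CrFun ℂ 𝒰 p γ) ⊤ P,
        (∀ u : Lp (CrFun ℂ 𝒰 p γ) ⊤ P, ∃ h : MemLp (fiberTransfer (f ε) u) ⊤ P,
          L u = ell h.toLp) ∧
        ∀ u ∈ constFiberIntegral P 𝒰 p γ, L u ∈ constFiberIntegral P 𝒰 p γ)) := by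
  have hconst : ∀ (u : Lp (CrFun ℂ 𝒰 p γ) ⊤ P) (c : ℂ), (∀ᵐ s ∂P, fiberIntegral u s = c) →
      ∀ᵐ s ∂P, fiberIntegral (ell u) s = c := fun u c hu =>
    (hell.apply_functional u (integralCLM 𝒰 p γ)).ae_eq_const hθ hu
  have hpres : ∀ F : Ω → CrSelf 𝒰 e (p + 1) γ, (∀ᵐ s ∂P, IsExpanding d (F s)) →
      ∀ u : Lp (CrFun ℂ 𝒰 p γ) ⊤ P,
      (∀ᵐ s ∂P, fiberIntegral (fiberTransfer F u) s = fiberIntegral u s) ∧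
      ∀ h : MemLp (fiberTransfer F u) ⊤ P, u ∈ constFiberIntegral P 𝒰 p γ →
        h.toLp ∈ constFiberIntegral P 𝒰 p γ ∧ ell h.toLp ∈ constFiberIntegral P 𝒰 p γ := by
    intro F hF u
    have h1 : ∀ᵐ s ∂P, fiberIntegral (fiberTransfer F u) s = fiberIntegral u s := by
      filter_upwards [hF] with s hs
      exact integralCLM_transferOp hγ hs.injective_mder (u s)
    refine ⟨h1, fun h hu => ?_⟩
    obtain ⟨c, hc⟩ := hu
    have h2 : ∀ᵐ s ∂P, fiberIntegral h.toLp s = c := by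
      filter_upwards [h1, hc, h.coeFn_toLp] with s h3 h4 h5
      rw [← h4, ← h3, fiberIntegral_eq, fiberIntegral_eq, h5]
    exact ⟨⟨c, h2⟩, ⟨c, hconst _ c h2⟩⟩
  refine ⟨fun u => aestronglyMeasurable_fiberIntegral (Lp.aestronglyMeasurable u),
    -- L^∞ is complete by `CrFun.completeSpace`, and the subspace is closed in it.
    isClosed_constFiberIntegral, isClosed_constFiberIntegral.completeSpace_coe, hconst,
    fun g hg x => ⟨finite_fiber hγ hg.injective_mder x, fun w =>
      congrFun (transferOp_coe hγ hg.injective_mder w) x⟩,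
    fun ε _ hε u => hpres (f ε) hε u, ?_⟩
  obtain ⟨C, hC, hbound⟩ := eventually_norm_transferOp_le hγ hf₀
  -- One ball around f₀ serves both expansion and the norm bound. The maps are kept in the ball of
  -- half the radius, which leaves room for the cutoff in the measurability argument.
  obtain ⟨r, hr, hball⟩ := Metric.eventually_nhds_iff.1 (hbound.and (hf₀.eventually hγ))
  have hsup : ∀ᶠ ε in 𝓝[>] (0 : ℝ),
      essSup (fun s => edist (f ε s) f₀) P < ENNReal.ofReal (r / 2) :=
    hlim.eventually (gt_mem_nhds (ENNReal.ofReal_pos.2 (half_pos hr)))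
  filter_upwards [hsup, self_mem_nhdsWithin] with ε hε hε0
  have hdist : ∀ᵐ s ∂P, dist (f ε s) f₀ < r / 2 := by
    filter_upwards [ae_lt_of_essSup_lt hε] with s hs
    rw [edist_dist] at hs
    exact (ENNReal.ofReal_lt_ofReal_iff (half_pos hr)).1 hs
  have hexp : ∀ᵐ s ∂P, IsExpanding d (f ε s) :=
    hdist.mono fun s hs => (hball (hs.trans (half_lt_self hr))).2
  have hb : ∀ᵐ s ∂P, ∀ w : CrFun ℂ 𝒰 p γ, ‖transferOp (f ε s) w‖ ≤ C * ‖w‖ :=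
    hdist.mono fun s hs => (hball (hs.trans (half_lt_self hr))).1
  refine ⟨hexp, ⟨C, hb⟩, fun u hm => ?_, fun hγ0 => ?_⟩
  · exact ⟨memLp_fiberTransfer hC hb u hm, fun hu => ((hpres _ hexp u).2 _ hu).2⟩
  · have hfm : StronglyMeasurable (f ε) := (hf ε hε0).stronglyMeasurable
    have hm : ∀ u : Lp (CrFun ℂ 𝒰 p γ) ⊤ P, MemLp (fiberTransfer (f ε) u) ⊤ P := fun u =>
      memLp_fiberTransfer hC hb u (aestronglyMeasurable_fiberTransfer hγ0
        (fun g hg => (hball hg).2) hfm hdist (Lp.aestronglyMeasurable u))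
    obtain ⟨T, hT⟩ := exists_fiberTransfer_clm hγ hexp hb hm
    refine ⟨ell.comp T, fun u => ⟨hm u, by rw [ContinuousLinearMap.comp_apply, hT]⟩,
      fun u hu => ?_⟩
    rw [ContinuousLinearMap.comp_apply, hT]
    exact ((hpres _ hexp u).2 (hm u) hu).2
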